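/- Setting. Let $E$ be a $d$-dimensional real Euclidean space with dual $E^*$. A flat-branched complex is a triple $(B,E,\rho)$, where $B$ is a finite semi-simplicial set of dimension $d$ and $\rho:C_1(B,\mathbb Z)\to E$ is a homomorphism that vanishes on boundaries and is such that for each $s\in B_d$ the vectors $\rho(e_{d,1}(s)),\dots,\rho(e_{d,d}(s))$ are linearly independent; here $e_{n,i}(s)$ is the edge of $s\in B_n$ from its vertex $0$ to its vertex $i$. Let $|B|$ be the geometric realization, $|s|\subset|B|$ the open cell of $s$, and $\alpha_s:|s|\to E$ the map sending the point with barycentric coordinates $(c_0,\dots,c_n)$ to $\sum_{i=1}^n c_i\,\rho(e_{n,i}(s))$. A continuous map $f:E\to|B|$ is an isometric winding if for each simplex $s$ the map $f$ restricts to a covering map $f^{-1}(|s|)\to|s|$ and $\alpha_s\circ f$ is a translation on each connected component of $f^{-1}(|s|)$. Put $(T_tf)(y)=f(y-t)$. The hull $\mathbb X(f_0)$ is the closure of $\{T_tf_0: t\in E\}$ in $C(E,|B|)$ with the compact-open topology. Let $f_0:E\to|B|$ be an isometric winding and let $\mu$ be a translation invariant Borel probability measure on $\mathbb X(f_0)$.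 Inner products are antilinear in the first argument, and $\widehat\varphi(k)=\int_E\varphi(y)e^{-2\pi i k\cdot y}\,dy$. For $x\in|B|$ and $\varphi$ in the Schwartz space $\mathcal S(E)$ let $$\Gamma_x(\varphi)(f)=\sum_{y\in f^{-1}(x)}\varphi(-y),\qquad f\in\mathbb X(f_0).$$ For points $x_1,\dots,x_m\in|B|$ and weights $w_1,\dots,w_m\in\mathbb C$, the diffraction measure $\eta$ is the positive tempered measure on $E^*$ with $$\sum_{p,q}\overline{w_p}w_q\langle\Gamma_{x_p}(\varphi_1),\Gamma_{x_q}(\varphi_2)\rangle=\int_{E^*}\overline{\widehat{\varphi_1}}\,\widehat{\varphi_2}\,d\eta\qquad(\varphi_1,\varphi_2\in\mathcal S(E)),$$ the matrix-valued diffraction measure $\zeta=(\zeta_{pq})$ is the tempered measure on $E^*$ with values in the positive semi-definite Hermitian $m\times m$ matrices such that $\langle\Gamma_{x_p}(\varphi_1),\Gamma_{x_q}(\varphi_2)\rangle=\int\overline{\widehat{\varphi_1}}\,\widehat{\varphi_2}\,d\zeta_{pq}$ for all $p,q,\varphi_1,\varphi_2$, and $\Theta:L^2(E^*,\zeta;\mathbb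 C^m)\to L^2(\mathbb X(f_0),\mu)$ is the linear isometric embedding with $\Theta(\widehat\varphi\otimes e_p)=\Gamma_{x_p}(\varphi)$ for all $\varphi\in\mathcal S(E)$ and all $p$, where $(e_p)$ is the canonical basis of $\mathbb C^m$. Proposition. (0) These objects exist: the sums $\Gamma_x(\varphi)(f)$ converge absolutely, $\Gamma_x(\varphi)\in L^2(\mathbb X(f_0),\mu)$, and for all $x_1,\dots,x_m$ and $w_1,\dots,w_m$ there are $\eta$, $\zeta$ and $\Theta$ as above. (1) Let $k\in E^*$ and let $\psi_k\in L^2(\mathbb X(f_0),\mu)$ be a normalized eigenfunction with eigenvalue $k$, that is, $\|\psi_k\|=1$ and for every $t\in E$ one has $\psi_k(T_{-t}f)=e^{2\pi i k\cdot t}\psi_k(f)$ for $\mu$-almost every $f$. Then there is a function $a_k:|B|\to\mathbb C$ (depending on $k$ and $\psi_k$, but not on any decoration points) such that for all $m$ and all $x_1,\dots,x_m\in|B|$ $$\langle\psi_k,\Theta(1_{\{k\}}\otimes e_p)\rangle=a_k(x_p),\qquad p=1,\dots,m .$$ (2) If moreover $\mu$ is ergodic, the same function $a_k$ satisfies, for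 all $m$, all $x_1,\dots,x_m\in|B|$ and all $w_1,\dots,w_m\in\mathbb C$, $$\eta(\{k\})=\Bigl|\sum_{p=1}^m w_p\,a_k(x_p)\Bigr|^2 .$$ -/

import Mathlib

open MeasureTheory Matrix
open scoped FourierTransform SchwartzMap InnerProductSpace ComplexOrder

universe u v

noncomputable section

namespace FlatBranched

/-! ### Semi-simplicial sets and their geometric realization -/

/-- A semi-simplicial set: a contravariant functor to sets from the category of the finite ordered
sets `[n] = {0 < 1 < ... < n}` and order preserving injective maps. -/
structure SemiSimplicialSet where
  /-- the set of simplices of dimension `n` -/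
  obj : ℕ → Type u
  /-- the map induced by an order preserving injection `[m] → [n]` -/
  map : ∀ {m n : ℕ}, (Fin (m + 1) ↪o Fin (n + 1)) → obj n → obj m
  map_id : ∀ {n : ℕ} (s : obj n), map (RelEmbedding.refl (· ≤ ·)) s = s
  map_comp : ∀ {l m n : ℕ} (θ : Fin (l + 1) ↪o Fin (m + 1)) (θ' : Fin (m + 1) ↪o Fin (n + 1))
    (s : obj n), map (θ.trans θ') s = map θ (map θ' s)

namespace SemiSimplicialSet

variable (B : SemiSimplicialSet.{u})

/-- The set of all simplices, of all dimensions. -/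
abbrev Simplex : Type u := Σ n : ℕ, B.obj n

/-- The disjoint union over all simplices `s` of the standard closed simplex of dimension
`dim s`, with the topology of a disjoint union. -/
abbrev Pieces : Type u := Σ s : B.Simplex, stdSimplex ℝ (Fin (s.1 + 1))

/-- The gluing relation of the geometric realization: a point `u` of the face `θ^* s` is identified
with the point `θ_* u` of `s`. -/
inductive Glue : B.Pieces → B.Pieces → Prop
  | glue {m n : ℕ} (θ : Fin (m + 1) ↪o Fin (n + 1)) (s : B.obj n)
      (u : stdSimplex ℝ (Fin (m + 1))) :
      Glue ⟨⟨m, B.map θ s⟩, u⟩ ⟨⟨n, s⟩, stdSimplex.map θ u⟩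

/-- The geometric realization `|B|`, with the quotient topology. -/
def Realization : Type u := Quot B.Glue

instance : TopologicalSpace B.Realization :=
  inferInstanceAs (TopologicalSpace (Quot B.Glue))

variable {B}

/-- The characteristic map of the simplex `s`, from the closed standard simplex to `|B|`. -/
def charMap (s : B.Simplex) (u : stdSimplex ℝ (Fin (s.1 + 1))) : B.Realization :=
  Quot.mk _ ⟨s, u⟩

/-- The (open) simplicial cell `|s|` of `|B|`: the image of the interior of the standard simplex. -/
def cell (s : B.Simplex) : Set B.Realization :=
  charMap s '' {u | ∀ i, 0 < u i}

/-- The injection `[1] → [n]` given by `0 ↦ 0`, `1 ↦ i + 1`, where `0 ≤ i < n`. -/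
def coEdge {n : ℕ} (i : Fin n) : Fin (1 + 1) ↪o Fin (n + 1) :=
  OrderEmbedding.ofStrictMono ![0, i.succ] (by
    intro a b hab
    fin_cases a <;> fin_cases b <;> simp_all)

/-- The reference edges of a simplex `s` of dimension `n`: `edge s i`, for `0 ≤ i < n`, is the edge
that joins the vertices number `0` and number `i + 1` of `s`. -/
def edge {n : ℕ} (s : B.obj n) (i : Fin n) : B.obj 1 := B.map (coEdge i) s

variable (B)

/-- The group of chains `C_n(B, ℤ)`. -/
abbrev Chains (n : ℕ) : Type u := B.obj n →₀ ℤ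

/-- The boundary `C_{n+1}(B, ℤ) → C_n(B, ℤ)`, the alternating sum of the faces. -/
def boundary (n : ℕ) : B.Chains (n + 1) →ₗ[ℤ] B.Chains n :=
  Finsupp.linearCombination ℤ fun s : B.obj (n + 1) =>
    ∑ i : Fin (n + 2), ((-1 : ℤ) ^ (i : ℕ)) • Finsupp.single (B.map (Fin.succAboveOrderEmb i) s) 1

end SemiSimplicialSet

open SemiSimplicialSet

/-! ### Flat-branched complexes and isometric windings -/

section Complex

variable (E : Type v) [NormedAddCommGroup E] [InnerProductSpace ℝ E]

/-- A flat-branched semi-simplicial complex `(B, E, ρ)` of dimension `d = dim E`: `B` is a finite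
semi-simplicial set of dimension `d` and `ρ : C_1(B, ℤ) → E` is a homomorphism that vanishes on
boundaries and is such that the reference edges of each `d`-simplex are sent to linearly
independent vectors. -/
structure FBSComplex extends SemiSimplicialSet.{u} where
  finite : ∀ n, Finite (obj n)
  nonempty_dim : Nonempty (obj (Module.finrank ℝ E))
  isEmpty_above : ∀ n, Module.finrank ℝ E < n → IsEmpty (obj n)
  ρ : toSemiSimplicialSet.Chains 1 →+ E
  ρ_boundary : ∀ c : toSemiSimplicialSet.Chains 2, ρ (toSemiSimplicialSet.boundary 1 c) = 0
  linearIndependent : ∀ s : obj (Module.finrank ℝ E),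
    LinearIndependent ℝ fun i : Fin (Module.finrank ℝ E) => ρ (Finsupp.single (edge s i) 1)

variable {E}

/-- The prototile space `|B|`. -/
abbrev FBSComplex.Space (K : FBSComplex.{u} E) : Type u := K.toSemiSimplicialSet.Realization

variable (K : FBSComplex.{u} E)

/-- The affine map sending the point of the standard `n`-simplex with barycentric coordinates
`u 0, ..., u n` to `∑_{i=1}^n u_i ρ(e_{n,i}(s))`. It maps the open standard simplex
onto the open affine simplex `σ_s`. -/
def FBSComplex.toAffine (s : K.Simplex) (u : stdSimplex ℝ (Fin (s.1 + 1))) : E :=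
  ∑ i : Fin s.1, u i.succ • K.ρ (Finsupp.single (edge s.2 i) 1)

open Classical in
/-- The map `α_s : |s| → σ_s ⊆ E`, the identification by barycentric coordinates (extended by `0`
outside of the cell `|s|`). The barycentric coordinates of a point of the open cell `|s|`
are unique. -/
def FBSComplex.α (s : K.Simplex) (x : K.Space) : E :=
  if h : ∃ u : stdSimplex ℝ (Fin (s.1 + 1)), (∀ i, 0 < u i) ∧ charMap s u = x then
    K.toAffine s h.choose
  else 0

/-- Isometric windings of a flat-branched complex. -/
structure IsIsometricWinding (f : C(E, K.Space)) : Prop where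
  /-- over each cell `|s|`, the map `f` is a covering map -/
  isCoveringMap : ∀ s : K.Simplex, IsCoveringMap ((cell s).restrictPreimage f)
  /-- `α_s ∘ f` is a translation on each connected component of `f⁻¹(|s|)` -/
  translation : ∀ s : K.Simplex, ∀ y ∈ f ⁻¹' cell s, ∃ t : E,
    ∀ z ∈ connectedComponentIn (f ⁻¹' cell s) y, K.α s (f z) = z + t

end Complex

/-! ### The hull and the action of translations -/

section Hull

variable {E : Type v} [NormedAddCommGroup E] {X : Type u} [TopologicalSpace X]

/-- The translate `T_t f : y ↦ f (y - t)`. -/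
def translate (t : E) (f : C(E, X)) : C(E, X) :=
  f.comp ⟨fun y => y - t, continuous_id.sub continuous_const⟩

theorem continuous_translate (t : E) : Continuous (translate t : C(E, X) → C(E, X)) :=
  ContinuousMap.continuous_precomp _

/-- The hull of `f₀`: the closure of its orbit in the compact-open topology. -/
def hullSet (f₀ : C(E, X)) : Set C(E, X) := closure (Set.range fun t : E => translate t f₀)

theorem translate_mem_hullSet {f₀ f : C(E, X)} (t : E) (hf : f ∈ hullSet f₀) :
    translate t f ∈ hullSet f₀ := by
  refine map_mem_closure (continuous_translate t) hf ?_
  rintro _ ⟨s, rfl⟩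
  refine ⟨s + t, ?_⟩
  ext y
  simp only [translate, ContinuousMap.comp_apply, ContinuousMap.coe_mk]
  congr 1
  abel

/-- The hull `𝕏(f₀)` as a type, with the compact-open topology and its Borel sets. -/
def Hull (f₀ : C(E, X)) : Type (max u v) := hullSet f₀

instance (f₀ : C(E, X)) : TopologicalSpace (Hull f₀) :=
  inferInstanceAs (TopologicalSpace (hullSet f₀))

instance (f₀ : C(E, X)) : MeasurableSpace (Hull f₀) := borel _

instance (f₀ : C(E, X)) : BorelSpace (Hull f₀) := ⟨rfl⟩

/-- The map `E → X` that an element of the hull is. -/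
def Hull.toMap {f₀ : C(E, X)} (f : Hull f₀) : C(E, X) := f.1

/-- The action of `E` on the hull by the translations `T_t`. -/
instance (f₀ : C(E, X)) : AddAction E (Hull f₀) where
  vadd t f := ⟨translate t f.1, translate_mem_hullSet t f.2⟩
  zero_vadd f := by
    refine Subtype.ext (ContinuousMap.ext fun y => ?_)
    change f.1 (y - 0) = f.1 y
    rw [sub_zero]
  add_vadd s t f := by
    refine Subtype.ext (ContinuousMap.ext fun y => ?_)
    change f.1 (y - (s + t)) = f.1 (y - s - t)
    rw [sub_sub]

variable [InnerProductSpace ℝ E]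

/-- The function `Γ_x(φ) : f ↦ ∑_{y ∈ f⁻¹(x)} φ(-y)` on the hull. -/
def Γ (f₀ : C(E, X)) (x : X) (φ : 𝓢(E, ℂ)) (f : Hull f₀) : ℂ :=
  ∑' y : (f.toMap ⁻¹' {x} : Set E), φ (-(y : E))

/-- `ψ` is a normalized eigenfunction, for the eigenvalue `k`, of the action of the translations on
`L²(𝕏(f₀), μ)`, where `(T_t ψ)(f) = ψ(T_{-t} f)`:
`‖ψ‖ = 1` and `T_t ψ = exp(2πi k·t) ψ` for every `t ∈ E`. Here the dual space `E^*` is identified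
with the Euclidean space `E` by means of the inner product. -/
structure IsNormalizedEigenfunction {f₀ : C(E, X)} (μ : Measure (Hull f₀)) (k : E)
    (ψ : Lp ℂ 2 μ) : Prop where
  norm_eq_one : ‖ψ‖ = 1
  eigen : ∀ t : E, (fun f : Hull f₀ => ψ (-t +ᵥ f)) =ᵐ[μ]
    fun f => Complex.exp (2 * Real.pi * Complex.I * (⟪k, t⟫_ℝ : ℝ)) * ψ f

end Hull

/-! ### Matrix-valued measures and their `L²` spaces -/

section MatrixMeasure

variable (E : Type v) [NormedAddCommGroup E] [MeasurableSpace E]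

/-- A tempered measure `ζ` on `E` with values in the positive semi-definite Hermitian `m × m`
matrices. It is given by its trace measure `tr ζ`, a tempered measure, and by the density
`dζ / d(tr ζ)`, a measurable function with values in the positive semi-definite matrices,
of trace one almost everywhere: `ζ_pq(A) = ∫_A (dζ / d(tr ζ))_pq d(tr ζ)` for bounded Borel `A`. -/
structure MatrixMeasure (m : ℕ) where
  /-- the trace measure -/
  tr : Measure E
  /-- the density with respect to the trace measure -/
  density : E → Matrix (Fin m) (Fin m) ℂ
  tempered : tr.HasTemperateGrowth
  measurable_density : ∀ p q, Measurable fun k => density k p q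
  posSemidef : ∀ k, (density k).PosSemidef
  trace_density : ∀ᵐ k ∂tr, (density k).trace = 1

variable {E}

namespace MatrixMeasure

variable {m : ℕ} (ζ : MatrixMeasure E m)

/-- The density of `⟨g, h⟩` with respect to the trace measure. -/
def form (g h : E → Fin m → ℂ) (k : E) : ℂ := star (g k) ⬝ᵥ (ζ.density k *ᵥ h k)

theorem form_add_left (g g' h : E → Fin m → ℂ) :
    ζ.form (g + g') h = ζ.form g h + ζ.form g' h := by
  funext k; simp [form, add_dotProduct]

theorem form_smul_left (c : ℂ) (g h : E → Fin m → ℂ) :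
    ζ.form (c • g) h = star c • ζ.form g h := by
  funext k; simp [form, smul_dotProduct]

theorem form_add_right (g h h' : E → Fin m → ℂ) :
    ζ.form g (h + h') = ζ.form g h + ζ.form g h' := by
  funext k; simp [form, mulVec_add, dotProduct_add]

theorem form_smul_right (c : ℂ) (g h : E → Fin m → ℂ) :
    ζ.form g (c • h) = c • ζ.form g h := by
  funext k; simp [form, mulVec_smul, dotProduct_smul]

theorem star_form (g h : E → Fin m → ℂ) (k : E) : star (ζ.form g h k) = ζ.form h g k := by
  have hH : (ζ.density k)ᴴ = ζ.density k := (ζ.posSemidef k).isHermitian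
  simp only [form]
  rw [← star_dotProduct_star, star_star, star_mulVec, hH, dotProduct_mulVec]

theorem form_self_nonneg (g : E → Fin m → ℂ) (k : E) : 0 ≤ ζ.form g g k :=
  (ζ.posSemidef k).dotProduct_mulVec_nonneg _

theorem norm_form_le (g h : E → Fin m → ℂ) (k : E) :
    ‖ζ.form g h k‖ ≤ ‖ζ.form g g k‖ + ‖ζ.form h h k‖ := by
  have key : ∀ c : ℂ, star c * c = 1 →
      0 ≤ (ζ.form g g k).re + (ζ.form h h k).re + 2 * (c * ζ.form g h k).re := by
    intro c hc
    have h0 := (Complex.le_def.1 (ζ.form_self_nonneg (g + c • h) k)).1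
    have h1 : star (ζ.form g h k) = ζ.form h g k := ζ.star_form g h k
    rw [form_add_left, form_add_right, form_add_right, form_smul_left, form_smul_left,
      form_smul_right, form_smul_right] at h0
    simp only [Pi.add_apply, Pi.smul_apply, smul_eq_mul, ← mul_assoc, hc, one_mul] at h0
    rw [← h1] at h0
    have h2 : (star c * star (ζ.form g h k)).re = (c * ζ.form g h k).re := by
      simp
    simp only [Complex.add_re, h2, Complex.zero_re] at h0
    linarith
  have hg := Complex.re_le_norm (ζ.form g g k)
  have hh := Complex.re_le_norm (ζ.form h h k)
  have k1 := key 1 (by simp)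
  have k2 := key (-1) (by simp)
  have k3 := key Complex.I (by simp)
  have k4 := key (-Complex.I) (by simp)
  simp only [one_mul, neg_mul, Complex.neg_re, Complex.I_mul_re] at k1 k2 k3 k4
  refine (Complex.norm_le_abs_re_add_abs_im _).trans ?_
  have a1 : |(ζ.form g h k).re| ≤ ((ζ.form g g k).re + (ζ.form h h k).re) / 2 := by
    rw [abs_le]; constructor <;> linarith
  have a2 : |(ζ.form g h k).im| ≤ ((ζ.form g g k).re + (ζ.form h h k).re) / 2 := by
    rw [abs_le]; constructor <;> linarith
  linarith

theorem aestronglyMeasurable_form {g h : E → Fin m → ℂ} (hg : AEStronglyMeasurable g ζ.tr)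
    (hh : AEStronglyMeasurable h ζ.tr) : AEStronglyMeasurable (ζ.form g h) ζ.tr := by
  have hg' : ∀ p, AEMeasurable (fun k => g k p) ζ.tr := fun p =>
    (measurable_pi_apply p).comp_aemeasurable hg.aemeasurable
  have hh' : ∀ p, AEMeasurable (fun k => h k p) ζ.tr := fun p =>
    (measurable_pi_apply p).comp_aemeasurable hh.aemeasurable
  have : AEMeasurable (ζ.form g h) ζ.tr := by
    change AEMeasurable (fun k => ∑ p, star (g k p) * ∑ q, ζ.density k p q * h k q) ζ.tr
    refine Finset.aemeasurable_fun_sum _ fun p _ => ?_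
    refine AEMeasurable.mul ?_ ?_
    · exact Complex.continuous_conj.measurable.comp_aemeasurable (hg' p)
    · exact Finset.aemeasurable_fun_sum _ fun q _ =>
        ((ζ.measurable_density p q).aemeasurable).mul (hh' q)
  exact this.aestronglyMeasurable

theorem integrable_form {g h : E → Fin m → ℂ} (hg : AEStronglyMeasurable g ζ.tr)
    (hh : AEStronglyMeasurable h ζ.tr) (hg2 : Integrable (ζ.form g g) ζ.tr)
    (hh2 : Integrable (ζ.form h h) ζ.tr) : Integrable (ζ.form g h) ζ.tr :=
  (hg2.norm.add hh2.norm).mono' (ζ.aestronglyMeasurable_form hg hh)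
    (Filter.Eventually.of_forall fun k => ζ.norm_form_le g h k)

/-- The vector space of the functions `g : E → ℂ^m` that are square-integrable with respect
to `ζ`, that is `∫ g^* (dζ / d(tr ζ)) g d(tr ζ) < ∞`. -/
def squareIntegrableSubmodule : Submodule ℂ (E → Fin m → ℂ) where
  carrier := {g | AEStronglyMeasurable g ζ.tr ∧ Integrable (ζ.form g g) ζ.tr}
  zero_mem' := by
    refine ⟨aestronglyMeasurable_const, ?_⟩
    have : ζ.form 0 0 = fun _ => 0 := by funext k; simp [form]
    rw [this]
    exact integrable_zero _ _ _
  add_mem' := by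
    rintro g h ⟨hg, hg2⟩ ⟨hh, hh2⟩
    refine ⟨hg.add hh, ?_⟩
    rw [form_add_left, form_add_right, form_add_right]
    exact (hg2.add (ζ.integrable_form hg hh hg2 hh2)).add
      ((ζ.integrable_form hh hg hh2 hg2).add hh2)
  smul_mem' := by
    rintro c g ⟨hg, hg2⟩
    refine ⟨hg.const_smul c, ?_⟩
    rw [form_smul_left, form_smul_right]
    exact (hg2.smul c).smul _

/-- The type of the functions `g : E → ℂ^m` that are square-integrable with respect to `ζ`; the
type synonym keeps the topology of the seminorm below apart from that of pointwise convergence. -/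
def SquareIntegrable : Type v := ζ.squareIntegrableSubmodule

instance : AddCommGroup ζ.SquareIntegrable :=
  inferInstanceAs (AddCommGroup ζ.squareIntegrableSubmodule)

instance : Module ℂ ζ.SquareIntegrable :=
  inferInstanceAs (Module ℂ ζ.squareIntegrableSubmodule)

/-- The semi-definite inner product
`⟨g, h⟩ = ∫ g^* (dζ / d(tr ζ)) h d(tr ζ) = ∑_{p,q} ∫ conj(g_p) h_q dζ_pq`. -/
instance core : PreInnerProductSpace.Core ℂ ζ.SquareIntegrable where
  inner g h := ∫ k, ζ.form g.1 h.1 k ∂ζ.tr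
  conj_inner_symm g h := by
    rw [← integral_conj]
    exact integral_congr_ae (Filter.Eventually.of_forall fun k => ζ.star_form h.1 g.1 k)
  re_inner_nonneg g := by
    have h := integral_re g.2.2
    refine le_of_le_of_eq ?_ h
    exact integral_nonneg fun k => (Complex.le_def.1 (ζ.form_self_nonneg g.1 k)).1
  add_left g g' h := by
    change ∫ k, ζ.form (g.1 + g'.1) h.1 k ∂ζ.tr = _
    rw [form_add_left]
    exact integral_add (ζ.integrable_form g.2.1 h.2.1 g.2.2 h.2.2)
      (ζ.integrable_form g'.2.1 h.2.1 g'.2.2 h.2.2)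
  smul_left g h c := by
    change ∫ k, ζ.form (c • g.1) h.1 k ∂ζ.tr = _
    rw [form_smul_left]
    exact integral_const_mul _ _

instance : SeminormedAddCommGroup ζ.SquareIntegrable :=
  InnerProductSpace.Core.toSeminormedAddCommGroup (𝕜 := ℂ)

instance : InnerProductSpace ℂ ζ.SquareIntegrable := InnerProductSpace.ofCore _

/-- The space `L²(E, ζ; ℂ^m)`: square-integrable functions up to functions of seminorm zero. -/
abbrev L2 : Type v := SeparationQuotient ζ.SquareIntegrable

theorem form_single (h : E → ℂ) (p : Fin m) (k : E) :
    ζ.form (fun k => Pi.single p (h k)) (fun k => Pi.single p (h k)) k =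
      star (h k) * h k * ζ.density k p p := by
  simp only [form]
  rw [← Pi.single_star, single_dotProduct, mulVec_single]
  simp only [Pi.smul_apply, MulOpposite.smul_eq_mul_unop, MulOpposite.unop_op, col_apply]
  ring

theorem single_mem {h : E → ℂ} (hh : MemLp h 2 ζ.tr) (p : Fin m) :
    (fun k => Pi.single p (h k)) ∈ ζ.squareIntegrableSubmodule := by
  have hm : AEStronglyMeasurable (fun k => (Pi.single p (h k) : Fin m → ℂ)) ζ.tr :=
    (continuous_single p).comp_aestronglyMeasurable hh.1
  refine ⟨hm, ?_⟩
  refine Integrable.mono' (hh.integrable_norm_pow (by norm_num)) (ζ.aestronglyMeasurable_form hm hm) ?_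
  filter_upwards [ζ.trace_density] with k hk
  have hd : ∀ q, 0 ≤ ζ.density k q q := fun q => (ζ.posSemidef k).diag_nonneg
  have hle : ζ.density k p p ≤ 1 := by
    rw [← hk, trace]
    exact Finset.single_le_sum (f := fun q => ζ.density k q q) (fun q _ => hd q)
      (Finset.mem_univ p)
  have hn : ‖ζ.density k p p‖ ≤ 1 := by
    have h1 : ((‖ζ.density k p p‖ : ℝ) : ℂ) = ζ.density k p p := Complex.norm_of_nonneg' (hd p)
    have h2 := (Complex.le_def.1 hle).1
    rw [← h1] at h2
    simpa using h2
  rw [form_single, norm_mul, norm_mul, norm_star]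
  calc ‖h k‖ * ‖h k‖ * ‖ζ.density k p p‖ ≤ ‖h k‖ * ‖h k‖ * 1 := by gcongr
    _ = ‖h k‖ ^ 2 := by ring

/-- The element `h ⊗ e_p` of `L²(E, ζ; ℂ^m)`, for a function `h` that is square-integrable with
respect to the trace measure. -/
def tensor (h : E → ℂ) (hh : MemLp h 2 ζ.tr) (p : Fin m) : ζ.L2 :=
  SeparationQuotient.mk ⟨fun k => Pi.single p (h k), ζ.single_mem hh p⟩

variable [BorelSpace E]

theorem memLp_indicator (k : E) : MemLp (({k} : Set E).indicator fun _ => (1 : ℂ)) 2 ζ.tr := by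
  refine memLp_indicator_const 2 (measurableSet_singleton k) 1 (Or.inr ?_)
  obtain ⟨n, hn⟩ := ζ.tempered.exists_integrable
  have hpos : (0 : ℝ) < (1 + ‖k‖) ^ (-(n : ℝ)) := Real.rpow_pos_of_pos (by positivity) _
  refine ((measure_mono ?_).trans_lt (hn.measure_norm_ge_lt_top hpos)).ne
  rintro _ rfl
  exact Real.le_norm_self _

/-- The element `1_{k} ⊗ e_p` of `L²(E, ζ; ℂ^m)`. -/
def indicatorTensor (k : E) (p : Fin m) : ζ.L2 :=
  ζ.tensor (({k} : Set E).indicator fun _ => 1) (ζ.memLp_indicator k) p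

variable [InnerProductSpace ℝ E] [FiniteDimensional ℝ E]

/-- The element `φ ⊗ e_p` of `L²(E, ζ; ℂ^m)` for a Schwartz function `φ`. -/
def schwartzTensor (φ : 𝓢(E, ℂ)) (p : Fin m) : ζ.L2 :=
  ζ.tensor φ (haveI := ζ.tempered; φ.memLp 2 ζ.tr) p

end MatrixMeasure

end MatrixMeasure

/-! ### Diffraction -/

section Diffraction

variable {E : Type v} [NormedAddCommGroup E] [InnerProductSpace ℝ E] [FiniteDimensional ℝ E]
  [MeasurableSpace E] [BorelSpace E] {X : Type u} [TopologicalSpace X] {f₀ : C(E, X)}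
  (μ : Measure (Hull f₀)) {m : ℕ}

/-- The inner product `⟨Γ_x(φ₁), Γ_y(φ₂)⟩` of `L²(𝕏(f₀), μ)`, antilinear in the first argument. -/
def innerΓ (x y : X) (φ₁ φ₂ : 𝓢(E, ℂ)) : ℂ :=
  ∫ f, star (Γ f₀ x φ₁ f) * Γ f₀ y φ₂ f ∂μ

/-- `η` is the diffraction measure of the weighted Dirac comb
`∑_p w_p ∑_{y ∈ f⁻¹(x_p)} δ_y`: a positive tempered measure such that
`∑_{p,q} conj(w_p) w_q ⟨Γ_{x_p}(φ₁), Γ_{x_q}(φ₂)⟩ = ∫ conj(φ₁^) φ₂^ dη`, where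
`φ^(k) = ∫ φ(y) exp(-2πi k·y) dy`. -/
structure IsDiffractionMeasure (x : Fin m → X) (w : Fin m → ℂ) (η : Measure E) : Prop where
  tempered : η.HasTemperateGrowth
  inner_eq : ∀ φ₁ φ₂ : 𝓢(E, ℂ),
    ∑ p, ∑ q, star (w p) * w q * innerΓ μ (x p) (x q) φ₁ φ₂ =
      ∫ k, star (𝓕 φ₁ k) * 𝓕 φ₂ k ∂η

/-- `ζ` is the matrix-valued diffraction measure of the decoration points `x_1, ..., x_m`:
`⟨Γ_{x_p}(φ₁), Γ_{x_q}(φ₂)⟩ = ∫ conj(φ₁^) φ₂^ dζ_pq`. -/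
def IsMatrixDiffractionMeasure (x : Fin m → X) (ζ : MatrixMeasure E m) : Prop :=
  ∀ (p q : Fin m) (φ₁ φ₂ : 𝓢(E, ℂ)),
    innerΓ μ (x p) (x q) φ₁ φ₂ =
      ∫ k, star (𝓕 φ₁ k) * 𝓕 φ₂ k * ζ.density k p q ∂ζ.tr

/-- `Θ` is the isometric embedding `L²(E, ζ; ℂ^m) → L²(𝕏(f₀), μ)` determined by
`Θ(φ^ ⊗ e_p) = Γ_{x_p}(φ)` for all Schwartz functions `φ`. -/
def IsDiffractionEmbedding (x : Fin m → X) (ζ : MatrixMeasure E m)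
    (Θ : ζ.L2 →ₗᵢ[ℂ] Lp ℂ 2 μ) : Prop :=
  ∀ (p : Fin m) (φ : 𝓢(E, ℂ)), Θ (ζ.schwartzTensor (𝓕 φ) p) =ᵐ[μ] Γ f₀ (x p) φ

end Diffraction

end FlatBranched

end

noncomputable section

namespace FlatBranched

namespace SemiSimplicialSet

/-! ### Faces of points and the quotient topology -/

/-! The geometric half shows that fibres are uniformly sparse. Near a point of a cell of locally
maximal dimension, `α_s ∘ f` is a translation of an open set, so the cell is a `d`-cell;
continuation over the open simplex then shows that `f` maps a full translated copy of that simplex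
by its characteristic map. Being covered by such tiles is a closed condition, so it passes from `f₀`
to all points of `E` and to the whole hull (`IsIsometricWinding.isTiledAt_hull`). Positions of tiles
of one type are separated by an inradius, hence each fibre is a finite union of separated sets and
`∑ (1 + ‖y‖)^{-(d+1)}` over a fibre is bounded uniformly on the hull
(`IsIsometricWinding.exists_tsum_weight_fibre_le`). This makes `Γ_x(φ)` a bounded measurable
function, controlled by a weighted uniform norm of `φ`.

The analytic half concerns the linear map `S : φ ↦ ∑_p w_p Γ_{x_p}(φ)` from Schwartz functions to
`L²`. By invariance of `μ`, inner products of `S φ₁`, `S φ₂` do not change when both functions are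
translated. Bochner's theorem gives a spectral measure for every `S φ`; commutativity of convolution
shows that these are `|φ^|²` times one common measure, which is `η`
(`IsTranslationInvariant.exists_measure_inner_eq`). Polarization and Radon–Nikodym derivatives turn
the measures for varying `w` into `ζ` (`exists_matrixMeasure`), and density of Schwartz tensors
gives `Θ` (`MatrixMeasure.exists_linearIsometry`).

For the amplitudes, take Schwartz functions `φ_n` with `φ_n^ → 1_{k}` boundedly, with shrinking
supports. Then `Γ_y(φ_n)` converges in `L²` to a vector `v(y)` (`spectralAtom`) that knows only `k`
and the single point `y`, and `Θ(1_{k} ⊗ e_p) = v(x_p)` (`map_indicatorTensor`). So `a_k(y) = ⟨ψ_k,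
v(y)⟩`. The sum `V = ∑ w_p v(x_p)` satisfies `η({k}) = ‖V‖²` and transforms under translations like
`ψ_k`. If `μ` is ergodic, `conj(ψ_k) V` is constant, so `V` is a multiple of the unit vector `ψ_k`
and `‖V‖ = |⟨ψ_k, V⟩|` (`norm_inner_eq_norm_of_eigen`). -/

theorem stdSimplex_map_apply {X Y : Type*} [Fintype X] [Fintype Y] {θ : X → Y}
    (hθ : Function.Injective θ) (v : stdSimplex ℝ X) (i : X) :
    stdSimplex.map θ v (θ i) = v i := by
  classical
  rw [stdSimplex.map_coe, FunOnFinite.linearMap_apply_apply]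
  rw [Finset.sum_eq_single i]
  · intro j hj hji
    exact absurd (hθ (Finset.mem_filter.1 hj).2) hji
  · simp

theorem stdSimplex_map_apply_of_notMem_range {X Y : Type*} [Fintype X] [Fintype Y] {θ : X → Y}
    (v : stdSimplex ℝ X) {j : Y} (hj : j ∉ Set.range θ) :
    stdSimplex.map θ v j = 0 := by
  classical
  rw [stdSimplex.map_coe, FunOnFinite.linearMap_apply_apply]
  refine Finset.sum_eq_zero fun i hi => ?_
  exact absurd ⟨i, (Finset.mem_filter.1 hi).2⟩ hj

theorem range_eq_support {X Y : Type*} [Fintype X] [Fintype Y] {θ : X → Y}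
    (hθ : Function.Injective θ) {v : stdSimplex ℝ X} (hv : ∀ i, 0 < v i) :
    Set.range θ = {j | 0 < stdSimplex.map θ v j} := by
  ext j
  by_cases hj : j ∈ Set.range θ
  · obtain ⟨i, rfl⟩ := hj
    simp only [Set.mem_range_self, Set.mem_ofPred_eq, true_iff]
    rw [stdSimplex_map_apply hθ]; exact hv i
  · simp only [hj, Set.mem_ofPred_eq, false_iff]
    rw [stdSimplex_map_apply_of_notMem_range v hj]; exact lt_irrefl _

variable {B : SemiSimplicialSet.{u}}

/-- The point `b` of a closed simplex represents the point `a` in a face of the simplex of `a`. -/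
def IsFace (a b : B.Pieces) : Prop :=
  ∃ θ : Fin (b.1.1 + 1) ↪o Fin (a.1.1 + 1), B.map θ a.1.2 = b.1.2 ∧ a.2 = stdSimplex.map θ b.2

/-- Points in the interior of their simplex. -/
def IsInterior (a : B.Pieces) : Prop := ∀ i, 0 < a.2 i

theorem IsFace.refl (a : B.Pieces) : IsFace a a :=
  ⟨RelEmbedding.refl _, B.map_id _, (stdSimplex.map_id_apply a.2).symm⟩

theorem IsFace.trans {a b c : B.Pieces} (hab : IsFace a b) (hbc : IsFace b c) : IsFace a c := by
  obtain ⟨θ, h1, h2⟩ := hab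
  obtain ⟨θ', h3, h4⟩ := hbc
  refine ⟨θ'.trans θ, ?_, ?_⟩
  · rw [B.map_comp, h1, h3]
  · rw [h2, h4, stdSimplex.map_comp_apply]
    rfl

/-- Delete the vanishing barycentric coordinates: the positive ones, listed in increasing order,
span the face that contains the point in its interior. -/
theorem exists_isInterior_isFace (a : B.Pieces) : ∃ b, IsInterior b ∧ IsFace a b := by
  classical
  obtain ⟨⟨n, s⟩, u⟩ := a
  set S : Finset (Fin (n + 1)) := Finset.univ.filter fun i => 0 < u i with hS
  have hne : S.Nonempty := by
    by_contra h
    rw [Finset.not_nonempty_iff_eq_empty, Finset.filter_eq_empty_iff] at h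
    have h1 : ∑ i, u i = 0 := Finset.sum_eq_zero fun i hi =>
      le_antisymm (not_lt.1 (h hi)) (stdSimplex.zero_le u i)
    simp at h1
  obtain ⟨m, hm⟩ : ∃ m, S.card = m + 1 := ⟨S.card - 1, by have := hne.card_pos; omega⟩
  let θ : Fin (m + 1) ↪o Fin (n + 1) := S.orderEmbOfFin hm
  have hrange : ∀ j, j ∉ Set.range θ → u j = 0 := by
    intro j hj
    have : j ∉ S := by
      rwa [Finset.range_orderEmbOfFin, Finset.mem_coe] at hj
    rw [hS, Finset.mem_filter] at this
    exact le_antisymm (not_lt.1 fun h => this ⟨Finset.mem_univ _, h⟩) (stdSimplex.zero_le u j)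
  have hpos : ∀ i, 0 < u (θ i) := fun i =>
    (Finset.mem_filter.1 (Finset.orderEmbOfFin_mem S hm i)).2
  have hsum : ∑ i, u (θ i) = 1 := by
    rw [← stdSimplex.sum_eq_one u]
    exact Finset.sum_of_injOn θ θ.injective.injOn (by simp)
      (fun j _ hj => hrange j (by simpa using hj)) (fun _ _ => rfl)
  refine ⟨⟨⟨m, B.map θ s⟩, ⟨fun i => u (θ i), fun i => (hpos i).le, hsum⟩⟩, hpos, θ, rfl, ?_⟩
  ext j
  by_cases hj : j ∈ Set.range θ
  · obtain ⟨i, rfl⟩ := hj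
    exact (stdSimplex_map_apply θ.injective (⟨fun i => u (θ i), fun i => (hpos i).le, hsum⟩ :
      stdSimplex ℝ (Fin (m + 1))) i).symm
  · exact (hrange j hj).trans (stdSimplex_map_apply_of_notMem_range _ hj).symm

/-- The support of `u` is the range of the order embedding, and an order embedding of a finite chain
is determined by its range; so face and coordinates can both be read off from `u`. -/
theorem pieces_ext {n m m' : ℕ} {s : B.obj n} {u : stdSimplex ℝ (Fin (n + 1))}
    {r : B.obj m} {v : stdSimplex ℝ (Fin (m + 1))} {r' : B.obj m'}
    {v' : stdSimplex ℝ (Fin (m' + 1))} {θ : Fin (m + 1) ↪o Fin (n + 1)}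
    {θ' : Fin (m' + 1) ↪o Fin (n + 1)} (hv : ∀ i, 0 < v i) (hv' : ∀ i, 0 < v' i)
    (h1 : B.map θ s = r) (h2 : u = stdSimplex.map θ v) (h1' : B.map θ' s = r')
    (h2' : u = stdSimplex.map θ' v') : (⟨⟨m, r⟩, v⟩ : B.Pieces) = ⟨⟨m', r'⟩, v'⟩ := by
  have hr : Set.range θ = Set.range θ' := by
    rw [range_eq_support θ.injective hv, range_eq_support θ'.injective hv', ← h2, ← h2']
  have hm : m = m' := by
    have h3 := Set.ncard_range_of_injective θ.injective
    have h4 := Set.ncard_range_of_injective θ'.injective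
    rw [hr, h4] at h3
    simpa using h3.symm
  subst hm
  have hθ : θ = θ' := by
    ext i
    rw [(StrictMono.range_inj θ.strictMono θ'.strictMono).1 hr]
  subst hθ
  subst h1
  subst h1'
  have : v = v' := by
    ext i
    rw [← stdSimplex_map_apply θ.injective v i, ← h2, h2', stdSimplex_map_apply θ.injective]
  rw [this]

theorem IsFace.unique {a b b' : B.Pieces} (hb : IsInterior b) (hab : IsFace a b)
    (hb' : IsInterior b') (hab' : IsFace a b') : b = b' := by
  obtain ⟨θ, h1, h2⟩ := hab
  obtain ⟨θ', h1', h2'⟩ := hab'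
  exact pieces_ext hb hb' h1 h2 h1' h2'

/-- The set of interior representatives of a point of the realization (a singleton). -/
def interiorReps : B.Realization → Set B.Pieces :=
  Quot.lift (fun a => {c | IsInterior c ∧ IsFace a c}) (by
    rintro _ _ ⟨θ, s, v⟩
    have hyx : IsFace (B := B) ⟨⟨_, s⟩, stdSimplex.map θ v⟩ ⟨⟨_, B.map θ s⟩, v⟩ := ⟨θ, rfl, rfl⟩
    ext c
    refine ⟨fun h => ⟨h.1, hyx.trans h.2⟩, fun h => ⟨h.1, ?_⟩⟩
    obtain ⟨c', hc', hxc'⟩ := exists_isInterior_isFace (B := B) ⟨⟨_, B.map θ s⟩, v⟩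
    rwa [IsFace.unique h.1 h.2 hc' (hyx.trans hxc')])

theorem charMap_map {m n : ℕ} {θ : Fin (m + 1) ↪o Fin (n + 1)} {s : B.obj n} {r : B.obj m}
    (h : B.map θ s = r) (v : stdSimplex ℝ (Fin (m + 1))) :
    charMap (B := B) ⟨n, s⟩ (stdSimplex.map θ v) = charMap (B := B) ⟨m, r⟩ v := by
  subst h
  exact (Quot.sound (Glue.glue θ s v)).symm

theorem IsFace.charMap_eq {a b : B.Pieces} (h : IsFace a b) :
    charMap a.1 a.2 = charMap b.1 b.2 := by
  obtain ⟨θ, h1, h2⟩ := h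
  rw [h2]
  exact charMap_map h1 b.2

/-- Equality in `Quot` is generated by chains of gluings. The invariant `interiorReps` avoids them:
it is constant on classes, and each of its values is the unique interior representative. -/
theorem exists_common_face {s s' : B.Simplex} {u : stdSimplex ℝ (Fin (s.1 + 1))}
    {u' : stdSimplex ℝ (Fin (s'.1 + 1))} (h : charMap s u = charMap s' u') :
    ∃ c, IsInterior c ∧ IsFace ⟨s, u⟩ c ∧ IsFace ⟨s', u'⟩ c := by
  have h1 := congrArg interiorReps h
  obtain ⟨c, hc, hac⟩ := exists_isInterior_isFace (B := B) ⟨s, u⟩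
  have h2 : c ∈ interiorReps (charMap s' u') := h1 ▸ (⟨hc, hac⟩ : c ∈ interiorReps (charMap s u))
  exact ⟨c, hc, hac, h2.2⟩

theorem isFace_of_charMap_eq {s s' : B.Simplex} {u : stdSimplex ℝ (Fin (s.1 + 1))}
    {u' : stdSimplex ℝ (Fin (s'.1 + 1))} (hu : ∀ i, 0 < u i) (h : charMap s u = charMap s' u') :
    IsFace (B := B) ⟨s', u'⟩ ⟨s, u⟩ := by
  obtain ⟨c, hc, h1, h2⟩ := exists_common_face h
  rwa [IsFace.unique (B := B) (b := ⟨s, u⟩) hu (IsFace.refl ⟨s, u⟩) hc h1]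

theorem eq_of_charMap_eq {s s' : B.Simplex} {u : stdSimplex ℝ (Fin (s.1 + 1))}
    {u' : stdSimplex ℝ (Fin (s'.1 + 1))} (hu : ∀ i, 0 < u i) (hu' : ∀ i, 0 < u' i)
    (h : charMap s u = charMap s' u') : (⟨s, u⟩ : B.Pieces) = ⟨s', u'⟩ :=
  IsFace.unique (B := B) hu (isFace_of_charMap_eq hu h) hu' (IsFace.refl _)

theorem charMap_injOn {s : B.Simplex} {u u' : stdSimplex ℝ (Fin (s.1 + 1))} (hu : ∀ i, 0 < u i)
    (hu' : ∀ i, 0 < u' i) (h : charMap s u = charMap s u') : u = u' :=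
  eq_of_heq (Sigma.mk.inj (eq_of_charMap_eq hu hu' h)).2

theorem exists_mem_cell (x : B.Realization) : ∃ s : B.Simplex, x ∈ cell s := by
  obtain ⟨⟨s, u⟩, rfl⟩ := Quot.exists_rep x
  obtain ⟨⟨r, v⟩, hv, hf⟩ := exists_isInterior_isFace (B := B) ⟨s, u⟩
  exact ⟨r, v, hv, hf.charMap_eq.symm⟩

theorem continuous_charMap (s : B.Simplex) : Continuous (charMap s) :=
  continuous_quot_mk.comp continuous_sigmaMk

/-- The saturation of a closed set meets each closed simplex in a finite union of sets obtained by
restricting to a face and pushing forward into another simplex. The simplices are compact, so these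
pushforwards are closed. -/
theorem isClosedMap_quotMk [Finite B.Simplex] :
    IsClosedMap (Quot.mk B.Glue : B.Pieces → B.Realization) := by
  intro F hF
  have hq : Topology.IsQuotientMap (Quot.mk B.Glue : B.Pieces → B.Realization) :=
    isQuotientMap_quot_mk
  rw [← hq.isClosed_preimage, isClosed_sigma_iff]
  intro s'
  have key : {u' : stdSimplex ℝ (Fin (s'.1 + 1)) |
      (⟨s', u'⟩ : B.Pieces) ∈ Quot.mk B.Glue ⁻¹' (Quot.mk B.Glue '' F)} =
      ⋃ (s : B.Simplex) (w : B.Simplex) (θ : Fin (w.1 + 1) ↪o Fin (s.1 + 1))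
        (θ' : Fin (w.1 + 1) ↪o Fin (s'.1 + 1)) (_ : B.map θ s.2 = w.2 ∧ B.map θ' s'.2 = w.2),
        stdSimplex.map θ' '' (stdSimplex.map θ ⁻¹' {u | (⟨s, u⟩ : B.Pieces) ∈ F}) := by
    ext u'
    simp only [Set.mem_preimage, Set.mem_image, Set.mem_iUnion, Set.mem_ofPred_eq]
    constructor
    · rintro ⟨⟨s, u⟩, hF, h⟩
      obtain ⟨⟨w, v⟩, -, ⟨θ, h1, h2⟩, ⟨θ', h3, h4⟩⟩ :=
        exists_common_face (s := s) (s' := s') (u := u) (u' := u') h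
      refine ⟨s, w, θ, θ', ⟨h1, h3⟩, v, ?_, h4.symm⟩
      rwa [← show u = stdSimplex.map θ v from h2]
    · rintro ⟨s, w, θ, θ', ⟨h1, h2⟩, v, hF, rfl⟩
      refine ⟨_, hF, ?_⟩
      have e1 := IsFace.charMap_eq (B := B) (a := ⟨s, stdSimplex.map θ v⟩) (b := ⟨w, v⟩)
        ⟨θ, h1, rfl⟩
      have e2 := IsFace.charMap_eq (B := B) (a := ⟨s', stdSimplex.map θ' v⟩) (b := ⟨w, v⟩)
        ⟨θ', h2, rfl⟩
      exact e1.trans e2.symm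
  change IsClosed {u' : stdSimplex ℝ (Fin (s'.1 + 1)) | _}
  rw [key]
  refine isClosed_iUnion_of_finite fun s => isClosed_iUnion_of_finite fun w =>
    isClosed_iUnion_of_finite fun θ => isClosed_iUnion_of_finite fun θ' =>
    isClosed_iUnion_of_finite fun _ => ?_
  refine (stdSimplex.continuous_map _).isClosedMap _ ?_
  exact ((hF.preimage continuous_sigmaMk)).preimage (stdSimplex.continuous_map _)

/-- A quotient of a normal space by a closed map: disjoint closed fibres have disjoint open
neighbourhoods `U` and `V`, and the complements of the images of `Uᶜ` and `Vᶜ` separate the points.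
-/
theorem t2Space_realization [Finite B.Simplex] : T2Space B.Realization := by
  refine ⟨fun x y hxy => ?_⟩
  let π : B.Pieces → B.Realization := Quot.mk B.Glue
  have hπ : Continuous π := continuous_quot_mk
  have hc : IsClosedMap π := isClosedMap_quotMk
  have hsurj : Function.Surjective π := Quot.exists_rep
  have hT1 : ∀ x, IsClosed ({x} : Set B.Realization) := by
    intro x
    obtain ⟨a, rfl⟩ := hsurj x
    simpa using hc {a} isClosed_singleton
  have hd : Disjoint (π ⁻¹' {x}) (π ⁻¹' {y}) :=
    Disjoint.preimage _ (by simpa using hxy)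
  obtain ⟨U, V, hU, hV, hxU, hyV, hUV⟩ := normal_separation ((hT1 x).preimage hπ)
    ((hT1 y).preimage hπ) hd
  refine ⟨(π '' Uᶜ)ᶜ, (π '' Vᶜ)ᶜ, (hc _ hU.isClosed_compl).isOpen_compl,
    (hc _ hV.isClosed_compl).isOpen_compl, ?_, ?_, ?_⟩
  · rintro ⟨a, ha, rfl⟩
    exact ha (hxU rfl)
  · rintro ⟨a, ha, rfl⟩
    exact ha (hyV rfl)
  · rw [Set.disjoint_left]
    intro z hz hz'
    obtain ⟨a, rfl⟩ := hsurj z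
    have h1 : a ∈ U := by by_contra h; exact hz ⟨a, h, rfl⟩
    have h2 : a ∈ V := by by_contra h; exact hz' ⟨a, h, rfl⟩
    exact Set.disjoint_left.1 hUV h1 h2

/-- The union of the closed cells of dimension at most that of `s`, other than `s`. -/
def otherCells (s : B.Simplex) : Set B.Realization :=
  ⋃ (s' : B.Simplex) (_ : s' ≠ s ∧ s'.1 ≤ s.1), Set.range (charMap s')

theorem isClosed_otherCells [Finite B.Simplex] (s : B.Simplex) : IsClosed (otherCells s) := by
  have := t2Space_realization (B := B)
  exact isClosed_iUnion_of_finite fun s' => isClosed_iUnion_of_finite fun _ =>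
    (isCompact_range (continuous_charMap s')).isClosed

theorem map_eq_self {n : ℕ} (θ : Fin (n + 1) ↪o Fin (n + 1)) (s : B.obj n) : B.map θ s = s := by
  have : θ = RelEmbedding.refl _ := by
    have h := StrictMono.range_inj (f := θ) (g := id) θ.strictMono strictMono_id
    ext i
    exact congrArg Fin.val (congrFun (h.1 (by
      rw [Set.range_id, (Finite.surjective_of_injective θ.injective).range_eq])) i)
  rw [this, B.map_id]

/-- A point of the open cell `s` lies in the closed cell `s'` only if `s` is a face of `s'`. The
bound on dimensions makes this face all of `s'`. -/
theorem disjoint_cell_otherCells (s : B.Simplex) : Disjoint (cell s) (otherCells s) := by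
  rw [Set.disjoint_left]
  rintro _ ⟨u, hu, rfl⟩ h
  simp only [otherCells, Set.mem_iUnion] at h
  obtain ⟨s', ⟨hne, hle⟩, u', hu'⟩ := h
  obtain ⟨θ, h1⟩ : ∃ θ : Fin (s.1 + 1) ↪o Fin (s'.1 + 1), B.map θ s'.2 = s.2 :=
    (isFace_of_charMap_eq hu hu'.symm).imp fun _ h => h.1
  have h2 : s.1 = s'.1 := by
    refine le_antisymm ?_ hle
    have := Fintype.card_le_of_embedding θ.toEmbedding
    simpa using this
  clear hu' hu u'
  obtain ⟨n, s⟩ := s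
  obtain ⟨n', s'⟩ := s'
  change n = n' at h2
  subst h2
  exact hne (congrArg (Sigma.mk n) ((map_eq_self θ s').symm.trans h1))

theorem mem_cell_of_notMem_otherCells {s : B.Simplex} {x : B.Realization}
    (hx : x ∉ otherCells s) : ∃ s', x ∈ cell s' ∧ (s' = s ∨ s.1 < s'.1) := by
  obtain ⟨s', hs'⟩ := exists_mem_cell x
  refine ⟨s', hs', ?_⟩
  by_contra h
  push Not at h
  obtain ⟨u, -, rfl⟩ := hs'
  exact hx (Set.mem_iUnion₂.2 ⟨s', h, u, rfl⟩)

end SemiSimplicialSet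

end FlatBranched

end

noncomputable section

namespace FlatBranched

open SemiSimplicialSet

/-! ### The open standard simplex -/

theorem isPreconnected_openSimplex (n : ℕ) :
    IsPreconnected {u : stdSimplex ℝ (Fin (n + 1)) | ∀ i, 0 < u i} := by
  rw [← Topology.IsInducing.subtypeVal.isPreconnected_image]
  have : (Subtype.val '' {u : stdSimplex ℝ (Fin (n + 1)) | ∀ i, 0 < u i}) =
      {x : Fin (n + 1) → ℝ | (∀ i, 0 < x i) ∧ ∑ i, x i = 1} := by
    ext x
    constructor
    · rintro ⟨u, hu, rfl⟩
      exact ⟨hu, u.2.2⟩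
    · rintro ⟨h1, h2⟩
      exact ⟨⟨x, fun i => (h1 i).le, h2⟩, h1, rfl⟩
  rw [this]
  refine Convex.isPreconnected ?_
  intro x hx y hy a b ha hb hab
  refine ⟨fun i => ?_, ?_⟩
  · simp only [Pi.add_apply, Pi.smul_apply, smul_eq_mul]
    rcases ha.eq_or_lt with rfl | ha
    · have : b = 1 := by linarith
      subst this
      simpa using hy.1 i
    · have := mul_pos ha (hx.1 i)
      have := mul_nonneg hb (hy.1 i).le
      linarith
  · simp only [Pi.add_apply, Pi.smul_apply, smul_eq_mul]
    rw [Finset.sum_add_distrib, ← Finset.mul_sum, ← Finset.mul_sum, hx.2, hy.2]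
    linarith

theorem isOpen_openSimplex (n : ℕ) : IsOpen {u : stdSimplex ℝ (Fin (n + 1)) | ∀ i, 0 < u i} := by
  simp only [Set.ofPred_forall]
  refine isOpen_iInter_of_finite fun i => ?_
  exact isOpen_lt continuous_const ((continuous_apply i).comp continuous_subtype_val)

theorem dense_openSimplex (n : ℕ) : Dense {u : stdSimplex ℝ (Fin (n + 1)) | ∀ i, 0 < u i} := by
  intro u
  let b : stdSimplex ℝ (Fin (n + 1)) := stdSimplex.barycenter
  have hb : ∀ i, 0 < b i := fun i => by
    change 0 < ((Fintype.card (Fin (n + 1)) : ℝ))⁻¹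
    positivity
  -- Sliding `u` towards the barycenter makes every coordinate positive at once for `ε > 0`.
  let g : Set.Icc (0 : ℝ) 1 → stdSimplex ℝ (Fin (n + 1)) := fun ε =>
    ⟨(1 - (ε : ℝ)) • (u : Fin (n + 1) → ℝ) + (ε : ℝ) • (b : Fin (n + 1) → ℝ),
      convex_stdSimplex ℝ _ u.2 b.2 (sub_nonneg.2 ε.2.2) ε.2.1 (by ring)⟩
  have hg : Continuous g := by
    refine Continuous.subtype_mk ?_ _
    fun_prop
  have h0 : g 0 = u := by
    apply Subtype.ext
    simp only [g, Set.Icc.coe_zero, sub_zero, one_smul, zero_smul, add_zero]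
    rfl
  rw [← h0]
  have hcl : (0 : Set.Icc (0 : ℝ) 1) ∈ closure {ε : Set.Icc (0 : ℝ) 1 | 0 < ε} := by
    have : closure (Set.Ioi (0 : Set.Icc (0 : ℝ) 1)) = Set.Ici 0 :=
      closure_Ioi' ⟨1, by simp⟩
    change (0 : Set.Icc (0 : ℝ) 1) ∈ closure (Set.Ioi 0)
    rw [this]
    exact Set.self_mem_Ici
  refine map_mem_closure hg hcl ?_
  intro ε hε i
  change 0 < (1 - (ε : ℝ)) * u i + (ε : ℝ) * b i
  have h1 : 0 < (ε : ℝ) := hε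
  have h2 : (ε : ℝ) ≤ 1 := ε.2.2
  have h3 : 0 ≤ u i := stdSimplex.zero_le u i
  have := mul_pos h1 (hb i)
  have := mul_nonneg (sub_nonneg.2 h2) h3
  linarith

/-! ### Isometric windings are tiled by simplices -/

section Tiles

variable {E : Type v} [NormedAddCommGroup E] [InnerProductSpace ℝ E] (K : FBSComplex.{u} E)

namespace FBSComplex

theorem dim_le (s : K.Simplex) : s.1 ≤ Module.finrank ℝ E := by
  by_contra h
  exact (K.isEmpty_above s.1 (not_le.1 h)).false s.2

instance : Finite K.Simplex := by
  have := K.finite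
  let g : (Σ n : Fin (Module.finrank ℝ E + 1), K.obj n) → K.Simplex := fun s => ⟨s.1, s.2⟩
  refine Finite.of_surjective g fun s => ?_
  exact ⟨⟨⟨s.1, Nat.lt_succ_of_le (K.dim_le s)⟩, s.2⟩, rfl⟩

instance : T2Space K.Space := t2Space_realization

/-- The set of `d`-simplices as simplices. -/
abbrev top (s : K.obj (Module.finrank ℝ E)) : K.Simplex := ⟨Module.finrank ℝ E, s⟩

theorem continuous_toAffine (s : K.Simplex) : Continuous (K.toAffine s) := by
  refine continuous_finsetSum _ fun i _ => Continuous.smul ?_ continuous_const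
  exact (continuous_apply i.succ).comp continuous_subtype_val

theorem α_charMap {s : K.Simplex} {u : stdSimplex ℝ (Fin (s.1 + 1))} (hu : ∀ i, 0 < u i) :
    K.α s (charMap s u) = K.toAffine s u := by
  have h : ∃ u' : stdSimplex ℝ (Fin (s.1 + 1)), (∀ i, 0 < u' i) ∧ charMap s u' = charMap s u :=
    ⟨u, hu, rfl⟩
  rw [FBSComplex.α, dif_pos h, charMap_injOn h.choose_spec.1 hu h.choose_spec.2]

theorem α_mem_span (s : K.Simplex) (x : K.Space) :
    K.α s x ∈ Submodule.span ℝ (Set.range fun i : Fin s.1 => K.ρ (Finsupp.single (edge s.2 i) 1)) := by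
  rw [FBSComplex.α]
  split_ifs with h
  · exact Submodule.sum_mem _ fun i _ => Submodule.smul_mem _ _ (Submodule.subset_span ⟨i, rfl⟩)
  · exact Submodule.zero_mem _

theorem toAffine_injective (s : K.obj (Module.finrank ℝ E)) :
    Function.Injective (K.toAffine (K.top s)) := by
  intro u u' h
  have h1 : ∀ i : Fin (Module.finrank ℝ E), u i.succ = u' i.succ := by
    have h2 := Fintype.linearIndependent_iff.1 (K.linearIndependent s)
      (fun i => u i.succ - u' i.succ) (by
        simp only [sub_smul, Finset.sum_sub_distrib]
        exact sub_eq_zero.2 h)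
    exact fun i => sub_eq_zero.1 (h2 i)
  ext i
  refine Fin.cases ?_ h1 i
  have h3 := stdSimplex.sum_eq_one u
  have h4 := stdSimplex.sum_eq_one u'
  change ∑ x : Fin (Module.finrank ℝ E + 1), u x = 1 at h3
  change ∑ x : Fin (Module.finrank ℝ E + 1), u' x = 1 at h4
  rw [Fin.sum_univ_succ] at h3 h4
  rw [Finset.sum_congr rfl fun i _ => h1 i] at h3
  exact add_right_cancel (h3.trans h4.symm)

variable {K}

theorem isOpen_cell_top (s : K.obj (Module.finrank ℝ E)) : IsOpen (cell (K.top s)) := by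
  have : cell (K.top s) = (otherCells (K.top s))ᶜ := by
    refine Set.Subset.antisymm (disjoint_cell_otherCells _).subset_compl_right fun x hx => ?_
    obtain ⟨s', h1, rfl | h2⟩ := mem_cell_of_notMem_otherCells hx
    · exact h1
    · exact absurd h2 (not_lt.2 (K.dim_le s'))
  rw [this]
  exact (isClosed_otherCells _).isOpen_compl

/-- The simplex `s` at position `t` is a tile of `f`. -/
def IsTile (f : C(E, K.Space)) (s : K.obj (Module.finrank ℝ E)) (t : E) : Prop :=
  ∀ u, f (t + K.toAffine (K.top s) u) = charMap (K.top s) u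

/-- The point `y` is covered by a tile of `f`. -/
def IsTiledAt (f : C(E, K.Space)) (y : E) : Prop :=
  ∃ s u₀, IsTile f s (y - K.toAffine (K.top s) u₀)

end FBSComplex

open FBSComplex

variable {K} {f : C(E, K.Space)}

/-- Among the cells met by `f` on `W` take one, `s`, of maximal dimension. Then `f` maps a whole
ball into `|s|`, where `α_s ∘ f` is a translation; but `α_s` takes values in the span of `dim s`
edge vectors, so this span is `E`. -/
theorem IsIsometricWinding.exists_mem_top_cell [FiniteDimensional ℝ E]
    (hf : IsIsometricWinding K f) {W : Set E}
    (hW : IsOpen W) (hne : W.Nonempty) : ∃ y ∈ W, ∃ s, f y ∈ cell (K.top s) := by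
  obtain ⟨s, ⟨y, hy, hys⟩, hmax⟩ := Set.exists_max_image {s : K.Simplex | ∃ y ∈ W, f y ∈ cell s}
    (fun s => s.1) (Set.toFinite _) (by
      obtain ⟨y, hy⟩ := hne
      obtain ⟨s, hs⟩ := exists_mem_cell (f y)
      exact ⟨s, y, hy, hs⟩)
  have hW' : IsOpen (W ∩ f ⁻¹' (otherCells s)ᶜ) :=
    hW.inter ((isClosed_otherCells s).isOpen_compl.preimage f.continuous)
  have hyW' : y ∈ W ∩ f ⁻¹' (otherCells s)ᶜ :=
    ⟨hy, fun h => Set.disjoint_left.1 (disjoint_cell_otherCells s) hys h⟩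
  obtain ⟨r, hr, hball⟩ := Metric.isOpen_iff.1 hW' y hyW'
  have hcell : Metric.ball y r ⊆ f ⁻¹' cell s := by
    intro z hz
    obtain ⟨hzW, hzo⟩ := hball hz
    obtain ⟨s', h1, rfl | h2⟩ := mem_cell_of_notMem_otherCells hzo
    · exact h1
    · exact absurd (hmax s' ⟨z, hzW, h1⟩) (not_le.2 h2)
  obtain ⟨t, ht⟩ := hf.translation s y hys
  have hC : Metric.ball y r ⊆ connectedComponentIn (f ⁻¹' cell s) y :=
    (convex_ball y r).isPreconnected.subset_connectedComponentIn (Metric.mem_ball_self hr) hcell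
  have hspan : Submodule.span ℝ
      (Set.range fun i : Fin s.1 => K.ρ (Finsupp.single (edge s.2 i) 1)) = ⊤ := by
    rw [eq_top_iff]
    rintro v -
    obtain ⟨ε, hε, hεv⟩ : ∃ ε : ℝ, 0 < ε ∧ y + ε • v ∈ Metric.ball y r := by
      refine ⟨r / (2 * (‖v‖ + 1)), by positivity, ?_⟩
      rw [Metric.mem_ball, dist_eq_norm, add_sub_cancel_left, norm_smul, Real.norm_eq_abs,
        abs_of_pos (by positivity), div_mul_eq_mul_div, div_lt_iff₀ (by positivity)]
      nlinarith [norm_nonneg v]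
    have h1 := ht _ (hC hεv)
    have h2 := ht _ (hC (Metric.mem_ball_self hr))
    have h3 : ε • v ∈ Submodule.span ℝ
        (Set.range fun i : Fin s.1 => K.ρ (Finsupp.single (edge s.2 i) 1)) := by
      have h4 := Submodule.sub_mem _ (K.α_mem_span s (f (y + ε • v))) (K.α_mem_span s (f y))
      rw [h1, h2] at h4
      convert h4 using 1
      abel
    simpa [hε.ne'] using Submodule.smul_mem _ ε⁻¹ h3
  have hdim : s.1 = Module.finrank ℝ E := by
    refine le_antisymm (K.dim_le s) ?_
    have := finrank_range_le_card (R := ℝ) (fun i : Fin s.1 => K.ρ (Finsupp.single (edge s.2 i) 1))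
    rwa [Set.finrank, hspan, finrank_top, Fintype.card_fin] at this
  obtain ⟨n, s⟩ := s
  dsimp only at hdim
  subst hdim
  exact ⟨y, hy, s, hys⟩

/-- Continuation over the open simplex. The map `g` is the inverse of `α_s ∘ f` suggested by the
translation on the component `C` of `y`; the set of interior `u` with `g u ∈ C` is nonempty, open
and relatively closed, so it is everything. Density extends `f ∘ g = charMap` to the closed simplex.
-/
theorem IsIsometricWinding.isTiledAt_of_mem_cell (hf : IsIsometricWinding K f) {y : E}
    {s : K.obj (Module.finrank ℝ E)} (hy : f y ∈ cell (K.top s)) : IsTiledAt f y := by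
  set σ := K.top s
  obtain ⟨t, ht⟩ := hf.translation σ y hy
  set C := connectedComponentIn (f ⁻¹' cell σ) y
  have hCo : IsOpen C := ((isOpen_cell_top s).preimage f.continuous).connectedComponentIn
  have hyC : y ∈ C := mem_connectedComponentIn hy
  have hCsub : C ⊆ f ⁻¹' cell σ := connectedComponentIn_subset _ _
  have hrep : ∀ z ∈ C, ∃ u : stdSimplex ℝ (Fin (σ.1 + 1)), (∀ i, 0 < u i) ∧ charMap σ u = f z ∧
      K.toAffine σ u = z + t := by
    intro z hz
    obtain ⟨u, hu, huz⟩ := hCsub hz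
    refine ⟨u, hu, huz, ?_⟩
    rw [← ht z hz, ← huz, K.α_charMap hu]
  let g : stdSimplex ℝ (Fin (σ.1 + 1)) → E := fun u => -t + K.toAffine σ u
  have hg : Continuous g := continuous_const.add (K.continuous_toAffine σ)
  have hQ : IsClosed {u | f (g u) = charMap σ u} :=
    isClosed_eq (f.continuous.comp hg) (continuous_charMap σ)
  have hCQ : ∀ u, (∀ i, 0 < u i) → g u ∈ C → f (g u) = charMap σ u := by
    intro u hu huC
    obtain ⟨u', hu', h1, h2⟩ := hrep _ huC
    have : u' = u := K.toAffine_injective s (h2.trans (by simp only [g]; abel))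
    rw [← h1, this]
  obtain ⟨u₀, hu₀, h1, h2⟩ := hrep y hyC
  have hg₀ : g u₀ = y := by simp only [g]; rw [h2]; abel
  have hall : {u | ∀ i, 0 < u i} ⊆ g ⁻¹' C := by
    refine (isPreconnected_openSimplex σ.1).subset_of_closure_inter_subset (hCo.preimage hg)
      ⟨u₀, hu₀, by rwa [Set.mem_preimage, hg₀]⟩ ?_
    rintro u ⟨hucl, hu⟩
    have huQ : f (g u) = charMap σ u := by
      have h3 : u ∈ closure ({u | ∀ i, 0 < u i} ∩ g ⁻¹' C) :=
        (isOpen_openSimplex σ.1).inter_closure ⟨hu, hucl⟩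
      exact closure_minimal (fun v hv => hCQ v hv.1 hv.2) hQ h3
    have hguC : g u ∈ closure C := map_mem_closure hg hucl fun v hv => hv
    -- Adjoining the limit point `g u` keeps `C` connected, and `f (g u)` still lies in the open
    -- cell because `u` is interior; so `g u` belongs to the component.
    have hpre : IsPreconnected (insert (g u) C) :=
      isPreconnected_connectedComponentIn.subset_closure (Set.subset_insert _ _)
        (Set.insert_subset hguC subset_closure)
    refine hpre.subset_connectedComponentIn (Set.mem_insert_of_mem _ hyC) ?_ (Set.mem_insert _ _)
    refine Set.insert_subset ?_ hCsub
    exact ⟨u, hu, huQ.symm⟩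
  refine ⟨s, u₀, fun u => ?_⟩
  have htile : u ∈ {u | f (g u) = charMap σ u} := by
    have h3 : closure {u | ∀ i, 0 < u i} ⊆ {u | f (g u) = charMap σ u} :=
      closure_minimal (fun v hv => hCQ v hv (hall hv)) hQ
    exact h3 (dense_openSimplex σ.1 u)
  convert htile.out using 2
  simp only [g]
  rw [show K.toAffine (K.top s) u₀ = y + t from h2]
  abel

/-- Evaluation is jointly continuous since `E` is locally compact. The quantifier over `u₀` is a
projection along a compact simplex, and there are finitely many types `s`. -/
theorem FBSComplex.isClosed_setOf_isTiledAt [FiniteDimensional ℝ E] :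
    IsClosed {p : C(E, K.Space) × E | IsTiledAt p.1 p.2} := by
  have : ProperSpace E := FiniteDimensional.proper_real E
  have := K.finite
  have key : {p : C(E, K.Space) × E | IsTiledAt p.1 p.2} = ⋃ s : K.obj (Module.finrank ℝ E),
      Prod.fst '' {q : (C(E, K.Space) × E) × stdSimplex ℝ (Fin (Module.finrank ℝ E + 1)) |
        IsTile q.1.1 s (q.1.2 - K.toAffine (K.top s) q.2)} := by
    ext p
    simp only [Set.mem_iUnion, Set.mem_image, Prod.exists, Set.mem_ofPred_eq]
    constructor
    · rintro ⟨s, u₀, h⟩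
      exact ⟨s, p.1, p.2, u₀, h, rfl⟩
    · rintro ⟨s, f, y, u₀, h, rfl⟩
      exact ⟨s, u₀, h⟩
  rw [key]
  refine isClosed_iUnion_of_finite fun s => isClosedMap_fst_of_compactSpace _ ?_
  simp only [IsTile, Set.ofPred_forall]
  refine isClosed_iInter fun u => isClosed_eq ?_ continuous_const
  have hA := K.continuous_toAffine (K.top s)
  have hA' : Continuous fun q : (C(E, K.Space) × E) × stdSimplex ℝ (Fin (Module.finrank ℝ E + 1)) =>
      K.toAffine (K.top s) q.2 := hA.comp continuous_snd
  exact ContinuousEval.continuous_eval.comp ((continuous_fst.comp continuous_fst).prodMk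
    (((continuous_snd.comp continuous_fst).sub hA').add continuous_const))

theorem IsIsometricWinding.isTiledAt [FiniteDimensional ℝ E] (hf : IsIsometricWinding K f) (y : E) :
    IsTiledAt f y := by
  have hcl : IsClosed {y | IsTiledAt f y} :=
    isClosed_setOf_isTiledAt.preimage (by fun_prop : Continuous fun y : E => (f, y))
  have hd : Dense {y | IsTiledAt f y} := by
    rw [dense_iff_inter_open]
    intro U hU hne
    obtain ⟨y, hy, s, hs⟩ := hf.exists_mem_top_cell hU hne
    exact ⟨y, hy, hf.isTiledAt_of_mem_cell hs⟩
  have := hd y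
  rwa [hcl.closure_eq] at this

theorem IsIsometricWinding.isTiledAt_hull [FiniteDimensional ℝ E] (hf : IsIsometricWinding K f)
    (g : Hull f) (y : E) : IsTiledAt g.toMap y := by
  have hcl : IsClosed {g : C(E, K.Space) | IsTiledAt g y} :=
    isClosed_setOf_isTiledAt.preimage (by fun_prop : Continuous fun g : C(E, K.Space) => (g, y))
  refine closure_minimal ?_ hcl g.2
  rintro _ ⟨t, rfl⟩
  obtain ⟨s, u₀, h⟩ := hf.isTiledAt (y - t)
  refine ⟨s, u₀, fun u => ?_⟩
  rw [← h u]
  change f (_ - t) = _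
  congr 1
  abel

end Tiles

end FlatBranched

end

noncomputable section

namespace FlatBranched

open SemiSimplicialSet FBSComplex
open scoped ENNReal

/-! ### Weighted sums over separated sets. -/

section Weight

variable {E : Type v} [NormedAddCommGroup E] 

/-- The weight `(1 + ‖y‖)^{-(d+1)}`, summable over uniformly discrete sets. -/
def weight [InnerProductSpace ℝ E] (y : E) : ℝ := (1 + ‖y‖) ^ (-((Module.finrank ℝ E + 1 : ℕ) : ℝ))

variable [InnerProductSpace ℝ E]

theorem weight_pos (y : E) : 0 < weight y := Real.rpow_pos_of_pos (by positivity) _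

theorem weight_mul_pow (y : E) : weight y * (1 + ‖y‖) ^ (Module.finrank ℝ E + 1) = 1 := by
  have : (0 : ℝ) < 1 + ‖y‖ := by positivity
  rw [weight, Real.rpow_neg this.le, Real.rpow_natCast]
  exact inv_mul_cancel₀ (by positivity)

theorem weight_le_mul {y z : E} {r : ℝ} (h : ‖z - y‖ ≤ r) :
    weight y ≤ (1 + r) ^ (Module.finrank ℝ E + 1) * weight z := by
  have h1 : 1 + ‖z‖ ≤ (1 + r) * (1 + ‖y‖) := by
    have h2 : ‖z‖ ≤ ‖y‖ + r := by
      calc ‖z‖ = ‖y + (z - y)‖ := by congr 1; abel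
        _ ≤ _ := (norm_add_le _ _).trans (by gcongr)
    nlinarith [norm_nonneg y, norm_nonneg (z - y)]
  have hy := weight_mul_pow y
  have hz := weight_mul_pow z
  have hpow : (1 + ‖z‖) ^ (Module.finrank ℝ E + 1) ≤
      (1 + r) ^ (Module.finrank ℝ E + 1) * (1 + ‖y‖) ^ (Module.finrank ℝ E + 1) := by
    rw [← mul_pow]
    gcongr
  have := weight_pos y
  have := weight_pos z
  calc weight y = weight y * (weight z * (1 + ‖z‖) ^ (Module.finrank ℝ E + 1)) := by
        rw [hz, mul_one]
    _ ≤ weight y * (weight z * ((1 + r) ^ (Module.finrank ℝ E + 1) *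
        (1 + ‖y‖) ^ (Module.finrank ℝ E + 1))) := by gcongr
    _ = (weight y * (1 + ‖y‖) ^ (Module.finrank ℝ E + 1)) *
        ((1 + r) ^ (Module.finrank ℝ E + 1) * weight z) := by ring
    _ = _ := by rw [hy, one_mul]

variable [FiniteDimensional ℝ E]

/-- On a ball of radius `r / 2` the weight is comparable to its value at the centre, so a sum over
an `r`-separated set is bounded by the integral of the weight over disjoint balls. The exponent `d +
1` makes this integral finite. -/
theorem exists_tsum_weight_le {r : ℝ} (hr : 0 < r) : ∃ C : ℝ≥0∞, C ≠ ∞ ∧ ∀ T : Set E,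
    (T.Pairwise fun y z => r ≤ dist y z) → ∑' y : T, ENNReal.ofReal (weight (y : E)) ≤ C := by
  borelize E
  set N := Module.finrank ℝ E + 1
  set V : ℝ≥0∞ := volume (Metric.ball (0 : E) (r / 2))
  have hV0 : V ≠ 0 := (Metric.measure_ball_pos _ _ (by positivity)).ne'
  have hVt : V ≠ ∞ := measure_ball_lt_top.ne
  set c : ℝ≥0∞ := ENNReal.ofReal ((1 + r / 2) ^ N)
  set I : ℝ≥0∞ := ∫⁻ z : E, ENNReal.ofReal (weight z)
  have hI : I ≠ ∞ := by
    have : Integrable (fun z : E => weight z) :=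
      integrable_one_add_norm (by push_cast; linarith)
    exact this.lintegral_lt_top.ne
  refine ⟨c * V⁻¹ * I, by finiteness, fun T hT => ?_⟩
  rw [ENNReal.tsum_eq_iSup_sum]
  refine iSup_le fun S => ?_
  have hmeas : Measurable fun z : E => ENNReal.ofReal (weight z) := by
    unfold weight
    fun_prop
  have hball : ∀ y : E, ENNReal.ofReal (weight y) ≤
      c * V⁻¹ * ∫⁻ z in Metric.ball y (r / 2), ENNReal.ofReal (weight z) := by
    intro y
    have h1 : ENNReal.ofReal (weight y) * V ≤
        c * ∫⁻ z in Metric.ball y (r / 2), ENNReal.ofReal (weight z) := by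
      rw [← lintegral_const_mul _ hmeas]
      calc ENNReal.ofReal (weight y) * V
          = ∫⁻ _ in Metric.ball y (r / 2), ENNReal.ofReal (weight y) := by
            rw [setLIntegral_const]
            congr 1
            exact (Measure.addHaar_ball_center volume y (r / 2)).symm
        _ ≤ _ := by
            refine setLIntegral_mono (by fun_prop) fun z hz => ?_
            rw [← ENNReal.ofReal_mul (by positivity)]
            refine ENNReal.ofReal_le_ofReal (weight_le_mul ?_)
            rw [← dist_eq_norm]
            exact (Metric.mem_ball.1 hz).le
    calc ENNReal.ofReal (weight y) = ENNReal.ofReal (weight y) * V * V⁻¹ := by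
          rw [mul_assoc, ENNReal.mul_inv_cancel hV0 hVt, mul_one]
      _ ≤ (c * ∫⁻ z in Metric.ball y (r / 2), ENNReal.ofReal (weight z)) * V⁻¹ := by gcongr
      _ = _ := by ring
  calc ∑ y ∈ S, ENNReal.ofReal (weight (y : E))
      ≤ ∑ y ∈ S, c * V⁻¹ * ∫⁻ z in Metric.ball (y : E) (r / 2), ENNReal.ofReal (weight z) :=
        Finset.sum_le_sum fun y _ => hball y
    _ = c * V⁻¹ * ∫⁻ z in ⋃ y ∈ S, Metric.ball (y : E) (r / 2), ENNReal.ofReal (weight z) := by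
        rw [← Finset.mul_sum, lintegral_biUnion_finset _ fun y _ => measurableSet_ball]
        intro y _ z _ hyz
        refine Metric.ball_disjoint_ball ?_
        have := hT y.2 z.2 (fun h => hyz (Subtype.ext h))
        linarith
    _ ≤ c * V⁻¹ * I := by
        gcongr
        exact setLIntegral_le_lintegral _ _

end Weight

/-! ### Separation of tiles and sparsity of fibres. -/

section Fibres

variable {E : Type v} [NormedAddCommGroup E] [InnerProductSpace ℝ E] [FiniteDimensional ℝ E]
  {K : FBSComplex.{u} E}

theorem FBSComplex.exists_ball_subset_toAffine (s : K.obj (Module.finrank ℝ E)) :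
    ∃ c : E, ∃ r > 0, ∀ z ∈ Metric.ball c r, ∃ u : stdSimplex ℝ (Fin (Module.finrank ℝ E + 1)),
      (∀ i, 0 < u i) ∧ K.toAffine (K.top s) u = z := by
  let d := Module.finrank ℝ E
  let b : Module.Basis (Fin d) ℝ E := basisOfLinearIndependentOfCardEqFinrank'
    _ (K.linearIndependent s) (by simp [d])
  let O : Set E := {z | (∀ i, 0 < b.repr z i) ∧ ∑ i, b.repr z i < 1}
  have hcont : ∀ i, Continuous fun z => b.repr z i := fun i =>
    (LinearMap.continuous_of_finiteDimensional (b.coord i) : _)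
  have hO : IsOpen O := by
    refine IsOpen.inter ?_ (isOpen_lt (continuous_finsetSum _ fun i _ => hcont i) continuous_const)
    have : {z | ∀ i, 0 < b.repr z i} = ⋂ i, {z | 0 < b.repr z i} := by ext; simp
    change IsOpen {z | ∀ i, 0 < b.repr z i}
    rw [this]
    exact isOpen_iInter_of_finite fun i => isOpen_lt continuous_const (hcont i)
  -- The barycenter of the affine simplex: its vertex `0` lies at the origin and the remaining `d`
  -- coordinates are all `1 / (d + 1)`.
  let c : E := ∑ i, (1 / (d + 1) : ℝ) • b i
  have hc : c ∈ O := by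
    have h1 : ∀ i, b.repr c i = 1 / (d + 1) := fun i => by
      simp [c, map_sum, Finsupp.single_apply]
    refine ⟨fun i => ?_, ?_⟩
    · rw [h1]; positivity
    · simp only [h1, Finset.sum_const, Finset.card_univ, Fintype.card_fin, nsmul_eq_mul]
      rw [mul_one_div, div_lt_one (by positivity)]
      linarith
  obtain ⟨r, hr, hball⟩ := Metric.isOpen_iff.1 hO c hc
  refine ⟨c, r, hr, fun z hz => ?_⟩
  obtain ⟨h1, h2⟩ := hball hz
  have hpos : ∀ i, 0 < (Fin.cons (1 - ∑ i, b.repr z i) (fun i => b.repr z i) : Fin (d + 1) → ℝ) i := by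
    intro i
    refine Fin.cases ?_ (fun i => ?_) i
    · simpa using h2
    · simpa using h1 i
  refine ⟨⟨Fin.cons (1 - ∑ i, b.repr z i) fun i => b.repr z i, fun i => (hpos i).le, ?_⟩, hpos, ?_⟩
  · rw [Fin.sum_univ_succ]
    simp only [Fin.cons_zero, Fin.cons_succ]
    ring
  · conv_rhs => rw [← b.sum_repr z]
    refine Finset.sum_congr rfl fun i _ => ?_
    congr 1
    exact (congrFun (coe_basisOfLinearIndependentOfCardEqFinrank' _ (K.linearIndependent s)
      (by simp)) i).symm

/-- The constant `r` is the radius of a ball inside the affine simplex. If two positions are closer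
than this, the tiles share an interior point of both; its image determines its barycentric
coordinates, so the positions agree. -/
theorem FBSComplex.exists_separated (s : K.obj (Module.finrank ℝ E)) : ∃ r > 0,
    ∀ f : C(E, K.Space), {t | IsTile f s t}.Pairwise fun t t' => r ≤ dist t t' := by
  obtain ⟨c, r, hr, hball⟩ := K.exists_ball_subset_toAffine s
  refine ⟨r, hr, fun f t ht t' ht' hne => ?_⟩
  by_contra hlt
  obtain ⟨u, hu, h1⟩ := hball c (Metric.mem_ball_self hr)
  obtain ⟨u', hu', h2⟩ := hball (c + (t - t')) (by
    rw [Metric.mem_ball, dist_eq_norm, add_sub_cancel_left, ← dist_eq_norm]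
    exact not_le.1 hlt)
  have h3 : charMap (K.top s) u = charMap (K.top s) u' := by
    rw [← ht u, ← ht' u', h1, h2]
    congr 1
    abel
  have h4 : u = u' := charMap_injOn hu hu' h3
  rw [h4, h2] at h1
  exact hne (sub_eq_zero.1 (by simpa using h1))

/-- Let `x` have coordinates `v` in the open cell `w`. A preimage of `x` in a tile of type `s` sits
at the point of the simplex with coordinates `θ_* v`, for some embedding `θ` of `w` as a face of
`s`. Hence the fibre is covered by finitely many translates, indexed by `(s, θ)`, of sets of tile
positions. -/
theorem IsIsometricWinding.exists_tsum_weight_fibre_le {f₀ : C(E, K.Space)}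
    (hf₀ : IsIsometricWinding K f₀) (x : K.Space) : ∃ C : ℝ≥0∞, C ≠ ∞ ∧ ∀ f : Hull f₀,
      ∑' y : (f.toMap ⁻¹' {x} : Set E), ENNReal.ofReal (weight (y : E)) ≤ C := by
  have := K.finite
  obtain ⟨w, v, hv, rfl⟩ := exists_mem_cell x
  let ι := K.obj (Module.finrank ℝ E) × (Fin (w.1 + 1) ↪o Fin (Module.finrank ℝ E + 1))
  have := Fintype.ofFinite ι
  choose r hr hsep using fun s => K.exists_separated s
  choose C hC hle using fun s => exists_tsum_weight_le (E := E) (hr s)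
  refine ⟨∑ i : ι, C i.1, ENNReal.sum_ne_top.2 fun i _ => hC i.1, fun f => ?_⟩
  let T : ι → Set E := fun i =>
    (fun t => t + K.toAffine (K.top i.1) (stdSimplex.map i.2 v)) '' {t | IsTile f.toMap i.1 t}
  have hsub : (f.toMap ⁻¹' {charMap w v} : Set E) ⊆ ⋃ i, T i := by
    intro y hy
    obtain ⟨s, u₀, h⟩ := hf₀.isTiledAt_hull f y
    have h1 : charMap w v = charMap (K.top s) u₀ := by
      rw [← h u₀, sub_add_cancel]
      exact hy.symm
    obtain ⟨θ, -, hθ⟩ := isFace_of_charMap_eq hv h1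
    refine Set.mem_iUnion.2 ⟨(s, θ), y - K.toAffine (K.top s) u₀, h, ?_⟩
    dsimp only at hθ ⊢
    rw [← hθ, sub_add_cancel]
  calc ∑' y : (f.toMap ⁻¹' {charMap w v} : Set E), ENNReal.ofReal (weight (y : E))
      ≤ ∑' y : ⋃ i, T i, ENNReal.ofReal (weight (y : E)) :=
        ENNReal.tsum_mono_subtype (fun y => ENNReal.ofReal (weight y)) hsub
    _ ≤ ∑ i, ∑' y : T i, ENNReal.ofReal (weight (y : E)) :=
        ENNReal.tsum_iUnion_le (fun y => ENNReal.ofReal (weight y)) T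
    _ ≤ ∑ i : ι, C i.1 := by
        refine Finset.sum_le_sum fun i _ => hle i.1 _ ?_
        rintro _ ⟨t, ht, rfl⟩ _ ⟨t', ht', rfl⟩ hne
        dsimp only
        rw [dist_add_right]
        exact hsep i.1 f.toMap ht ht' fun h => hne (by rw [h])

end Fibres

end FlatBranched

end

noncomputable section

namespace FlatBranched

open scoped ENNReal

/-! ### The functions `Γ_x(φ)` -/

section GammaFunctions

theorem exists_le_mul_weight {E : Type v} [NormedAddCommGroup E] [InnerProductSpace ℝ E]
    (φ : 𝓢(E, ℂ)) (n : ℕ) : ∃ M, 0 ≤ M ∧ ∀ y, ‖iteratedFDeriv ℝ n φ y‖ ≤ M * weight y := by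
  set N := Module.finrank ℝ E + 1
  refine ⟨2 ^ N * ((Finset.Iic (N, n)).sup fun m => SchwartzMap.seminorm ℝ m.1 m.2) φ,
    by positivity, fun y => ?_⟩
  have h := SchwartzMap.one_add_le_sup_seminorm_apply (𝕜 := ℝ) (m := (N, n)) le_rfl le_rfl φ y
  have hw := weight_mul_pow y
  calc ‖iteratedFDeriv ℝ n φ y‖
      = ((1 + ‖y‖) ^ N * ‖iteratedFDeriv ℝ n φ y‖) * weight y := by
        rw [mul_right_comm, mul_comm _ (weight y), hw, one_mul]
    _ ≤ _ := mul_le_mul_of_nonneg_right h (weight_pos y).le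

theorem exists_norm_le_mul_weight {E : Type v} [NormedAddCommGroup E] [InnerProductSpace ℝ E]
    (φ : 𝓢(E, ℂ)) : ∃ M, 0 ≤ M ∧ ∀ y, ‖φ y‖ ≤ M * weight y := by
  simpa using exists_le_mul_weight φ 0

variable {E : Type v} [NormedAddCommGroup E] [InnerProductSpace ℝ E] 
  {X : Type u} [TopologicalSpace X] {f₀ : C(E, X)}

theorem weight_neg (y : E) : weight (-y) = weight y := by simp [weight]

/-- The fibres over each point of the elements of the hull are uniformly locally finite. -/
def HasUniformlyDiscreteFibres (f₀ : C(E, X)) : Prop :=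
  ∀ x : X, ∃ C : ℝ, ∀ f : Hull f₀, Summable (fun y : (f.toMap ⁻¹' {x} : Set E) => weight (y : E)) ∧
    ∑' y : (f.toMap ⁻¹' {x} : Set E), weight (y : E) ≤ C

theorem IsIsometricWinding.hasUniformlyDiscreteFibres [FiniteDimensional ℝ E]
    {K : FBSComplex.{u} E} {f₀ : C(E, K.Space)}
    (hf₀ : IsIsometricWinding K f₀) : HasUniformlyDiscreteFibres f₀ := by
  intro x
  obtain ⟨C, hC, h⟩ := hf₀.exists_tsum_weight_fibre_le x
  refine ⟨C.toReal, fun f => ?_⟩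
  have h1 : ∑' y : (f.toMap ⁻¹' {x} : Set E), ENNReal.ofReal (weight (y : E)) ≠ ∞ :=
    ne_top_of_le_ne_top hC (h f)
  have h2 : ∀ y : (f.toMap ⁻¹' {x} : Set E), (ENNReal.ofReal (weight (y : E))).toReal = weight (y : E) :=
    fun y => ENNReal.toReal_ofReal (weight_pos _).le
  refine ⟨(ENNReal.summable_toReal h1).congr fun y => (h2 y), ?_⟩
  rw [← tsum_congr h2, ← ENNReal.tsum_toReal_eq fun _ => ENNReal.ofReal_ne_top]
  exact ENNReal.toReal_mono hC (h f)

theorem HasUniformlyDiscreteFibres.summable_norm (h : HasUniformlyDiscreteFibres f₀) (x : X)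
    (φ : 𝓢(E, ℂ)) (f : Hull f₀) :
    Summable fun y : (f.toMap ⁻¹' {x} : Set E) => ‖φ (-(y : E))‖ := by
  obtain ⟨C, hC⟩ := h x
  obtain ⟨M, -, hM⟩ := exists_norm_le_mul_weight φ
  refine Summable.of_nonneg_of_le (fun _ => norm_nonneg _) (fun y => ?_) ((hC f).1.mul_left M)
  simpa [weight_neg] using hM (-y)

theorem HasUniformlyDiscreteFibres.exists_norm_Γ_le (h : HasUniformlyDiscreteFibres f₀) (x : X) :
    ∃ C, 0 ≤ C ∧ ∀ (φ : 𝓢(E, ℂ)) (M : ℝ), (∀ y, ‖φ y‖ ≤ M * weight y) →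
      ∀ f, ‖Γ f₀ x φ f‖ ≤ C * M := by
  obtain ⟨C, hC⟩ := h x
  refine ⟨max C 0, le_max_right _ _, fun φ M hM f => ?_⟩
  have hM0 : 0 ≤ M := by
    have := (norm_nonneg _).trans (hM 0)
    exact nonneg_of_mul_nonneg_left this (weight_pos 0)
  have h1 : ∀ y : (f.toMap ⁻¹' {x} : Set E), ‖φ (-(y : E))‖ ≤ M * weight (y : E) := fun y => by
    simpa [weight_neg] using hM (-y)
  calc ‖Γ f₀ x φ f‖ ≤ ∑' y : (f.toMap ⁻¹' {x} : Set E), M * weight (y : E) :=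
        tsum_of_norm_bounded ((hC f).1.mul_left M).hasSum h1
    _ = M * ∑' y : (f.toMap ⁻¹' {x} : Set E), weight (y : E) := tsum_mul_left
    _ ≤ M * max C 0 := by
        gcongr
        exact (hC f).2.trans (le_max_left _ _)
    _ = _ := mul_comm _ _

/-- The strict superlevel sets are countable unions of closed sets. A set `D n m R k` asks for `n`
fibre points in the ball of radius `R`, with mutual distances at least `1 / (m + 1)` and with sum at
least `a + 1 / (k + 1)`. All these conditions are closed, the separation keeps points distinct in
the limit, and the projection that forgets the points is along a compact space. -/
theorem measurable_tsum_fibre [T1Space X] [FiniteDimensional ℝ E] (x : X) {g : E → ℝ}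
    (hg : Continuous g) :
    Measurable fun f : Hull f₀ => ∑' y : (f.toMap ⁻¹' {x} : Set E), ENNReal.ofReal (g y) := by
  have : ProperSpace E := FiniteDimensional.proper_real E
  refine measurable_of_Ioi fun a => ?_
  let D : ℕ → ℕ → ℕ → ℕ → Set (Hull f₀) := fun n m R k =>
    Prod.fst '' {q : Hull f₀ × (Fin n → Metric.closedBall (0 : E) R) |
      (∀ i, q.1.toMap (q.2 i) = x) ∧ (∀ i j, i ≠ j → 1 / ((m : ℝ) + 1) ≤ dist (q.2 i) (q.2 j)) ∧
      a + ((k : ℝ≥0∞) + 1)⁻¹ ≤ ∑ i, ENNReal.ofReal (g (q.2 i))}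
  have hD : ∀ n m R k, IsClosed (D n m R k) := by
    intro n m R k
    have : CompactSpace (Metric.closedBall (0 : E) R) :=
      isCompact_iff_compactSpace.1 (isCompact_closedBall 0 _)
    refine isClosedMap_fst_of_compactSpace _ ?_
    refine IsClosed.inter ?_ (IsClosed.inter ?_ ?_)
    · have : {q : Hull f₀ × (Fin n → Metric.closedBall (0 : E) R) |
        ∀ i, q.1.toMap (q.2 i) = x} = ⋂ i, {q | q.1.toMap (q.2 i) = x} := by ext; simp
      change IsClosed {q : Hull f₀ × (Fin n → Metric.closedBall (0 : E) R) |
        ∀ i, q.1.toMap (q.2 i) = x}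
      rw [this]
      refine isClosed_iInter fun i => isClosed_singleton.preimage ?_
      have h1 : Continuous fun q : Hull f₀ × (Fin n → Metric.closedBall (0 : E) R) => q.1.toMap :=
        continuous_subtype_val.comp continuous_fst
      have h2 : Continuous fun q : Hull f₀ × (Fin n → Metric.closedBall (0 : E) R) =>
          (q.2 i : E) := by fun_prop
      exact ContinuousEval.continuous_eval.comp (h1.prodMk h2)
    · have : {q : Hull f₀ × (Fin n → Metric.closedBall (0 : E) R) |
        ∀ i j, i ≠ j → 1 / ((m : ℝ) + 1) ≤ dist (q.2 i) (q.2 j)} =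
          ⋂ i, ⋂ j, ⋂ (_ : i ≠ j), {q | 1 / ((m : ℝ) + 1) ≤ dist (q.2 i) (q.2 j)} := by
        ext; simp
      change IsClosed {q : Hull f₀ × (Fin n → Metric.closedBall (0 : E) R) |
        ∀ i j, i ≠ j → 1 / ((m : ℝ) + 1) ≤ dist (q.2 i) (q.2 j)}
      rw [this]
      refine isClosed_iInter fun i => isClosed_iInter fun j => isClosed_iInter fun _ =>
        isClosed_le continuous_const (by fun_prop)
    · exact isClosed_le continuous_const
        (continuous_finsetSum _ fun i _ => ENNReal.continuous_ofReal.comp (by fun_prop))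
  have key : (fun f : Hull f₀ => ∑' y : (f.toMap ⁻¹' {x} : Set E), ENNReal.ofReal (g y)) ⁻¹'
      Set.Ioi a = ⋃ (n) (m) (R) (k), D n m R k := by
    ext f
    simp only [Set.mem_preimage, Set.mem_Ioi, Set.mem_iUnion]
    constructor
    · intro h
      rw [ENNReal.tsum_eq_iSup_sum, lt_iSup_iff] at h
      obtain ⟨S, hS⟩ := h
      let p : Fin S.card → E := fun i => ((S.equivFin.symm i : (f.toMap ⁻¹' {x} : Set E)) : E)
      have hp : ∀ i, f.toMap (p i) = x := fun i => ((S.equivFin.symm i).1).2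
      have hpinj : Function.Injective p := fun i j hij =>
        S.equivFin.symm.injective (Subtype.ext (Subtype.ext hij))
      obtain ⟨m, hm⟩ : ∃ m : ℕ, ∀ i j, i ≠ j → 1 / ((m : ℝ) + 1) ≤ dist (p i) (p j) := by
        have : ∀ᶠ m : ℕ in Filter.atTop, ∀ i j, i ≠ j → 1 / ((m : ℝ) + 1) ≤ dist (p i) (p j) := by
          refine Filter.eventually_all.2 fun i => Filter.eventually_all.2 fun j => ?_
          by_cases hij : i = j
          · simp [hij]
          · have := (tendsto_one_div_add_atTop_nhds_zero_nat (𝕜 := ℝ)).eventually_le_const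
              (dist_pos.2 (hpinj.ne hij))
            filter_upwards [this] with m hm _ using hm
        exact this.exists
      obtain ⟨R, hR⟩ : ∃ R : ℕ, ∀ i, p i ∈ Metric.closedBall (0 : E) R := by
        have : ∀ᶠ R : ℕ in Filter.atTop, ∀ i, p i ∈ Metric.closedBall (0 : E) R := by
          refine Filter.eventually_all.2 fun i => ?_
          filter_upwards [Filter.eventually_ge_atTop ⌈‖p i‖⌉₊] with R hR
          rw [mem_closedBall_zero_iff]
          exact (Nat.le_ceil _).trans (by exact_mod_cast hR)
        exact this.exists
      have hsum : ∑ i, ENNReal.ofReal (g (p i)) = ∑ y ∈ S, ENNReal.ofReal (g y) := by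
        rw [← Finset.sum_coe_sort S]
        exact Equiv.sum_comp S.equivFin.symm fun y => ENNReal.ofReal (g (y : (f.toMap ⁻¹' {x} : Set E)))
      obtain ⟨k, hk⟩ : ∃ k : ℕ, a + ((k : ℝ≥0∞) + 1)⁻¹ ≤ ∑ y ∈ S, ENNReal.ofReal (g y) := by
        obtain ⟨k, hk⟩ := ENNReal.exists_inv_nat_lt (tsub_pos_of_lt hS).ne'
        refine ⟨k, ?_⟩
        have h1 : ((k : ℝ≥0∞) + 1)⁻¹ ≤ ∑ y ∈ S, ENNReal.ofReal (g y) - a :=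
          (ENNReal.inv_le_inv.2 le_self_add).trans hk.le
        calc a + ((k : ℝ≥0∞) + 1)⁻¹ ≤ a + (∑ y ∈ S, ENNReal.ofReal (g y) - a) := by gcongr
          _ = _ := add_tsub_cancel_of_le hS.le
      exact ⟨S.card, m, R, k, (f, fun i => ⟨p i, hR i⟩), ⟨hp, hm, hsum ▸ hk⟩, rfl⟩
    · rintro ⟨n, m, R, k, ⟨f, p⟩, ⟨h1, h2, h3⟩, rfl⟩
      dsimp only at h1 h2 h3 ⊢
      have hinj : Function.Injective fun i => (⟨p i, h1 i⟩ : (f.toMap ⁻¹' {x} : Set E)) := by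
        intro i j hij
        by_contra hne
        have h4 := h2 i j hne
        have h5 : p i = p j := Subtype.ext (Subtype.mk.inj hij)
        rw [h5, dist_self] at h4
        have : (0 : ℝ) < 1 / ((m : ℝ) + 1) := by positivity
        linarith
      have h4 : ∑ i, ENNReal.ofReal (g (p i)) ≤
          ∑' y : (f.toMap ⁻¹' {x} : Set E), ENNReal.ofReal (g y) := by
        rw [← tsum_fintype (L := SummationFilter.unconditional _)]
        exact ENNReal.tsum_comp_le_tsum_of_injective hinj
          fun y : (f.toMap ⁻¹' {x} : Set E) => ENNReal.ofReal (g y)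
      refine lt_of_lt_of_le ?_ (h3.trans h4)
      refine ENNReal.lt_add_right ?_ (by simp)
      rintro rfl
      rw [top_add, top_le_iff] at h3
      exact ENNReal.sum_ne_top.2 (fun _ _ => ENNReal.ofReal_ne_top) h3
  rw [key]
  exact MeasurableSet.iUnion fun n => MeasurableSet.iUnion fun m => MeasurableSet.iUnion fun R =>
    MeasurableSet.iUnion fun k => (hD n m R k).measurableSet

theorem tsum_eq_toReal_sub_toReal {ι : Type*} {h : ι → ℝ} (hs : Summable h) :
    ∑' i, h i = (∑' i, ENNReal.ofReal (h i)).toReal - (∑' i, ENNReal.ofReal (-h i)).toReal := by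
  rw [ENNReal.tsum_toReal_eq fun _ => ENNReal.ofReal_ne_top,
    ENNReal.tsum_toReal_eq fun _ => ENNReal.ofReal_ne_top]
  simp only [ENNReal.toReal_ofReal']
  have h1 : Summable fun i => max (h i) 0 := by
    refine Summable.of_nonneg_of_le (fun i => le_max_right _ _) (fun i => ?_) hs.abs
    exact max_le (le_abs_self _) (abs_nonneg _)
  have h2 : Summable fun i => max (-h i) 0 := by
    refine Summable.of_nonneg_of_le (fun i => le_max_right _ _) (fun i => ?_) hs.abs
    exact max_le (neg_le_abs _) (abs_nonneg _)
  rw [← h1.tsum_sub h2]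
  exact tsum_congr fun i => (max_zero_sub_max_neg_zero_eq_self _).symm

/-- The fibre of `T_{-t} f` is the fibre of `f` moved by `-t`; with the sign in `φ(-y)` this moves
`φ` to `φ(· + t)`. -/
theorem Γ_vadd (x : X) (φ : 𝓢(E, ℂ)) (t : E) (f : Hull f₀) :
    Γ f₀ x φ (-t +ᵥ f) = Γ f₀ x (SchwartzMap.compSubConstCLM ℂ (-t) φ) f := by
  let e : ((-t +ᵥ f : Hull f₀).toMap ⁻¹' {x} : Set E) ≃ (f.toMap ⁻¹' {x} : Set E) :=
    { toFun := fun y => ⟨y - -t, y.2⟩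
      invFun := fun y => ⟨y + -t, by
        change f.toMap (y + -t - -t) = x
        rw [add_sub_cancel_right]; exact y.2⟩
      left_inv := fun y => Subtype.ext (sub_add_cancel _ _)
      right_inv := fun y => Subtype.ext (add_sub_cancel_right _ _) }
  rw [Γ, Γ, ← e.tsum_eq]
  refine tsum_congr fun y => ?_
  rw [SchwartzMap.compSubConstCLM_apply]
  congr 1
  change -(y : E) = -((y : E) - -t) - -t
  abel

instance : MeasurableConstVAdd E (Hull f₀) where
  measurable_const_vadd t := by
    have : Continuous fun f : Hull f₀ => t +ᵥ f :=
      Continuous.subtype_mk ((continuous_translate t).comp continuous_subtype_val) _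
    exact this.measurable

variable [T1Space X] [FiniteDimensional ℝ E]

theorem HasUniformlyDiscreteFibres.measurable_Γ (h : HasUniformlyDiscreteFibres f₀) (x : X)
    (φ : 𝓢(E, ℂ)) : Measurable (Γ f₀ x φ) := by
  have hs : ∀ f : Hull f₀, Summable fun y : (f.toMap ⁻¹' {x} : Set E) => φ (-(y : E)) :=
    fun f => (h.summable_norm x φ f).of_norm
  have hφ : Continuous fun y : E => φ (-y) := φ.continuous.comp continuous_neg
  have hre : Measurable fun f => (Γ f₀ x φ f).re := by
    have : (fun f => (Γ f₀ x φ f).re) = fun f : Hull f₀ =>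
        (∑' y : (f.toMap ⁻¹' {x} : Set E), ENNReal.ofReal (φ (-(y : E))).re).toReal -
        (∑' y : (f.toMap ⁻¹' {x} : Set E), ENNReal.ofReal (-(φ (-(y : E))).re)).toReal := by
      funext f
      rw [Γ, Complex.re_tsum (hs f)]
      exact tsum_eq_toReal_sub_toReal (Complex.hasSum_re (hs f).hasSum).summable
    rw [this]
    exact (measurable_tsum_fibre x (Complex.continuous_re.comp hφ)).ennreal_toReal.sub
      (measurable_tsum_fibre x (Complex.continuous_re.comp hφ).neg).ennreal_toReal
  have him : Measurable fun f => (Γ f₀ x φ f).im := by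
    have : (fun f => (Γ f₀ x φ f).im) = fun f : Hull f₀ =>
        (∑' y : (f.toMap ⁻¹' {x} : Set E), ENNReal.ofReal (φ (-(y : E))).im).toReal -
        (∑' y : (f.toMap ⁻¹' {x} : Set E), ENNReal.ofReal (-(φ (-(y : E))).im)).toReal := by
      funext f
      rw [Γ, Complex.im_tsum (hs f)]
      exact tsum_eq_toReal_sub_toReal (Complex.hasSum_im (hs f).hasSum).summable
    rw [this]
    exact (measurable_tsum_fibre x (Complex.continuous_im.comp hφ)).ennreal_toReal.sub
      (measurable_tsum_fibre x (Complex.continuous_im.comp hφ).neg).ennreal_toReal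
  exact measurable_of_re_im hre him

variable (μ : Measure (Hull f₀)) [IsProbabilityMeasure μ]

theorem HasUniformlyDiscreteFibres.memLp_Γ (h : HasUniformlyDiscreteFibres f₀) (x : X)
    (φ : 𝓢(E, ℂ)) : MemLp (Γ f₀ x φ) 2 μ := by
  obtain ⟨C, -, hC⟩ := h.exists_norm_Γ_le x
  obtain ⟨M, -, hM⟩ := exists_norm_le_mul_weight φ
  exact MemLp.of_bound (h.measurable_Γ x φ).aestronglyMeasurable _
    (Filter.Eventually.of_forall (hC φ M hM))

/-- The linear map `φ ↦ Γ_x(φ)` to `L²`. -/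
def toL2Γ (h : HasUniformlyDiscreteFibres f₀) (x : X) : 𝓢(E, ℂ) →ₗ[ℂ] Lp ℂ 2 μ where
  toFun φ := (h.memLp_Γ μ x φ).toLp
  map_add' φ ψ := by
    rw [← MemLp.toLp_add]
    congr 1
    funext f
    exact ((h.summable_norm x φ f).of_norm).tsum_add ((h.summable_norm x ψ f).of_norm)
  map_smul' c φ := by
    rw [RingHom.id_apply, ← MemLp.toLp_const_smul]
    congr 1
    funext f
    exact tsum_const_smul'' c

variable (h : HasUniformlyDiscreteFibres f₀)

theorem coeFn_toL2Γ (x : X) (φ : 𝓢(E, ℂ)) : toL2Γ μ h x φ =ᵐ[μ] Γ f₀ x φ :=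
  (h.memLp_Γ μ x φ).coeFn_toLp

theorem exists_norm_toL2Γ_le (x : X) : ∃ C, 0 ≤ C ∧ ∀ (φ : 𝓢(E, ℂ)) (M : ℝ),
    (∀ y, ‖φ y‖ ≤ M * weight y) → ‖toL2Γ μ h x φ‖ ≤ C * M := by
  obtain ⟨C, hC0, hC⟩ := h.exists_norm_Γ_le x
  refine ⟨C, hC0, fun φ M hM => ?_⟩
  -- A point of the hull serves only to see that `C * M` is nonnegative.
  obtain ⟨f⟩ : Nonempty (Hull f₀) := ⟨⟨f₀, subset_closure ⟨0, by ext; simp [translate]⟩⟩⟩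
  have hM0 : 0 ≤ C * M := (norm_nonneg _).trans (hC φ M hM f)
  have := Lp.norm_le_of_ae_bound (μ := μ) (p := 2) (f := toL2Γ μ h x φ) hM0 (by
    filter_upwards [coeFn_toL2Γ μ h x φ] with f hf
    rw [hf]
    exact hC φ M hM f)
  simpa [measureUnivNNReal] using this

theorem inner_toL2Γ (x y : X) (φ₁ φ₂ : 𝓢(E, ℂ)) :
    ⟪toL2Γ μ h x φ₁, toL2Γ μ h y φ₂⟫_ℂ = ∫ f, star (Γ f₀ x φ₁ f) * Γ f₀ y φ₂ f ∂μ := by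
  rw [L2.inner_def]
  refine integral_congr_ae ?_
  filter_upwards [coeFn_toL2Γ μ h x φ₁, coeFn_toL2Γ μ h y φ₂] with f h1 h2
  rw [h1, h2, RCLike.inner_apply, mul_comm]
  rfl

variable [VAddInvariantMeasure E (Hull f₀) μ]

theorem toL2Γ_vadd (x : X) (φ : 𝓢(E, ℂ)) (t : E) :
    (fun f => toL2Γ μ h x φ (-t +ᵥ f)) =ᵐ[μ]
      toL2Γ μ h x (SchwartzMap.compSubConstCLM ℂ (-t) φ) := by
  have h1 := (measurePreserving_vadd (-t) μ).quasiMeasurePreserving.ae_eq_comp (coeFn_toL2Γ μ h x φ)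
  filter_upwards [h1, coeFn_toL2Γ μ h x (SchwartzMap.compSubConstCLM ℂ (-t) φ)] with f h2 h3
  rw [h3, ← Γ_vadd]
  exact h2

theorem inner_toL2Γ_translate (x y : X) (φ₁ φ₂ : 𝓢(E, ℂ)) (t : E) :
    ⟪toL2Γ μ h x (SchwartzMap.compSubConstCLM ℂ t φ₁),
      toL2Γ μ h y (SchwartzMap.compSubConstCLM ℂ t φ₂)⟫_ℂ =
    ⟪toL2Γ μ h x φ₁, toL2Γ μ h y φ₂⟫_ℂ := by
  obtain ⟨t, rfl⟩ : ∃ s, t = -s := ⟨-t, (neg_neg t).symm⟩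
  rw [inner_toL2Γ, inner_toL2Γ]
  simp only [← Γ_vadd]
  exact integral_vadd_eq_self (fun f => star (Γ f₀ x φ₁ f) * Γ f₀ y φ₂ f)

end GammaFunctions

end FlatBranched

end

noncomputable section

set_option linter.unusedSectionVars false

namespace FlatBranched

open scoped ENNReal
open Filter Topology

/-! ### Bochner's theorem -/

section Bochner

variable {E : Type v} [NormedAddCommGroup E] [InnerProductSpace ℝ E] [FiniteDimensional ℝ E]
  [MeasurableSpace E] [BorelSpace E]

/-- Integrate `𝓕 f` against Gaussians `exp(-‖k‖² / (n + 1))`. Moving the Fourier transform to the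
Gaussian gives an approximate identity, so the integrals tend to `f 0`; since `𝓕 f ≥ 0`, Fatou's
lemma bounds its integral by `f 0`. -/
theorem integrable_fourier_of_nonneg {f : E → ℂ} (hf : Integrable f) (hc : Continuous f)
    (hpos : ∀ k, 0 ≤ 𝓕 f k) : Integrable (𝓕 f) := by
  have hF : Continuous (𝓕 f) :=
    VectorFourier.fourierIntegral_continuous Real.continuous_fourierChar continuous_inner hf
  let r : E → ℝ := fun k => (𝓕 f k).re
  have hr : ∀ k, 𝓕 f k = (r k : ℂ) := fun k => by
    have := (Complex.le_def.1 (hpos k)).2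
    exact Complex.ext rfl (by simpa using this.symm)
  have hr0 : ∀ k, 0 ≤ r k := fun k => by simpa using (Complex.le_def.1 (hpos k)).1
  have hrc : Continuous r := Complex.continuous_re.comp hF
  let g : ℕ → E → ℝ := fun n k => Real.exp (-((n : ℝ) + 1)⁻¹ * ‖k‖ ^ 2) * r k
  have hbound : ∀ k, ‖r k‖ ≤ ∫ v, ‖f v‖ := fun k => by
    refine (Complex.abs_re_le_norm _).trans ?_
    exact VectorFourier.norm_fourierIntegral_le_integral_norm _ _ _ _ _
  have hexp : ∀ n : ℕ, Integrable fun k : E => Real.exp (-((n : ℝ) + 1)⁻¹ * ‖k‖ ^ 2) := by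
    intro n
    have := (GaussianFourier.integrable_cexp_neg_mul_sq_norm_add (V := E)
      (b := (((n : ℝ) + 1)⁻¹ : ℝ)) (by rw [Complex.ofReal_re]; positivity) 0 0).re
    refine this.congr (Eventually.of_forall fun k => ?_)
    simp only [zero_mul, add_zero]
    rw [← Complex.ofReal_pow, ← Complex.ofReal_neg, ← Complex.ofReal_mul, ← Complex.ofReal_exp]
    rfl
  have hg : ∀ n, Integrable (g n) := fun n =>
    (hexp n).mul_bdd hrc.aestronglyMeasurable (Eventually.of_forall hbound)
  have hlim : Tendsto (fun n => ∫ k, g n k) atTop (𝓝 (f 0).re) := by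
    have h1 := (Real.tendsto_integral_gaussian_smul' hf (v := 0) hc.continuousAt).comp
      (tendsto_natCast_atTop_atTop (R := ℝ) |>.comp (tendsto_add_atTop_nat 1))
    have h2 := (Complex.continuous_re.tendsto _).comp h1
    refine h2.congr fun n => ?_
    simp only [Function.comp_apply]
    set c : ℝ := ((n + 1 : ℕ) : ℝ) with hcdef
    have hcpos : 0 < c := by positivity
    have J : Integrable (fun w : E => Complex.exp (-(c⁻¹ : ℝ) * ‖w‖ ^ 2)) := by
      simpa using GaussianFourier.integrable_cexp_neg_mul_sq_norm_add (V := E)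
        (b := (c⁻¹ : ℝ)) (by simpa using hcpos) 0 0
    -- Self-adjointness of the Fourier transform, for the Gaussian and `f`.
    have h3 := VectorFourier.integral_fourierIntegral_smul_eq_flip (L := innerₗ E)
      (μ := volume) (ν := volume) Real.continuous_fourierChar continuous_inner J hf
    have h4 : ∀ w : E, VectorFourier.fourierIntegral 𝐞 volume (innerₗ E)
        (fun w : E => Complex.exp (-(c⁻¹ : ℝ) * ‖w‖ ^ 2)) w =
        ((Real.pi * c : ℂ) ^ (Module.finrank ℝ E / 2 : ℂ) *
          Complex.exp (-Real.pi ^ 2 * c * ‖0 - w‖ ^ 2)) := by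
      intro w
      have := fourier_gaussian_innerProductSpace (V := E) (b := (c⁻¹ : ℝ)) (by simpa using hcpos) w
      refine Eq.trans this ?_
      simp only [Complex.ofReal_inv, div_inv_eq_mul, zero_sub, norm_neg]
      congr 2
      ring
    simp only [h4] at h3
    rw [h3]
    have h5 : ∀ w : E, Complex.exp (-(c⁻¹ : ℝ) * ‖w‖ ^ 2) •
        VectorFourier.fourierIntegral 𝐞 volume (innerₗ E).flip f w = ((g n w : ℝ) : ℂ) := by
      intro w
      have : VectorFourier.fourierIntegral 𝐞 volume (innerₗ E).flip f w = 𝓕 f w := by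
        rw [flip_innerₗ]; rfl
      rw [this, hr, smul_eq_mul]
      simp only [g, hcdef]
      push_cast
      rfl
    simp only [h5]
    rw [integral_complex_ofReal, Complex.ofReal_re]
  have hfin : ∫⁻ k, ENNReal.ofReal (r k) ≤ ENNReal.ofReal (f 0).re := by
    have h1 : ∀ k, Tendsto (fun n => ENNReal.ofReal (g n k)) atTop (𝓝 (ENNReal.ofReal (r k))) := by
      intro k
      refine ENNReal.tendsto_ofReal ?_
      have h2 : Tendsto (fun n : ℕ => -((n : ℝ) + 1)⁻¹ * ‖k‖ ^ 2) atTop (𝓝 0) := by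
        have := (tendsto_one_div_add_atTop_nhds_zero_nat (𝕜 := ℝ)).neg.mul_const (‖k‖ ^ 2)
        simpa using this
      have h3 := ((Real.continuous_exp.tendsto 0).comp h2).mul_const (r k)
      simpa [g] using h3
    calc ∫⁻ k, ENNReal.ofReal (r k)
        = ∫⁻ k, liminf (fun n => ENNReal.ofReal (g n k)) atTop :=
          lintegral_congr fun k => (h1 k).liminf_eq.symm
      _ ≤ liminf (fun n => ∫⁻ k, ENNReal.ofReal (g n k)) atTop :=
          lintegral_liminf_le' fun n => (hg n).aestronglyMeasurable.aemeasurable.ennreal_ofReal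
      _ = liminf (fun n => ENNReal.ofReal (∫ k, g n k)) atTop := by
          congr 1
          funext n
          rw [ofReal_integral_eq_lintegral_ofReal (hg n)
            (Eventually.of_forall fun k => mul_nonneg (Real.exp_nonneg _) (hr0 k))]
      _ = ENNReal.ofReal (f 0).re := (ENNReal.tendsto_ofReal hlim).liminf_eq
  refine ⟨hF.aestronglyMeasurable, ?_⟩
  rw [hasFiniteIntegral_iff_norm]
  refine lt_of_le_of_lt (le_of_eq ?_) (hfin.trans_lt ENNReal.ofReal_lt_top)
  refine lintegral_congr fun k => ?_
  rw [hr, Complex.norm_real, Real.norm_of_nonneg (hr0 k)]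

/-- The character `k ↦ exp(-2πi k·t)`. -/
def char (t k : E) : ℂ := Complex.exp (-(2 * Real.pi * ⟪k, t⟫_ℝ : ℝ) * Complex.I)

theorem char_eq_fourierChar (t k : E) : char t k = (𝐞 (-⟪k, t⟫_ℝ) : ℂ) := by
  rw [char, Real.fourierChar_apply]
  congr 1
  push_cast
  ring

theorem norm_char (t k : E) : ‖char t k‖ = 1 := by
  rw [char_eq_fourierChar]
  exact Circle.norm_coe _

theorem continuous_char (t : E) : Continuous (char t) := by
  unfold char
  fun_prop

theorem char_zero (k : E) : char 0 k = 1 := by simp [char]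

theorem char_add (s t k : E) : char (s + t) k = char s k * char t k := by
  rw [char, char, char, ← Complex.exp_add, inner_add_right]
  congr 1
  push_cast
  ring

theorem star_char (t k : E) : star (char t k) = char (-t) k := by
  rw [char, char, ← starRingEnd_apply, ← Complex.exp_conj]
  congr 1
  rw [map_mul, map_neg, Complex.conj_ofReal, Complex.conj_I, inner_neg_right]
  push_cast
  ring

theorem integral_char_eq_charFun (ν : Measure E) (t : E) :
    ∫ k, char t k ∂ν = charFun ν (-(2 * Real.pi) • t) := by
  rw [charFun_apply]
  refine integral_congr_ae (Eventually.of_forall fun k => ?_)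
  simp only [char, inner_smul_right]
  congr 2
  push_cast
  ring

/-- These integrals are characteristic functions up to the rescaling of the argument by `-2π`. -/
theorem ext_of_integral_char {ν ν' : Measure E} [IsFiniteMeasure ν] [IsFiniteMeasure ν']
    (h : ∀ t, ∫ k, char t k ∂ν = ∫ k, char t k ∂ν') : ν = ν' := by
  refine Measure.ext_of_charFun (funext fun s => ?_)
  have := h (-(2 * Real.pi)⁻¹ • s)
  rw [integral_char_eq_charFun, integral_char_eq_charFun, smul_smul] at this
  rwa [neg_mul_neg, mul_inv_cancel₀ (by positivity), one_smul] at this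

variable {H : Type*} [NormedAddCommGroup H] [InnerProductSpace ℂ H] [CompleteSpace H]

section

variable {u : E → H} (hu : Continuous u) (hinv : ∀ s r t, ⟪u (s + t), u (r + t)⟫_ℂ = ⟪u s, u r⟫_ℂ)

include hinv in
theorem norm_eq_of_translation_invariant (t : E) : ‖u t‖ = ‖u 0‖ := by
  have h := hinv 0 0 t
  rw [zero_add, inner_self_eq_norm_sq_to_K, inner_self_eq_norm_sq_to_K] at h
  have h2 : ‖u t‖ ^ 2 = ‖u 0‖ ^ 2 := by exact_mod_cast h
  exact (sq_eq_sq₀ (norm_nonneg _) (norm_nonneg _)).1 h2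

include hu hinv in
theorem integrable_smul_of_translation_invariant {h : E → ℂ} (hh : Integrable h) (t : E) :
    Integrable fun s => h s • u (s + t) := by
  refine (hh.norm.mul_const ‖u 0‖).mono' (hh.aestronglyMeasurable.smul
    (hu.comp (continuous_add_const t)).aestronglyMeasurable) (Eventually.of_forall fun s => ?_)
  rw [norm_smul, norm_eq_of_translation_invariant hinv (s + t)]

include hu hinv in
theorem inner_integral_smul_left {h : E → ℂ} (hh : Integrable h) (t : E) (v : H) :
    ⟪v, ∫ s, h s • u (s + t)⟫_ℂ = ∫ s, h s * ⟪v, u (s + t)⟫_ℂ := by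
  rw [← integral_inner (integrable_smul_of_translation_invariant hu hinv hh t) v]
  simp only [inner_smul_right]

include hu hinv in
-- Expand both integrals and substitute `r = s + t`: by invariance the inner product depends on `t`
-- only, and the integral over `s` leaves the autocorrelation of `h`.
theorem inner_integral_smul_eq {h : E → ℂ} (hh : Integrable h) :
    ⟪∫ s, h s • u s, ∫ s, h s • u s⟫_ℂ =
      ∫ t, ⟪u 0, u t⟫_ℂ * ∫ s, star (h s) * h (s + t) := by
  have h1 : ∀ v, ⟪∫ s, h s • u s, v⟫_ℂ = ∫ s, star (h s) * ⟪u s, v⟫_ℂ := by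
    intro v
    have := inner_integral_smul_left hu hinv hh 0 v
    simp only [add_zero] at this
    rw [← inner_conj_symm, this, ← integral_conj]
    refine integral_congr_ae (Eventually.of_forall fun s => ?_)
    simp only [map_mul, inner_conj_symm]
    rfl
  have hA : Continuous fun t => ⟪u 0, u t⟫_ℂ := continuous_const.inner hu
  have hbd : ∀ t, ‖⟪u 0, u t⟫_ℂ‖ ≤ ‖u 0‖ * ‖u 0‖ := fun t => by
    rw [← norm_eq_of_translation_invariant hinv t]
    refine (norm_inner_le_norm _ _).trans ?_
    rw [norm_eq_of_translation_invariant hinv t]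
  have h2 : ∀ s, ⟪u s, ∫ r, h r • u r⟫_ℂ = ∫ t, h (s + t) * ⟪u 0, u t⟫_ℂ := by
    intro s
    have := inner_integral_smul_left hu hinv hh 0 (u s)
    simp only [add_zero] at this
    rw [this, ← integral_add_left_eq_self _ s]
    refine integral_congr_ae (Eventually.of_forall fun t => ?_)
    dsimp only
    rw [← hinv 0 t s, zero_add, add_comm t s]
  rw [h1]
  simp only [h2]
  simp only [← integral_const_mul]
  rw [integral_integral_swap]
  · refine integral_congr_ae (Eventually.of_forall fun t => ?_)
    dsimp only
    refine integral_congr_ae (Eventually.of_forall fun s => ?_)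
    dsimp only
    ring
  · have hprod : Integrable (fun p : E × E => star (h p.1) * h (p.1 + p.2))
        (volume.prod volume) := by
      have h3 : Integrable (fun p : E × E => star (h p.1) * h p.2) (volume.prod volume) := by
        refine Integrable.mul_prod (f := fun s => star (h s)) ?_ hh
        exact Complex.conjLIE.toContinuousLinearEquiv.toContinuousLinearMap.integrable_comp hh
      exact (measurePreserving_prod_add volume volume).integrable_comp_of_integrable h3
    have h4 := hprod.mul_bdd (g := fun p : E × E => ⟪u 0, u p.2⟫_ℂ)
      (hA.comp continuous_snd).aestronglyMeasurable (Eventually.of_forall fun p => hbd p.2)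
    refine h4.congr (Eventually.of_forall fun p => ?_)
    simp only [Function.uncurry]
    ring

end

end Bochner

end FlatBranched

end

noncomputable section

set_option linter.unusedSectionVars false

namespace FlatBranched

open scoped ENNReal
open Filter Topology

/-! ### Gaussian regularization, Bochner's theorem and the effect of smoothing on spectral measures.
-/

section Bochner

variable {E : Type v} [NormedAddCommGroup E] [InnerProductSpace ℝ E] [FiniteDimensional ℝ E]
  [MeasurableSpace E] [BorelSpace E]

theorem integrable_rexp_neg_mul_sq {b : ℝ} (hb : 0 < b) :
    Integrable fun s : E => Real.exp (-b * ‖s‖ ^ 2) := by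
  have := (GaussianFourier.integrable_cexp_neg_mul_sq_norm_add (V := E)
    (b := (b : ℝ)) (by rwa [Complex.ofReal_re]) 0 0).re
  refine this.congr (Eventually.of_forall fun k => ?_)
  simp only [zero_mul, add_zero]
  rw [← Complex.ofReal_pow, ← Complex.ofReal_neg, ← Complex.ofReal_mul, ← Complex.ofReal_exp]
  rfl

theorem fourier_eq_integral_char (f : E → ℂ) (k : E) : 𝓕 f k = ∫ t, char k t * f t := by
  rw [Real.fourier_eq]
  refine integral_congr_ae (Eventually.of_forall fun t => ?_)
  simp only [char_eq_fourierChar, Circle.smul_def, smul_eq_mul]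

theorem fourierInv_eq_integral_char (f : E → ℂ) (t : E) : 𝓕⁻ f t = ∫ k, char (-t) k * f k := by
  rw [Real.fourierInv_eq]
  refine integral_congr_ae (Eventually.of_forall fun k => ?_)
  simp only [char_eq_fourierChar, Circle.smul_def, smul_eq_mul, inner_neg_right, neg_neg]

variable {H : Type*} [NormedAddCommGroup H] [InnerProductSpace ℂ H] [CompleteSpace H]
  {u : E → H} (hu : Continuous u) (hinv : ∀ s r t, ⟪u (s + t), u (r + t)⟫_ℂ = ⟪u s, u r⟫_ℂ)

include hu hinv in
-- A Gaussian times a character is, up to a positive constant, the autocorrelation of another such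
-- function `h`. So the Fourier transform at `k` is a positive multiple of `‖∫ h(s) u(s) ds‖²`.
theorem fourier_inner_mul_gaussian_nonneg {ε : ℝ} (hε : 0 < ε) (k : E) :
    0 ≤ 𝓕 (fun t => ⟪u 0, u t⟫_ℂ * (Real.exp (-ε * ‖t‖ ^ 2) : ℂ)) k := by
  let h : E → ℂ := fun s => char k s * (Real.exp (-(2 * ε) * ‖s‖ ^ 2) : ℂ)
  have hh : Integrable h := by
    refine (integrable_rexp_neg_mul_sq (E := E) (by positivity : 0 < 2 * ε)).ofReal.bdd_mul (c := 1)
      (continuous_char k).aestronglyMeasurable ?_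
    exact Eventually.of_forall fun s => (norm_char k s).le
  set c : ℝ := ∫ s : E, Real.exp (-(4 * ε) * ‖s‖ ^ 2) with hc
  have hcpos : 0 < c := by
    rw [hc, GaussianFourier.integral_rexp_neg_mul_sq_norm (by positivity)]
    positivity
  have hchar : ∀ s t, star (char k s) * char k (s + t) = char k t := by
    intro s t
    have h1 : char k (s + t) = char k s * char k t := by
      rw [char, char, char, ← Complex.exp_add, inner_add_left]
      congr 1
      push_cast
      ring
    have h2 : star (char k s) * char k s = 1 := by
      have := Complex.conj_mul' (char k s)
      rw [norm_char] at this
      simpa using this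
    rw [h1, ← mul_assoc, h2, one_mul]
  have hconv : ∀ t, ∫ s, star (h s) * h (s + t) =
      c * (char k t * (Real.exp (-ε * ‖t‖ ^ 2) : ℂ)) := by
    intro t
    have h1 : ∀ s, star (h s) * h (s + t) = ((Real.exp (-(4 * ε) * ‖s + (2 : ℝ)⁻¹ • t‖ ^ 2) : ℝ) : ℂ) *
        (char k t * (Real.exp (-ε * ‖t‖ ^ 2) : ℂ)) := by
      intro s
      -- From `‖s‖² + ‖s + t‖² = 2 ‖s + t/2‖² + ‖t‖² / 2`: the exponent `2ε` in `h` gives exactly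
      -- `ε` in `t`, and `4ε` in the variable to be integrated out.
      have h2 : (Real.exp (-(2 * ε) * ‖s‖ ^ 2)) * (Real.exp (-(2 * ε) * ‖s + t‖ ^ 2)) =
          (Real.exp (-(4 * ε) * ‖s + (2 : ℝ)⁻¹ • t‖ ^ 2)) * (Real.exp (-ε * ‖t‖ ^ 2)) := by
        rw [← Real.exp_add, ← Real.exp_add, norm_add_sq_real, norm_add_sq_real, inner_smul_right,
          norm_smul]
        congr 1
        norm_num
        ring
      calc star (h s) * h (s + t)
          = (star (char k s) * char k (s + t)) *
            ((Real.exp (-(2 * ε) * ‖s‖ ^ 2)) * (Real.exp (-(2 * ε) * ‖s + t‖ ^ 2)) : ℝ) := by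
            simp only [h, star_mul']
            rw [show star ((Real.exp (-(2 * ε) * ‖s‖ ^ 2) : ℝ) : ℂ) =
              ((Real.exp (-(2 * ε) * ‖s‖ ^ 2) : ℝ) : ℂ) from Complex.conj_ofReal _]
            push_cast
            ring
        _ = _ := by
            rw [hchar, h2]
            push_cast
            ring
    simp only [h1]
    rw [integral_mul_const]
    congr 1
    rw [integral_complex_ofReal, integral_add_right_eq_self
      (fun s : E => Real.exp (-(4 * ε) * ‖s‖ ^ 2))]
  have h1 := inner_integral_smul_eq hu hinv hh
  have h2 : ⟪∫ s, h s • u s, ∫ s, h s • u s⟫_ℂ =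
      c * 𝓕 (fun t => ⟪u 0, u t⟫_ℂ * (Real.exp (-ε * ‖t‖ ^ 2) : ℂ)) k := by
    rw [h1, fourier_eq_integral_char, ← integral_const_mul]
    refine integral_congr_ae (Eventually.of_forall fun t => ?_)
    dsimp only
    rw [hconv]
    ring
  have h3 : 𝓕 (fun t => ⟪u 0, u t⟫_ℂ * (Real.exp (-ε * ‖t‖ ^ 2) : ℂ)) k =
      ((c⁻¹ * ‖∫ s, h s • u s‖ ^ 2 : ℝ) : ℂ) := by
    rw [inner_self_eq_norm_sq_to_K] at h2
    have hc0 : (c : ℂ) ≠ 0 := by exact_mod_cast hcpos.ne'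
    rw [Complex.ofReal_mul, Complex.ofReal_inv, eq_inv_mul_iff_mul_eq₀ hc0, Complex.ofReal_pow]
    exact h2.symm
  rw [h3]
  exact_mod_cast (by positivity)

theorem exists_measure_of_fourier_nonneg {f : E → ℂ} (hf : Integrable f) (hc : Continuous f)
    (hpos : ∀ k, 0 ≤ 𝓕 f k) : ∃ ν : Measure E, IsFiniteMeasure ν ∧
      ∀ t, ∫ k, char (-t) k ∂ν = f t := by
  have hF := integrable_fourier_of_nonneg hf hc hpos
  have hr : ∀ k, 𝓕 f k = ((𝓕 f k).re : ℂ) := fun k => by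
    have := (Complex.le_def.1 (hpos k)).2
    exact Complex.ext rfl (by simpa using this.symm)
  have hr0 : ∀ k, 0 ≤ (𝓕 f k).re := fun k => by simpa using (Complex.le_def.1 (hpos k)).1
  refine ⟨volume.withDensity fun k => ENNReal.ofReal (𝓕 f k).re, ?_, fun t => ?_⟩
  · exact isFiniteMeasure_withDensity_ofReal hF.re.2
  · rw [integral_withDensity_eq_integral_toReal_smul₀
      (f := fun k => ENNReal.ofReal (𝓕 f k).re)
      hF.re.aestronglyMeasurable.aemeasurable.ennreal_ofReal
      (Eventually.of_forall fun _ => ENNReal.ofReal_lt_top)]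
    rw [← congrFun (hc.fourierInv_fourier_eq hf hF) t, fourierInv_eq_integral_char]
    refine integral_congr_ae (Eventually.of_forall fun k => ?_)
    dsimp only
    rw [ENNReal.toReal_ofReal (hr0 k), Complex.real_smul, ← hr, mul_comm]

include hu hinv in
-- Normalize the correlation function to `A 0 = 1` and damp it by Gaussians; the damped functions
-- are Fourier transforms of probability measures. Their characteristic functions converge to a
-- continuous function, so they are tight, and a limit along a subsequence represents `A`.
theorem exists_measure_integral_char_neg_eq_inner : ∃ ν : Measure E, IsFiniteMeasure ν ∧
    ∀ t, ∫ k, char (-t) k ∂ν = ⟪u 0, u t⟫_ℂ := by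
  -- Excluded because of the division by `‖u 0‖²`; the zero measure serves here.
  by_cases h0 : u 0 = 0
  · exact ⟨0, inferInstance, fun t => by simp [h0]⟩
  set a : ℝ := ‖u 0‖ ^ 2 with ha
  have hapos : 0 < a := by positivity
  let A : E → ℂ := fun t => (a⁻¹ : ℝ) * ⟪u 0, u t⟫_ℂ
  have hAc : Continuous A := continuous_const.mul (continuous_const.inner hu)
  have hA0 : A 0 = 1 := by
    simp only [A]
    rw [inner_self_eq_norm_sq_to_K, Complex.ofReal_inv, ha]
    push_cast
    refine inv_mul_cancel₀ ?_
    exact_mod_cast hapos.ne'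
  have hAbd : ∀ t, ‖A t‖ ≤ 1 := fun t => by
    simp only [A, norm_mul, Complex.norm_real, norm_inv]
    rw [Real.norm_of_nonneg hapos.le, inv_mul_le_one₀ hapos]
    refine (norm_inner_le_norm _ _).trans ?_
    rw [norm_eq_of_translation_invariant hinv t, ha, sq]
  let ε : ℕ → ℝ := fun n => 1 / ((n : ℝ) + 1)
  have hε : ∀ n, 0 < ε n := fun n => by positivity
  let f : ℕ → E → ℂ := fun n t => A t * (Real.exp (-ε n * ‖t‖ ^ 2) : ℂ)
  have hfi : ∀ n, Integrable (f n) := fun n =>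
    ((integrable_rexp_neg_mul_sq (hε n)).ofReal).bdd_mul hAc.aestronglyMeasurable
      (Eventually.of_forall hAbd)
  have hfc : ∀ n, Continuous (f n) := fun n => hAc.mul (by fun_prop)
  have hfp : ∀ n k, 0 ≤ 𝓕 (f n) k := fun n k => by
    have h1 := fourier_inner_mul_gaussian_nonneg hu hinv (hε n) k
    have h2 : 𝓕 (f n) k = (a⁻¹ : ℝ) *
        𝓕 (fun t => ⟪u 0, u t⟫_ℂ * (Real.exp (-ε n * ‖t‖ ^ 2) : ℂ)) k := by
      rw [fourier_eq_integral_char, fourier_eq_integral_char, ← integral_const_mul]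
      refine integral_congr_ae (Eventually.of_forall fun t => ?_)
      simp only [f, A]
      ring
    rw [h2]
    exact mul_nonneg (by exact_mod_cast (inv_pos.2 hapos).le) h1
  choose ν hνfin hν using fun n => exists_measure_of_fourier_nonneg (hfi n) (hfc n) (hfp n)
  have hprob : ∀ n, IsProbabilityMeasure (ν n) := fun n => by
    have h1 := hν n 0
    simp only [neg_zero, char_zero, integral_const] at h1
    have h2 : (ν n).real Set.univ = 1 := by
      have h3 : f n 0 = 1 := by simp [f, hA0]
      rw [h3] at h1
      simpa using h1
    refine ⟨?_⟩
    rw [← ENNReal.toReal_eq_one_iff]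
    exact h2
  have hchar : ∀ (ν : Measure E) s, charFun ν s = ∫ k, char (-((2 * Real.pi)⁻¹ • s)) k ∂ν := by
    intro ν s
    rw [integral_char_eq_charFun, smul_neg, neg_smul, neg_neg, smul_smul,
      mul_inv_cancel₀ (by positivity), one_smul]
  have hlim : ∀ t, Tendsto (fun n => f n t) atTop (𝓝 (A t)) := by
    intro t
    have h2 : Tendsto (fun n : ℕ => -ε n * ‖t‖ ^ 2) atTop (𝓝 0) := by
      simpa [ε] using (tendsto_one_div_add_atTop_nhds_zero_nat (𝕜 := ℝ)).neg.mul_const (‖t‖ ^ 2)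
    have h3 := (Complex.continuous_ofReal.tendsto _).comp ((Real.continuous_exp.tendsto 0).comp h2)
    simpa [f] using h3.const_mul (A t)
  have hlim' : ∀ s, Tendsto (fun n => charFun (ν n) s) atTop (𝓝 (A ((2 * Real.pi)⁻¹ • s))) := by
    intro s
    simp only [hchar, hν]
    exact hlim _
  have htight := isTightMeasureSet_of_tendsto_charFun
    (f := fun s => A ((2 * Real.pi)⁻¹ • s)) (by fun_prop) hlim'
  let P : ℕ → ProbabilityMeasure E := fun n => ⟨ν n, hprob n⟩
  have hcomp : IsCompact (closure (Set.range P)) := by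
    refine isCompact_closure_of_isTightMeasureSet ?_
    convert htight using 1
    ext m
    constructor
    · rintro ⟨_, ⟨n, rfl⟩, rfl⟩
      exact ⟨n, rfl⟩
    · rintro ⟨n, rfl⟩
      exact ⟨P n, ⟨n, rfl⟩, rfl⟩
  obtain ⟨Q, -, φ, hφ, hQ⟩ := hcomp.tendsto_subseq fun n => subset_closure (Set.mem_range_self n)
  have hQA : ∀ t, ∫ k, char (-t) k ∂(Q : Measure E) = A t := by
    intro t
    rw [ProbabilityMeasure.tendsto_iff_forall_integral_rclike_tendsto ℂ] at hQ
    have h1 := hQ (BoundedContinuousFunction.ofNormedAddCommGroup (char (-t)) (continuous_char _) 1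
      fun k => (norm_char _ k).le)
    refine tendsto_nhds_unique h1 ?_
    refine ((hlim t).comp hφ.tendsto_atTop).congr fun n => ?_
    exact (hν (φ n) t).symm
  refine ⟨ENNReal.ofReal a • (Q : Measure E), Measure.smul_finite _ ENNReal.ofReal_ne_top,
    fun t => ?_⟩
  rw [integral_smul_measure, hQA, ENNReal.toReal_ofReal hapos.le, Complex.real_smul]
  simp only [A]
  rw [← mul_assoc, ← Complex.ofReal_mul, mul_inv_cancel₀ hapos.ne', Complex.ofReal_one, one_mul]

include hu hinv in
/-- **Bochner's theorem**, for the matrix coefficients of a translation invariant curve in a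
Hilbert space. -/
theorem exists_measure_integral_char_eq_inner : ∃ ν : Measure E, IsFiniteMeasure ν ∧
    ∀ t, ∫ k, char t k ∂ν = ⟪u 0, u t⟫_ℂ := by
  obtain ⟨ν, hfin, hν⟩ := exists_measure_integral_char_neg_eq_inner (u := fun t => u (-t))
    (hu.comp continuous_neg) (fun s r t => by
      simp only [neg_add]
      exact hinv _ _ _)
  exact ⟨ν, hfin, fun t => by simpa using hν (-t)⟩

variable {ν : Measure E} [IsFiniteMeasure ν] (hν : ∀ t, ∫ k, char t k ∂ν = ⟪u 0, u t⟫_ℂ)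

theorem integral_fourier_mul_eq {h : E → ℂ} (hh : Integrable h) {G : E → ℂ} {c : ℝ}
    (hG : Continuous G) (hGc : ∀ k, ‖G k‖ ≤ c) :
    ∫ k, 𝓕 h k * G k ∂ν = ∫ s, h s * ∫ k, char s k * G k ∂ν := by
  have hs : ∀ s k : E, char s k = char k s := fun s k => by
    rw [char, char, real_inner_comm]
  simp only [fourier_eq_integral_char, ← integral_const_mul, ← integral_mul_const]
  rw [integral_integral_swap]
  · refine integral_congr_ae (Eventually.of_forall fun s => ?_)
    dsimp only
    refine integral_congr_ae (Eventually.of_forall fun k => ?_)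
    dsimp only
    rw [hs k s]
    ring
  · have hGi : Integrable G ν := Integrable.of_bound hG.aestronglyMeasurable c
      (Eventually.of_forall hGc)
    have hchar : Continuous fun p : E × E => char p.1 p.2 := by
      unfold char
      fun_prop
    refine ((hGi.mul_prod hh).bdd_mul (c := 1) hchar.aestronglyMeasurable
      (Eventually.of_forall fun p => (norm_char _ _).le)).congr (Eventually.of_forall fun p => ?_)
    simp only [Function.uncurry]
    ring

include hu hinv hν in
-- Smoothing the curve `u` by `h` multiplies its spectral measure by `|h^|²`. The inner product is
-- sesquilinear, so Fubini is applied once for each factor.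
theorem integral_char_mul_norm_sq_fourier {h : E → ℂ} (hh : Integrable h) (t : E) :
    ∫ k, char t k * (‖𝓕 h k‖ ^ 2 : ℝ) ∂ν = ⟪∫ s, h s • u s, ∫ r, h r • u (r + t)⟫_ℂ := by
  have hF : Continuous (𝓕 h) :=
    VectorFourier.fourierIntegral_continuous Real.continuous_fourierChar continuous_inner hh
  have hFb : ∀ k, ‖𝓕 h k‖ ≤ ∫ v, ‖h v‖ := fun k =>
    VectorFourier.norm_fourierIntegral_le_integral_norm _ _ _ _ _
  set c := ∫ v, ‖h v‖
  have h1 : ∀ q, ∫ k, char q k * star (𝓕 h k) ∂ν = ⟪∫ s, h s • u s, u q⟫_ℂ := by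
    intro q
    have h2 := integral_fourier_mul_eq (ν := ν) hh (continuous_char (-q))
      (fun k => (norm_char (-q) k).le)
    simp only [← char_add, hν] at h2
    have h3 : ∀ s, ⟪u 0, u (s + -q)⟫_ℂ = ⟪u q, u s⟫_ℂ := fun s => by
      rw [← hinv 0 (s + -q) q, zero_add, neg_add_cancel_right]
    simp only [h3] at h2
    have h4 := inner_integral_smul_left hu hinv hh 0 (u q)
    simp only [add_zero] at h4
    rw [← h4] at h2
    rw [← inner_conj_symm, ← h2, ← integral_conj]
    refine integral_congr_ae (Eventually.of_forall fun k => ?_)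
    simp only [map_mul]
    rw [mul_comm]
    congr 1
    have := star_char (-q) k
    rw [neg_neg] at this
    exact this.symm
  have h2 := integral_fourier_mul_eq (ν := ν) hh (G := fun k => char t k * star (𝓕 h k)) (c := c)
    ((continuous_char t).mul (continuous_star.comp hF)) (fun k => by
      rw [norm_mul, norm_char, one_mul, norm_star]
      exact hFb k)
  simp only [← mul_assoc, ← char_add, h1] at h2
  rw [inner_integral_smul_left hu hinv hh t, ← h2]
  refine integral_congr_ae (Eventually.of_forall fun k => ?_)
  dsimp only
  have := Complex.mul_conj' (𝓕 h k)
  push_cast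
  rw [← this, mul_comm (𝓕 h k) (char t k), mul_assoc]
  rfl

end Bochner

end FlatBranched

end

noncomputable section

set_option linter.unusedSectionVars false

namespace FlatBranched

open scoped ENNReal
open Filter Topology

/-! ### The Bochner–Schwartz theorem -/

section BochnerSchwartz

variable {E : Type v} [NormedAddCommGroup E] [InnerProductSpace ℝ E] [FiniteDimensional ℝ E]
  [MeasurableSpace E] [BorelSpace E]

theorem weight_sub_le (y t : E) :
    weight (y - t) ≤ (1 + ‖t‖) ^ (Module.finrank ℝ E + 1) * weight y :=
  weight_le_mul (by rw [sub_sub_cancel])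

/-- Mean value inequality on the unit ball around `y - s`, where all weights are comparable to
`weight y`. -/
theorem exists_norm_translate_sub_le (φ : 𝓢(E, ℂ)) (s : E) : ∃ c, 0 ≤ c ∧ ∀ t, ‖t - s‖ ≤ 1 →
    ∀ y, ‖φ (y - t) - φ (y - s)‖ ≤ (c * ‖t - s‖) * weight y := by
  obtain ⟨M, hM0, hM⟩ := exists_le_mul_weight φ 1
  set N := Module.finrank ℝ E + 1
  refine ⟨M * (1 + 1) ^ N * (1 + ‖s‖) ^ N, by positivity, fun t ht y => ?_⟩
  have hder : ∀ z ∈ Metric.closedBall (y - s) 1,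
      ‖fderiv ℝ φ z‖ ≤ M * (1 + 1) ^ N * (1 + ‖s‖) ^ N * weight y := by
    intro z hz
    have h1 : ‖fderiv ℝ φ z‖ ≤ M * weight z := by
      rw [← norm_iteratedFDeriv_one]
      exact hM z
    have h2 : weight z ≤ (1 + 1) ^ N * weight (y - s) :=
      weight_le_mul (by rw [← dist_eq_norm, dist_comm]; exact hz)
    calc ‖fderiv ℝ φ z‖ ≤ M * ((1 + 1) ^ N * ((1 + ‖s‖) ^ N * weight y)) := by
          refine h1.trans ?_
          gcongr
          refine h2.trans ?_
          gcongr
          exact weight_sub_le y s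
      _ = _ := by ring
  have h := (convex_closedBall (y - s) 1).norm_image_sub_le_of_norm_fderiv_le (f := φ)
    (fun z _ => φ.differentiableAt) hder (x := y - s) (y := y - t)
    (Metric.mem_closedBall_self zero_le_one) (by
      rw [mem_closedBall_iff_norm]
      rwa [sub_sub_sub_cancel_left, norm_sub_rev])
  rw [sub_sub_sub_cancel_left, norm_sub_rev s t] at h
  calc _ ≤ _ := h
    _ = _ := by ring

/-- The linear embedding `φ ↦ φ / weight` of the Schwartz space in the bounded functions. -/
def divWeight : 𝓢(E, ℂ) →ₗ[ℂ] BoundedContinuousFunction E ℂ where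
  toFun φ := BoundedContinuousFunction.ofNormedAddCommGroup
    (fun y => ((1 + ‖y‖) ^ (Module.finrank ℝ E + 1) : ℝ) * φ y)
    (by have := φ.continuous; fun_prop)
    (exists_norm_le_mul_weight φ).choose (by
      intro y
      have h := (exists_norm_le_mul_weight φ).choose_spec.2 y
      have hw := weight_mul_pow y
      rw [norm_mul, Complex.norm_real, Real.norm_of_nonneg (by positivity)]
      calc (1 + ‖y‖) ^ (Module.finrank ℝ E + 1) * ‖φ y‖
          ≤ (1 + ‖y‖) ^ (Module.finrank ℝ E + 1) *
            ((exists_norm_le_mul_weight φ).choose * weight y) := by gcongr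
        _ = (exists_norm_le_mul_weight φ).choose *
            (weight y * (1 + ‖y‖) ^ (Module.finrank ℝ E + 1)) := by ring
        _ = _ := by rw [hw, mul_one])
  map_add' φ ψ := by
    ext y
    simp [mul_add]
  map_smul' c φ := by
    ext y
    simp [mul_left_comm]

theorem divWeight_apply (φ : 𝓢(E, ℂ)) (y : E) :
    divWeight φ y = ((1 + ‖y‖) ^ (Module.finrank ℝ E + 1) : ℝ) * φ y := rfl

theorem norm_le_norm_divWeight_mul (φ : 𝓢(E, ℂ)) (y : E) : ‖φ y‖ ≤ ‖divWeight φ‖ * weight y := by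
  have h := (divWeight φ).norm_coe_le_norm y
  have hw := weight_mul_pow y
  rw [divWeight_apply, norm_mul, Complex.norm_real, Real.norm_of_nonneg (by positivity)] at h
  calc ‖φ y‖ = (weight y * (1 + ‖y‖) ^ (Module.finrank ℝ E + 1)) * ‖φ y‖ := by rw [hw, one_mul]
    _ = ((1 + ‖y‖) ^ (Module.finrank ℝ E + 1) * ‖φ y‖) * weight y := by ring
    _ ≤ _ := mul_le_mul_of_nonneg_right h (weight_pos y).le

theorem norm_divWeight_le {φ : 𝓢(E, ℂ)} {M : ℝ} (hM : ∀ y, ‖φ y‖ ≤ M * weight y) :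
    ‖divWeight φ‖ ≤ M := by
  have hM0 : 0 ≤ M := nonneg_of_mul_nonneg_left ((norm_nonneg _).trans (hM 0)) (weight_pos 0)
  refine BoundedContinuousFunction.norm_le hM0 |>.2 fun y => ?_
  have hw := weight_mul_pow y
  rw [divWeight_apply, norm_mul, Complex.norm_real, Real.norm_of_nonneg (by positivity)]
  calc (1 + ‖y‖) ^ (Module.finrank ℝ E + 1) * ‖φ y‖
      ≤ (1 + ‖y‖) ^ (Module.finrank ℝ E + 1) * (M * weight y) := by gcongr; exact hM y
    _ = M * (weight y * (1 + ‖y‖) ^ (Module.finrank ℝ E + 1)) := by ring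
    _ = _ := by rw [hw, mul_one]

/-- Translation of Schwartz functions, `φ ↦ φ(· - t)`. -/
abbrev shift (t : E) (φ : 𝓢(E, ℂ)) : 𝓢(E, ℂ) := SchwartzMap.compSubConstCLM ℂ t φ

theorem norm_divWeight_shift_le (φ : 𝓢(E, ℂ)) (t : E) :
    ‖divWeight (shift t φ)‖ ≤ ‖divWeight φ‖ * (1 + ‖t‖) ^ (Module.finrank ℝ E + 1) := by
  refine norm_divWeight_le fun y => ?_
  rw [SchwartzMap.compSubConstCLM_apply]
  refine (norm_le_norm_divWeight_mul φ _).trans ?_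
  rw [mul_assoc]
  gcongr
  exact weight_sub_le y t

theorem continuous_divWeight_shift (φ : 𝓢(E, ℂ)) : Continuous fun t => divWeight (shift t φ) := by
  rw [continuous_iff_continuousAt]
  intro s
  obtain ⟨c, -, hc⟩ := exists_norm_translate_sub_le φ s
  rw [ContinuousAt, tendsto_iff_norm_sub_tendsto_zero]
  have hlim : Tendsto (fun t => c * ‖t - s‖) (𝓝 s) (𝓝 0) := by
    have : Continuous fun t : E => c * ‖t - s‖ := by fun_prop
    simpa using this.tendsto s
  refine squeeze_zero' (Eventually.of_forall fun _ => norm_nonneg _) ?_ hlim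
  filter_upwards [Metric.closedBall_mem_nhds s one_pos] with t ht
  rw [← map_sub]
  refine norm_divWeight_le fun y => ?_
  exact hc t (by rwa [← dist_eq_norm]) y

variable {H : Type*} [NormedAddCommGroup H] [InnerProductSpace ℂ H] [CompleteSpace H]
  (S : 𝓢(E, ℂ) →ₗ[ℂ] H)

/-- The values of `S` are bounded by weighted uniform norms, and `S` intertwines the translations
with isometries. -/
structure IsTranslationInvariant : Prop where
  bound : ∃ C, 0 ≤ C ∧ ∀ (φ : 𝓢(E, ℂ)) (M : ℝ), (∀ y, ‖φ y‖ ≤ M * weight y) → ‖S φ‖ ≤ C * M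
  inner_shift : ∀ φ₁ φ₂ t, ⟪S (shift t φ₁), S (shift t φ₂)⟫_ℂ = ⟪S φ₁, S φ₂⟫_ℂ

namespace IsTranslationInvariant

variable {S} (hS : IsTranslationInvariant S)

include hS

theorem exists_norm_le : ∃ C, 0 ≤ C ∧ ∀ φ, ‖S φ‖ ≤ C * ‖divWeight φ‖ := by
  obtain ⟨C, hC, h⟩ := hS.bound
  exact ⟨C, hC, fun φ => h φ _ (norm_le_norm_divWeight_mul φ)⟩

theorem continuous_shift (φ : 𝓢(E, ℂ)) : Continuous fun t => S (shift t φ) := by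
  obtain ⟨C, hC, h⟩ := hS.exists_norm_le
  rw [continuous_iff_continuousAt]
  intro s
  rw [ContinuousAt, tendsto_iff_norm_sub_tendsto_zero]
  have hlim := (tendsto_iff_norm_sub_tendsto_zero.1
    ((continuous_divWeight_shift φ).tendsto s)).const_mul C
  rw [mul_zero] at hlim
  refine squeeze_zero (fun _ => norm_nonneg _) (fun t => ?_) hlim
  rw [← map_sub, ← map_sub]
  exact h _

theorem inner_shift_add (φ : 𝓢(E, ℂ)) (s r t : E) :
    ⟪S (shift (s + t) φ), S (shift (r + t) φ)⟫_ℂ = ⟪S (shift s φ), S (shift r φ)⟫_ℂ := by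
  rw [← hS.inner_shift (shift s φ) (shift r φ) t]
  simp only [shift, SchwartzMap.compSubConstCLM_comp]

/-- The convolution has to be an integral of translates in a Banach space through which `S` factors.
The closure `W` of the range of `divWeight` is one: translates of `φ` depend continuously on `t`
there, their norms grow polynomially, and the bound on `S` extends it to a continuous map `T` on
`W`, which commutes with the integral. -/
theorem map_convolution (h φ : 𝓢(E, ℂ)) :
    S (SchwartzMap.convolution (ContinuousLinearMap.mul ℂ ℂ) h φ) = ∫ t, h t • S (shift t φ) := by
  obtain ⟨C, hC, hbd⟩ := hS.exists_norm_le
  let W := (LinearMap.range (divWeight (E := E))).topologicalClosure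
  have hWc : CompleteSpace W := (Submodule.isClosed_topologicalClosure _).completeSpace_coe
  let J : 𝓢(E, ℂ) →ₗ[ℂ] W := divWeight.codRestrict W fun φ =>
    Submodule.le_topologicalClosure _ (LinearMap.mem_range_self _ φ)
  have hJ : DenseRange J := by
    intro w
    rw [closure_subtype]
    have h1 : (w : BoundedContinuousFunction E ℂ) ∈
        closure (LinearMap.range (divWeight (E := E)) : Set (BoundedContinuousFunction E ℂ)) := w.2
    refine closure_mono ?_ h1
    rintro _ ⟨φ, rfl⟩
    exact ⟨J φ, ⟨φ, rfl⟩, rfl⟩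
  have hnorm : ∀ φ, ‖S φ‖ ≤ C * ‖J φ‖ := hbd
  let T := S.extendOfNorm J
  have hT : ∀ φ, T (J φ) = S φ := LinearMap.extendOfNorm_eq hJ ⟨C, hnorm⟩
  have hcont : Continuous fun t => h t • J (shift t φ) :=
    h.continuous.smul (Continuous.subtype_mk (continuous_divWeight_shift φ) _)
  have hint : Integrable fun t => h t • J (shift t φ) := by
    have hpow : Integrable fun t => ‖divWeight φ‖ *
        ((1 + ‖t‖) ^ (Module.finrank ℝ E + 1) * ‖h t‖) := by
      refine Integrable.const_mul ?_ _
      have h1 : Integrable fun t => (2 : ℝ) ^ (Module.finrank ℝ E) *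
          (‖h t‖ + ‖t‖ ^ (Module.finrank ℝ E + 1) * ‖h t‖) :=
        (h.integrable.norm.add (h.integrable_pow_mul volume (Module.finrank ℝ E + 1))).const_mul _
      refine h1.mono' (by have := h.continuous; fun_prop) (Eventually.of_forall fun t => ?_)
      rw [Real.norm_of_nonneg (by positivity), ← one_add_mul, ← mul_assoc]
      gcongr
      have := add_pow_le zero_le_one (norm_nonneg t) (Module.finrank ℝ E + 1)
      simpa using this
    refine hpow.mono' hcont.aestronglyMeasurable (Eventually.of_forall fun t => ?_)
    rw [norm_smul]
    calc ‖h t‖ * ‖J (shift t φ)‖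
        ≤ ‖h t‖ * (‖divWeight φ‖ * (1 + ‖t‖) ^ (Module.finrank ℝ E + 1)) := by
          gcongr
          exact norm_divWeight_shift_le φ t
      _ = _ := by ring
  have key : ∫ t, h t • J (shift t φ) =
      J (SchwartzMap.convolution (ContinuousLinearMap.mul ℂ ℂ) h φ) := by
    apply Subtype.ext
    have h1 := (W.subtypeL.integral_comp_comm hint).symm
    refine Eq.trans h1 ?_
    -- Evaluation at `y` is continuous on bounded functions, so the vector-valued integral is
    -- identified pointwise with the convolution.
    ext y
    have h2 := ((BoundedContinuousFunction.evalCLM ℂ y).integral_comp_comm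
      (W.subtypeL.integrable_comp hint)).symm
    refine Eq.trans h2 ?_
    change ∫ t, h t * divWeight (shift t φ) y = divWeight _ y
    rw [divWeight_apply, SchwartzMap.convolution_apply, convolution_def, ← integral_const_mul]
    refine integral_congr_ae (Eventually.of_forall fun t => ?_)
    simp only [divWeight_apply, SchwartzMap.compSubConstCLM_apply, ContinuousLinearMap.mul_apply']
    ring
  rw [← hT, ← key, ← T.integral_comp_comm hint]
  simp only [map_smul, hT]

theorem exists_spectral_measure (φ : 𝓢(E, ℂ)) : ∃ ν : Measure E, IsFiniteMeasure ν ∧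
    ∀ t, ∫ k, char t k ∂ν = ⟪S φ, S (shift t φ)⟫_ℂ := by
  obtain ⟨ν, h1, h2⟩ := exists_measure_integral_char_eq_inner (hS.continuous_shift φ)
    (hS.inner_shift_add φ)
  refine ⟨ν, h1, fun t => ?_⟩
  rw [h2]
  simp [shift]

/-- The spectral measure of `S φ`. -/
def spectralMeasure (φ : 𝓢(E, ℂ)) : Measure E := (hS.exists_spectral_measure φ).choose

instance (φ : 𝓢(E, ℂ)) : IsFiniteMeasure (hS.spectralMeasure φ) :=
  (hS.exists_spectral_measure φ).choose_spec.1

theorem integral_char_spectralMeasure (φ : 𝓢(E, ℂ)) (t : E) :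
    ∫ k, char t k ∂(hS.spectralMeasure φ) = ⟪S φ, S (shift t φ)⟫_ℂ :=
  (hS.exists_spectral_measure φ).choose_spec.2 t

theorem shift_convolution (h φ : 𝓢(E, ℂ)) (t : E) :
    shift t (SchwartzMap.convolution (ContinuousLinearMap.mul ℂ ℂ) h φ) =
      SchwartzMap.convolution (ContinuousLinearMap.mul ℂ ℂ) h (shift t φ) := by
  ext y
  rw [SchwartzMap.compSubConstCLM_apply, SchwartzMap.convolution_apply,
    SchwartzMap.convolution_apply, convolution_def, convolution_def]
  refine integral_congr_ae (Eventually.of_forall fun r => ?_)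
  simp only [SchwartzMap.compSubConstCLM_apply]
  rw [sub_right_comm]

theorem integral_char_mul_norm_sq_spectralMeasure (h φ : 𝓢(E, ℂ)) (t : E) :
    ∫ k, char t k * (‖𝓕 h k‖ ^ 2 : ℝ) ∂(hS.spectralMeasure φ) =
      ⟪S (SchwartzMap.convolution (ContinuousLinearMap.mul ℂ ℂ) h φ),
        S (shift t (SchwartzMap.convolution (ContinuousLinearMap.mul ℂ ℂ) h φ))⟫_ℂ := by
  have h1 := integral_char_mul_norm_sq_fourier (ν := hS.spectralMeasure φ) (hS.continuous_shift φ)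
    (hS.inner_shift_add φ) (fun t => by
      rw [hS.integral_char_spectralMeasure]; simp [shift]) h.integrable t
  rw [hS.shift_convolution, hS.map_convolution, hS.map_convolution]
  refine h1.trans ?_
  congr 1
  refine integral_congr_ae (Eventually.of_forall fun r => ?_)
  simp only [shift, SchwartzMap.compSubConstCLM_comp]
  rw [add_comm]

/-- Both sides are the spectral measure of `S (ψ * φ) = S (φ * ψ)`. This is the compatibility that
allows the spectral measures to be glued to one measure, formally `ν_φ / |φ^|²`. -/
theorem spectralMeasure_withDensity (φ ψ : 𝓢(E, ℂ)) :
    (hS.spectralMeasure φ).withDensity (fun k => ENNReal.ofReal (‖𝓕 ψ k‖ ^ 2)) =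
      (hS.spectralMeasure ψ).withDensity (fun k => ENNReal.ofReal (‖𝓕 φ k‖ ^ 2)) := by
  have hint : ∀ φ ψ : 𝓢(E, ℂ), Integrable (fun k => ‖𝓕 ψ k‖ ^ 2) (hS.spectralMeasure φ) := by
    intro φ ψ
    refine Integrable.of_bound (by have := (𝓕 ψ).continuous; fun_prop)
      ((SchwartzMap.seminorm ℝ 0 0 (𝓕 ψ)) ^ 2) (Eventually.of_forall fun k => ?_)
    rw [Real.norm_of_nonneg (by positivity)]
    gcongr
    exact SchwartzMap.norm_le_seminorm ℝ _ k
  have hfin : ∀ φ ψ : 𝓢(E, ℂ), IsFiniteMeasure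
      ((hS.spectralMeasure φ).withDensity (fun k => ENNReal.ofReal (‖𝓕 ψ k‖ ^ 2))) :=
    fun φ ψ => isFiniteMeasure_withDensity_ofReal (hint φ ψ).2
  have := hfin φ ψ
  have := hfin ψ φ
  have hconv : ∀ (φ ψ : 𝓢(E, ℂ)) t, ∫ k, char t k ∂((hS.spectralMeasure φ).withDensity
      (fun k => ENNReal.ofReal (‖𝓕 ψ k‖ ^ 2))) =
      ∫ k, char t k * (‖𝓕 ψ k‖ ^ 2 : ℝ) ∂(hS.spectralMeasure φ) := by
    intro φ ψ t
    rw [integral_withDensity_eq_integral_toReal_smul₀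
      (f := fun k => ENNReal.ofReal (‖𝓕 ψ k‖ ^ 2))
      (hint φ ψ).aestronglyMeasurable.aemeasurable.ennreal_ofReal
      (Eventually.of_forall fun _ => ENNReal.ofReal_lt_top)]
    refine integral_congr_ae (Eventually.of_forall fun k => ?_)
    dsimp only
    rw [ENNReal.toReal_ofReal (by positivity), Complex.real_smul, mul_comm]
  refine ext_of_integral_char fun t => ?_
  rw [hconv, hconv, hS.integral_char_mul_norm_sq_spectralMeasure,
    hS.integral_char_mul_norm_sq_spectralMeasure]
  have hcomm : SchwartzMap.convolution (ContinuousLinearMap.mul ℂ ℂ) ψ φ =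
      SchwartzMap.convolution (ContinuousLinearMap.mul ℂ ℂ) φ ψ := by
    rw [← SchwartzMap.convolution_flip]
    congr 2
    ext
    simp
  rw [hcomm]

theorem spectralMeasure_univ (φ : 𝓢(E, ℂ)) :
    hS.spectralMeasure φ Set.univ = ENNReal.ofReal (‖S φ‖ ^ 2) := by
  have h1 := hS.integral_char_spectralMeasure φ 0
  simp only [char_zero, integral_const, shift, SchwartzMap.compSubConstCLM_zero,
    ContinuousLinearMap.id_apply, inner_self_eq_norm_sq_to_K] at h1
  have h2 : (hS.spectralMeasure φ).real Set.univ = ‖S φ‖ ^ 2 := by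
    have h3 := congrArg Complex.re h1
    rw [Complex.real_smul, mul_one, Complex.ofReal_re] at h3
    rw [h3]
    norm_cast
  rw [← h2, ofReal_measureReal]

end IsTranslationInvariant

end BochnerSchwartz

end FlatBranched

end

noncomputable section

set_option linter.unusedSectionVars false

namespace FlatBranched

open scoped ENNReal
open Filter Topology

/-! ### Gluing the spectral measures to one tempered measure. -/

section BochnerSchwartz

variable {E : Type v} [NormedAddCommGroup E] [InnerProductSpace ℝ E] [FiniteDimensional ℝ E]
  [MeasurableSpace E] [BorelSpace E]

/-- A Schwartz function that takes values in `[0, 1]`, is equal to `1` in a ball and is supported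
in a larger ball. -/
theorem exists_schwartz_bump (c : E) {r R : ℝ} (hr : 0 < r) (hR : r < R) :
    ∃ χ : 𝓢(E, ℂ), (∀ k ∈ Metric.closedBall c r, χ k = 1) ∧ (∀ k, R ≤ dist k c → χ k = 0) ∧
      ∀ k, ‖χ k‖ ≤ 1 := by
  let f : ContDiffBump c := ⟨r, R, hr, hR⟩
  have h1 : HasCompactSupport (fun k => ((f k : ℝ) : ℂ)) :=
    f.hasCompactSupport.comp_left (g := fun a : ℝ => (a : ℂ)) Complex.ofReal_zero
  have h2 : ContDiff ℝ (⊤ : ℕ∞) (fun k => ((f k : ℝ) : ℂ)) :=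
    Complex.ofRealCLM.contDiff.comp f.contDiff
  refine ⟨h1.toSchwartzMap h2, fun k hk => ?_, fun k hk => ?_, fun k => ?_⟩
  · change ((f k : ℝ) : ℂ) = 1
    rw [f.one_of_mem_closedBall hk, Complex.ofReal_one]
  · change ((f k : ℝ) : ℂ) = 0
    rw [f.zero_of_le_dist hk, Complex.ofReal_zero]
  · change ‖((f k : ℝ) : ℂ)‖ ≤ 1
    rw [Complex.norm_real, Real.norm_of_nonneg f.nonneg]
    exact f.le_one

theorem fourierInv_comp_inv_smul (χ : E → ℂ) {R : ℝ} (hR : 0 < R) (y : E) :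
    𝓕⁻ (fun k => χ (R⁻¹ • k)) y = (R ^ Module.finrank ℝ E : ℝ) • 𝓕⁻ χ (R • y) := by
  rw [fourierInv_eq_integral_char, fourierInv_eq_integral_char]
  have h := Measure.integral_comp_inv_smul volume (fun k => char (-(R • y)) k * χ k) R
  rw [abs_of_nonneg (by positivity)] at h
  rw [← h]
  refine integral_congr_ae (Eventually.of_forall fun k => ?_)
  simp only [char, inner_smul_left, inner_neg_right, inner_smul_right, RCLike.conj_to_real]
  rw [mul_inv_cancel_left₀ hR.ne']

/-- Schwartz functions whose Fourier transforms are `1` on larger and larger balls can be chosen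
of polynomial growth with respect to a weighted uniform norm. -/
theorem exists_fourier_eq_one : ∃ C, 0 ≤ C ∧ ∀ n : ℕ, ∃ φ : 𝓢(E, ℂ),
    (∀ k, ‖k‖ ≤ n + 1 → 𝓕 φ k = 1) ∧
      ∀ y, ‖φ y‖ ≤ C * ((n : ℝ) + 1) ^ Module.finrank ℝ E * weight y := by
  obtain ⟨χ, hχ, -, -⟩ := exists_schwartz_bump (0 : E) one_pos one_lt_two
  obtain ⟨M, hM0, hM⟩ := exists_norm_le_mul_weight (𝓕⁻ χ)
  refine ⟨M, hM0, fun n => ?_⟩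
  have hR : (0 : ℝ) < n + 1 := by positivity
  let e : E ≃L[ℝ] E := ContinuousLinearEquiv.smulLeft (Units.mk0 ((n : ℝ) + 1)⁻¹ (by positivity))
  let χ' : 𝓢(E, ℂ) := SchwartzMap.compCLMOfContinuousLinearEquiv ℂ e χ
  have hχ' : ∀ k, χ' k = χ (((n : ℝ) + 1)⁻¹ • k) := fun k => rfl
  refine ⟨𝓕⁻ χ', fun k hk => ?_, fun y => ?_⟩
  · rw [FourierTransform.fourier_fourierInv_eq, hχ']
    refine hχ _ ?_
    rw [mem_closedBall_zero_iff, norm_smul, norm_inv, Real.norm_of_nonneg hR.le,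
      inv_mul_le_one₀ hR]
    exact hk
  · have h1 : (𝓕⁻ χ') y = 𝓕⁻ (fun k => χ (((n : ℝ) + 1)⁻¹ • k)) y := by
      rw [SchwartzMap.fourierInv_coe]
      rfl
    rw [h1, fourierInv_comp_inv_smul _ hR, norm_smul, Real.norm_of_nonneg (by positivity),
      ← SchwartzMap.fourierInv_coe, mul_comm M, mul_assoc]
    gcongr
    refine (hM _).trans ?_
    gcongr
    -- The dilation factor `n + 1` is at least `1`, so the weight at the dilated point is no larger
    -- than at `y`; only the Jacobian `(n + 1)^d` remains.
    refine Real.rpow_le_rpow_of_nonpos (by positivity) ?_ (neg_nonpos.2 (Nat.cast_nonneg _))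
    rw [norm_smul, Real.norm_of_nonneg hR.le]
    nlinarith [norm_nonneg y, (Nat.cast_nonneg n : (0 : ℝ) ≤ n)]

variable {H : Type*} [NormedAddCommGroup H] [InnerProductSpace ℂ H] [CompleteSpace H]
  {S : 𝓢(E, ℂ) →ₗ[ℂ] H}

/-- Linear maps with the same norms have the same inner products. -/
theorem inner_eq_inner_of_norm_eq {V H' : Type*} [AddCommGroup V] [Module ℂ V]
    [NormedAddCommGroup H'] [InnerProductSpace ℂ H'] (S : V →ₗ[ℂ] H) (T : V →ₗ[ℂ] H')
    (h : ∀ v, ‖S v‖ = ‖T v‖) (v w : V) : ⟪S v, S w⟫_ℂ = ⟪T v, T w⟫_ℂ := by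
  rw [inner_eq_sum_norm_sq_div_four, inner_eq_sum_norm_sq_div_four]
  simp only [← map_smul, ← map_add, ← map_sub, h]

namespace IsTranslationInvariant

variable (hS : IsTranslationInvariant S)

include hS

/-- On the shell `A n = {n ≤ ‖k‖ < n + 1}` the transform of `g n` is `1`, so there the measure
sought must be the spectral measure of `g n`. Compatibility of the spectral measures then gives the
formula for every `φ`, shell by shell. -/
theorem exists_measure_withDensity : ∃ η : Measure E, η.HasTemperateGrowth ∧ ∀ φ : 𝓢(E, ℂ),
    η.withDensity (fun k => ENNReal.ofReal (‖𝓕 φ k‖ ^ 2)) = hS.spectralMeasure φ := by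
  obtain ⟨C, hC0, hC⟩ := exists_fourier_eq_one (E := E)
  choose g hg1 hgC using hC
  obtain ⟨C', hC'0, hC'⟩ := hS.bound
  let A : ℕ → Set E := fun n => {k | ⌊‖k‖⌋₊ = n}
  have hA : ∀ n, MeasurableSet (A n) := fun n =>
    (Nat.measurable_floor.comp measurable_norm) (measurableSet_singleton n)
  have hA1 : ∀ n, ∀ k ∈ A n, 𝓕 (g n) k = 1 := by
    intro n k hk
    refine hg1 n k ?_
    have := Nat.lt_floor_add_one ‖k‖
    rw [hk] at this
    exact this.le
  refine ⟨Measure.sum fun n => (hS.spectralMeasure (g n)).restrict (A n), ⟨?_⟩, fun φ => ?_⟩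
  · set d := Module.finrank ℝ E
    -- The mass of the `n`-th piece is at most `‖S (g n)‖² = O((n + 1)^{2d})`; two further powers
    -- make the sum over the shells converge.
    refine ⟨2 * d + 2, ⟨Continuous.aestronglyMeasurable (Continuous.rpow_const
      (by fun_prop) fun k => Or.inl (by positivity)), ?_⟩⟩
    rw [hasFiniteIntegral_iff_ofReal (Eventually.of_forall fun k => by positivity),
      lintegral_sum_measure]
    have hsum : Summable fun n : ℕ => (C' * C) ^ 2 * (((n : ℝ) + 1) ^ 2)⁻¹ := by
      refine Summable.mul_left _ ?_
      have := (summable_nat_add_iff 1).2 (Real.summable_nat_pow_inv.2 one_lt_two)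
      simpa using this
    refine lt_of_le_of_lt (ENNReal.tsum_le_tsum fun n => ?_) hsum.tsum_ofReal_lt_top
    have hn : (0 : ℝ) < n + 1 := by positivity
    have hSg : ‖S (g n)‖ ^ 2 ≤ (C' * (C * ((n : ℝ) + 1) ^ d)) ^ 2 := by
      gcongr
      exact hC' _ _ (hgC n)
    calc ∫⁻ k in A n, ENNReal.ofReal ((1 + ‖k‖) ^ (-((2 * d + 2 : ℕ) : ℝ)))
          ∂(hS.spectralMeasure (g n))
        ≤ ∫⁻ k in A n, ENNReal.ofReal ((((n : ℝ) + 1) ^ (2 * d + 2))⁻¹)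
          ∂(hS.spectralMeasure (g n)) := by
          refine setLIntegral_mono measurable_const fun k hk => ENNReal.ofReal_le_ofReal ?_
          rw [Real.rpow_neg (by positivity), Real.rpow_natCast]
          have := Nat.floor_le (norm_nonneg k)
          rw [hk] at this
          exact inv_anti₀ (by positivity) (pow_le_pow_left₀ hn.le (by linarith) _)
      _ ≤ ENNReal.ofReal ((((n : ℝ) + 1) ^ (2 * d + 2))⁻¹) *
          ENNReal.ofReal (‖S (g n)‖ ^ 2) := by
          rw [setLIntegral_const, ← hS.spectralMeasure_univ]
          gcongr
          exact Set.subset_univ _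
      _ ≤ _ := by
          rw [← ENNReal.ofReal_mul (by positivity)]
          refine ENNReal.ofReal_le_ofReal ((mul_le_mul_of_nonneg_left hSg (by positivity)).trans ?_)
          refine le_of_eq ?_
          field_simp
          ring
  · rw [withDensity_sum]
    have h1 : ∀ n, ((hS.spectralMeasure (g n)).restrict (A n)).withDensity
        (fun k => ENNReal.ofReal (‖𝓕 φ k‖ ^ 2)) = (hS.spectralMeasure φ).restrict (A n) := by
      intro n
      rw [← restrict_withDensity (hA n), hS.spectralMeasure_withDensity, restrict_withDensity (hA n)]
      conv_rhs => rw [← withDensity_one (μ := (hS.spectralMeasure φ).restrict (A n))]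
      refine withDensity_congr_ae ?_
      filter_upwards [ae_restrict_mem (hA n)] with k hk
      simp [hA1 n k hk]
    simp only [h1]
    rw [← Measure.restrict_iUnion _ hA]
    · have : ⋃ n, A n = Set.univ := Set.eq_univ_of_forall fun k => Set.mem_iUnion.2 ⟨_, rfl⟩
      rw [this, Measure.restrict_univ]
    · intro i j hij
      refine Set.disjoint_left.2 fun k hi hj => hij ?_
      exact hi.symm.trans hj

/-- The **Bochner–Schwartz theorem**: a translation invariant positive definite form on the Schwartz
space, of finite order, is the Fourier transform of a tempered measure. -/
theorem exists_measure_inner_eq : ∃ η : Measure E, η.HasTemperateGrowth ∧ ∀ φ₁ φ₂ : 𝓢(E, ℂ),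
    ⟪S φ₁, S φ₂⟫_ℂ = ∫ k, star (𝓕 φ₁ k) * 𝓕 φ₂ k ∂η := by
  obtain ⟨η, hη, h⟩ := hS.exists_measure_withDensity
  refine ⟨η, hη, fun φ₁ φ₂ => ?_⟩
  let T : 𝓢(E, ℂ) →ₗ[ℂ] Lp ℂ 2 η :=
    (SchwartzMap.toLpCLM ℂ ℂ 2 η).toLinearMap ∘ₗ (FourierTransform.fourierCLM ℂ 𝓢(E, ℂ)).toLinearMap
  have hT : ∀ φ, T φ = (𝓕 φ).toLp 2 η := fun φ => rfl
  -- Taking total masses of the spectral measures gives equality of norms; polarization does the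
  -- rest.
  have hn : ∀ φ, ‖S φ‖ = ‖T φ‖ := by
    intro φ
    rw [hT, ← sq_eq_sq₀ (norm_nonneg _) (norm_nonneg _)]
    have h1 : ENNReal.ofReal (‖S φ‖ ^ 2) = ∫⁻ k, ENNReal.ofReal (‖𝓕 φ k‖ ^ 2) ∂η := by
      rw [← hS.spectralMeasure_univ, ← h φ, withDensity_apply _ MeasurableSet.univ,
        Measure.restrict_univ]
    have h2 := ((𝓕 φ).memLp 2 η).integrable_norm_pow (by norm_num)
    have h3 : ‖(𝓕 φ).toLp 2 η‖ ^ 2 = ∫ k, ‖𝓕 φ k‖ ^ 2 ∂η := by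
      rw [SchwartzMap.norm_toLp' (by norm_num) (by norm_num), ← Real.rpow_natCast,
        ← Real.rpow_mul (integral_nonneg fun k => by positivity)]
      norm_num
    rw [h3, integral_eq_lintegral_of_nonneg_ae (Eventually.of_forall fun k => by positivity)
      h2.aestronglyMeasurable]
    rw [← h1, ENNReal.toReal_ofReal (by positivity)]
  rw [inner_eq_inner_of_norm_eq S T hn, hT, hT, SchwartzMap.inner_toL2_toL2_eq _ _ η]
  refine integral_congr_ae (Eventually.of_forall fun k => ?_)
  simp [mul_comm]

end IsTranslationInvariant

end BochnerSchwartz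

end FlatBranched

end

noncomputable section

set_option linter.unusedSectionVars false

namespace FlatBranched

open scoped ENNReal ContDiff
open Filter Topology

/-! ### Tempered measures -/

section Tempered

variable {E : Type v} [NormedAddCommGroup E] [InnerProductSpace ℝ E] [FiniteDimensional ℝ E]
  [MeasurableSpace E] [BorelSpace E]

theorem isLocallyFiniteMeasure_of_hasTemperateGrowth (η : Measure E) [h : η.HasTemperateGrowth] :
    IsLocallyFiniteMeasure η := by
  obtain ⟨n, hn⟩ := h.exists_integrable
  refine ⟨fun x => ⟨Metric.ball x 1, Metric.ball_mem_nhds x one_pos, ?_⟩⟩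
  have hpos : (0 : ℝ) < (1 + (‖x‖ + 1)) ^ (-(n : ℝ)) := Real.rpow_pos_of_pos (by positivity) _
  refine (measure_mono fun y hy => ?_).trans_lt (hn.measure_norm_ge_lt_top hpos)
  have hy' : ‖y‖ ≤ ‖x‖ + 1 := by
    have h1 := norm_le_norm_add_norm_sub' y x
    rw [mem_ball_iff_norm] at hy
    linarith
  refine le_trans ?_ (Real.le_norm_self _)
  exact Real.rpow_le_rpow_of_nonpos (by positivity) (by linarith)
    (neg_nonpos.2 (Nat.cast_nonneg _))

theorem hasTemperateGrowth_sum {ι : Type*} [Fintype ι] (η : ι → Measure E)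
    (h : ∀ i, (η i).HasTemperateGrowth) : (∑ i, η i).HasTemperateGrowth := by
  choose n hn using fun i => (h i).exists_integrable
  refine ⟨∑ i, n i, integrable_finsetSum_measure.2 fun i _ => ?_⟩
  refine (hn i).mono' (Continuous.aestronglyMeasurable (Continuous.rpow_const
      (by fun_prop) fun k => Or.inl (by positivity))) (Eventually.of_forall fun k => ?_)
  rw [Real.norm_of_nonneg (by positivity)]
  refine Real.rpow_le_rpow_of_exponent_le (by linarith [norm_nonneg k]) ?_
  rw [neg_le_neg_iff, Nat.cast_le]
  exact Finset.single_le_sum (fun j _ => Nat.zero_le _) (Finset.mem_univ i)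

/-- Every smooth compactly supported function is of the form `conj φ₁^ * φ₂^`. -/
theorem exists_star_fourier_mul_fourier_eq {g : E → ℝ} (hg : ContDiff ℝ ∞ g)
    (hc : HasCompactSupport g) : ∃ φ₁ φ₂ : 𝓢(E, ℂ), ∀ k, star (𝓕 φ₁ k) * 𝓕 φ₂ k = (g k : ℂ) := by
  have h1 : HasCompactSupport (fun k => ((g k : ℝ) : ℂ)) :=
    hc.comp_left (g := fun a : ℝ => (a : ℂ)) Complex.ofReal_zero
  have h2 : ContDiff ℝ ∞ (fun k => ((g k : ℝ) : ℂ)) := Complex.ofRealCLM.contDiff.comp hg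
  obtain ⟨R, hR⟩ := hc.isCompact.isBounded.subset_closedBall 0
  obtain ⟨χ, hχ, -, -⟩ := exists_schwartz_bump (0 : E) (r := max R 1) (R := max R 1 + 1)
    (lt_max_of_lt_right one_pos) (lt_add_one _)
  refine ⟨𝓕⁻ χ, 𝓕⁻ (h1.toSchwartzMap h2), fun k => ?_⟩
  rw [FourierTransform.fourier_fourierInv_eq, FourierTransform.fourier_fourierInv_eq]
  change star (χ k) * (g k : ℂ) = g k
  by_cases hk : g k = 0
  · simp [hk]
  · rw [hχ k, star_one, one_mul]
    exact Metric.closedBall_subset_closedBall (le_max_left _ _) (hR (subset_tsupport _ hk))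

theorem integrable_star_fourier_mul_fourier (η : Measure E) [η.HasTemperateGrowth]
    (φ₁ φ₂ : 𝓢(E, ℂ)) : Integrable (fun k => star (𝓕 φ₁ k) * 𝓕 φ₂ k) η := by
  have h1 : MemLp (fun k => star (𝓕 φ₁ k)) 2 η := ((𝓕 φ₁).memLp 2 η).star
  exact h1.integrable_mul ((𝓕 φ₂).memLp 2 η)

theorem integrable_star_fourier_mul_fourier_mul (η : Measure E) [η.HasTemperateGrowth]
    (φ₁ φ₂ : 𝓢(E, ℂ)) {G : E → ℂ} (hG : AEStronglyMeasurable G η) {C : ℝ}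
    (hC : ∀ᵐ k ∂η, ‖G k‖ ≤ C) : Integrable (fun k => star (𝓕 φ₁ k) * 𝓕 φ₂ k * G k) η :=
  (integrable_star_fourier_mul_fourier η φ₁ φ₂).mul_bdd hG hC

theorem integral_eq_integral_mul_rnDeriv {η τ : Measure E} [SigmaFinite τ] [SigmaFinite η]
    (h : η ≤ τ) (g : E → ℂ) : ∫ k, g k ∂η = ∫ k, g k * ((η.rnDeriv τ k).toReal : ℂ) ∂τ := by
  rw [← integral_rnDeriv_smul (Measure.absolutelyContinuous_of_le h)]
  refine integral_congr_ae (Eventually.of_forall fun k => ?_)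
  simp [mul_comm]

theorem norm_rnDeriv_le_one {η τ : Measure E} [SigmaFinite τ] (h : η ≤ τ) :
    ∀ᵐ k ∂τ, ‖((η.rnDeriv τ k).toReal : ℂ)‖ ≤ 1 := by
  filter_upwards [Measure.rnDeriv_le_one_of_le h] with k hk
  rw [Complex.norm_real, Real.norm_of_nonneg ENNReal.toReal_nonneg]
  exact ENNReal.toReal_le_of_le_ofReal zero_le_one (by simpa using hk)

theorem measurable_rnDeriv_ofReal (η τ : Measure E) :
    Measurable fun k => ((η.rnDeriv τ k).toReal : ℂ) :=
  Complex.measurable_ofReal.comp (Measure.measurable_rnDeriv η τ).ennreal_toReal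

/-- If the measure with density `G` with respect to `τ` agrees with a positive measure, then
`G ≥ 0`. -/
theorem ae_nonneg_of_integral_mul_eq {τ η : Measure E} [τ.HasTemperateGrowth]
    [η.HasTemperateGrowth] {G : E → ℂ} (hGm : Measurable G) {C : ℝ} (hC : ∀ᵐ k ∂τ, ‖G k‖ ≤ C)
    (h : ∀ φ₁ φ₂ : 𝓢(E, ℂ), ∫ k, star (𝓕 φ₁ k) * 𝓕 φ₂ k * G k ∂τ =
      ∫ k, star (𝓕 φ₁ k) * 𝓕 φ₂ k ∂η) : ∀ᵐ k ∂τ, 0 ≤ G k := by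
  have := isLocallyFiniteMeasure_of_hasTemperateGrowth τ
  have := isLocallyFiniteMeasure_of_hasTemperateGrowth η
  -- Relative to `ρ` the measures `τ` and `η` have bounded densities `a` and `b`. Testing against
  -- bump functions gives `G a = b` almost everywhere, and `a > 0` holds `τ`-almost everywhere.
  let ρ := τ + η
  have hρ : ρ.HasTemperateGrowth := by
    have := hasTemperateGrowth_sum ![τ, η] (by intro i; fin_cases i <;> assumption)
    simpa [Fin.sum_univ_two] using this
  have := isLocallyFiniteMeasure_of_hasTemperateGrowth ρ
  have hτρ : τ ≤ ρ := Measure.le_add_right le_rfl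
  have hηρ : η ≤ ρ := Measure.le_add_left le_rfl
  let a : E → ℂ := fun k => ((τ.rnDeriv ρ k).toReal : ℂ)
  let b : E → ℂ := fun k => ((η.rnDeriv ρ k).toReal : ℂ)
  have ham : Measurable a := measurable_rnDeriv_ofReal _ _
  have hbm : Measurable b := measurable_rnDeriv_ofReal _ _
  have hb1 : ∀ᵐ k ∂ρ, ‖b k‖ ≤ 1 := norm_rnDeriv_le_one hηρ
  -- The bound on `G` is known only `τ`-almost everywhere, but outside of that `a` vanishes.
  have hGa : ∀ᵐ k ∂ρ, ‖G k * a k‖ ≤ |C| := by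
    have h1 : ∀ᵐ k ∂(ρ.withDensity (τ.rnDeriv ρ)), ‖G k‖ ≤ C := by
      rw [Measure.withDensity_rnDeriv_eq _ _ (Measure.absolutelyContinuous_of_le hτρ)]
      exact hC
    rw [ae_withDensity_iff (Measure.measurable_rnDeriv _ _)] at h1
    filter_upwards [h1, norm_rnDeriv_le_one hτρ] with k hk hk1
    rw [norm_mul]
    by_cases h0 : τ.rnDeriv ρ k = 0
    · simp [a, h0]
    · calc ‖G k‖ * ‖a k‖ ≤ |C| * 1 := by
            gcongr
            exact (hk h0).trans (le_abs_self C)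
        _ = _ := mul_one _
  have hz : ∀ᵐ k ∂ρ, G k * a k - b k = 0 := by
    refine ae_eq_zero_of_integral_contDiff_smul_eq_zero ?_ fun g hg hc => ?_
    · refine (locallyIntegrable_const (|C| + 1)).mono
        ((hGm.mul ham).sub hbm).aestronglyMeasurable ?_
      filter_upwards [hGa, hb1] with k h1 h2
      rw [Real.norm_of_nonneg (by positivity)]
      exact (norm_sub_le _ _).trans (add_le_add h1 h2)
    · obtain ⟨φ₁, φ₂, hφ⟩ := exists_star_fourier_mul_fourier_eq hg hc
      have h1 := h φ₁ φ₂
      rw [integral_eq_integral_mul_rnDeriv hτρ, integral_eq_integral_mul_rnDeriv hηρ] at h1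
      have i1 := integrable_star_fourier_mul_fourier_mul ρ φ₁ φ₂ (G := fun k => G k * a k)
        (hGm.mul ham).aestronglyMeasurable hGa
      have i2 := integrable_star_fourier_mul_fourier_mul ρ φ₁ φ₂ hbm.aestronglyMeasurable hb1
      simp only [Complex.real_smul, ← hφ, mul_sub]
      rw [integral_sub i1 i2, sub_eq_zero, ← h1]
      simp only [mul_assoc, a]
  have hz' := (Measure.absolutelyContinuous_of_le hτρ).ae_le hz
  have h1 := (Measure.absolutelyContinuous_of_le hτρ).ae_le (Measure.rnDeriv_lt_top τ ρ)
  filter_upwards [hz', h1, Measure.rnDeriv_pos (Measure.absolutelyContinuous_of_le hτρ)]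
    with k hk hk1 hk0
  have ha : 0 < (τ.rnDeriv ρ k).toReal := ENNReal.toReal_pos hk0.ne' hk1.ne
  have hGk : G k = (((η.rnDeriv ρ k).toReal / (τ.rnDeriv ρ k).toReal : ℝ) : ℂ) := by
    have : ((τ.rnDeriv ρ k).toReal : ℂ) ≠ 0 := by exact_mod_cast ha.ne'
    rw [Complex.ofReal_div, eq_div_iff this]
    exact sub_eq_zero.1 hk
  rw [hGk, Complex.zero_le_real]
  positivity

end Tempered

/-! ### The existence of matrix-valued measures -/

section MatrixValued

/-- Over `ℂ` a quadratic form with real values already forces the matrix to be Hermitian. -/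
theorem posSemidef_of_forall_nonneg {m : ℕ} {M : Matrix (Fin m) (Fin m) ℂ}
    (h : ∀ w, 0 ≤ star w ⬝ᵥ (M *ᵥ w)) : M.PosSemidef := by
  refine PosSemidef.of_dotProduct_mulVec_nonneg ?_ h
  rw [← isSymmetric_toEuclideanLin_iff, LinearMap.isSymmetric_iff_inner_map_self_real]
  intro v
  have h1 : ⟪v, M.toEuclideanLin v⟫_ℂ = star v.ofLp ⬝ᵥ (M *ᵥ v.ofLp) := by
    rw [EuclideanSpace.inner_eq_star_dotProduct, dotProduct_comm]
    rfl
  have h2 : star (star v.ofLp ⬝ᵥ (M *ᵥ v.ofLp)) = star v.ofLp ⬝ᵥ (M *ᵥ v.ofLp) :=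
    (IsSelfAdjoint.of_nonneg (h v.ofLp)).star_eq
  rw [inner_conj_symm, h1, ← inner_conj_symm, h1]
  exact h2.symm

variable {E : Type v} [NormedAddCommGroup E] [InnerProductSpace ℝ E] [FiniteDimensional ℝ E]
  [MeasurableSpace E] [BorelSpace E] {m : ℕ}

/-- A matrix of bounded densities that defines positive measures is positive semidefinite. -/
theorem ae_posSemidef {τ : Measure E} [τ.HasTemperateGrowth] {M : E → Matrix (Fin m) (Fin m) ℂ}
    (hm : ∀ p q, Measurable fun k => M k p q) (h1 : ∀ p q, ∀ᵐ k ∂τ, ‖M k p q‖ ≤ 1)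
    (h : ∀ w : Fin m → ℂ, ∃ η : Measure E, η.HasTemperateGrowth ∧ ∀ φ₁ φ₂ : 𝓢(E, ℂ),
      ∫ k, star (𝓕 φ₁ k) * 𝓕 φ₂ k ∂η =
        ∑ p, ∑ q, star (w p) * w q * ∫ k, star (𝓕 φ₁ k) * 𝓕 φ₂ k * M k p q ∂τ) :
    ∀ᵐ k ∂τ, (M k).PosSemidef := by
  have key : ∀ w : Fin m → ℂ, ∀ᵐ k ∂τ, 0 ≤ star w ⬝ᵥ (M k *ᵥ w) := by
    intro w
    obtain ⟨η, hη, hηw⟩ := h w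
    have hform : ∀ k, star w ⬝ᵥ (M k *ᵥ w) = ∑ p, ∑ q, star (w p) * w q * M k p q := by
      intro k
      simp only [dotProduct, mulVec, Finset.mul_sum, Pi.star_apply]
      exact Finset.sum_congr rfl fun p _ => Finset.sum_congr rfl fun q _ => by ring
    simp only [hform]
    refine ae_nonneg_of_integral_mul_eq (η := η) (C := ∑ p, ∑ q, ‖star (w p) * w q‖) ?_ ?_ ?_
    · exact Finset.measurable_fun_sum _ fun p _ => Finset.measurable_fun_sum _ fun q _ =>
        (hm p q).const_mul _
    · filter_upwards [ae_all_iff.2 fun p => ae_all_iff.2 fun q => h1 p q] with k hk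
      refine (norm_sum_le _ _).trans (Finset.sum_le_sum fun p _ => (norm_sum_le _ _).trans
        (Finset.sum_le_sum fun q _ => ?_))
      rw [norm_mul]
      exact mul_le_of_le_one_right (norm_nonneg _) (hk p q)
    · intro φ₁ φ₂
      have hi : ∀ p q, Integrable (fun k => star (w p) * w q *
          (star (𝓕 φ₁ k) * 𝓕 φ₂ k * M k p q)) τ := fun p q =>
        (integrable_star_fourier_mul_fourier_mul τ φ₁ φ₂ (hm p q).aestronglyMeasurable
          (h1 p q)).const_mul _
      rw [hηw]
      simp only [Finset.mul_sum, ← integral_const_mul]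
      simp only [mul_left_comm (star (𝓕 φ₁ _) * 𝓕 φ₂ _)]
      rw [integral_finsetSum _ fun p _ => integrable_finsetSum _ fun q _ => hi p q]
      exact Finset.sum_congr rfl fun p _ => integral_finsetSum _ fun q _ => hi p q
  -- The exceptional null set depends on `w`, so only countably many `w` can be treated together; a
  -- dense sequence suffices since nonnegativity is a closed condition in `w`.
  have hall : ∀ᵐ k ∂τ, ∀ n, 0 ≤ star (TopologicalSpace.denseSeq (Fin m → ℂ) n) ⬝ᵥ
      (M k *ᵥ TopologicalSpace.denseSeq (Fin m → ℂ) n) := ae_all_iff.2 fun n => key _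
  filter_upwards [hall] with k hk
  refine posSemidef_of_forall_nonneg fun w => ?_
  have hcl : IsClosed {w : Fin m → ℂ | 0 ≤ star w ⬝ᵥ (M k *ᵥ w)} := by
    refine isClosed_le continuous_const ?_
    unfold dotProduct mulVec dotProduct
    fun_prop
  refine closure_minimal ?_ hcl (TopologicalSpace.denseRange_denseSeq (Fin m → ℂ) w)
  rintro _ ⟨n, rfl⟩
  exact hk n

/-- A matrix-valued measure from a matrix of bounded densities. -/
theorem exists_matrixMeasure_of_density {τ : Measure E} [τ.HasTemperateGrowth]
    {M : E → Matrix (Fin m) (Fin m) ℂ} (hm : ∀ p q, Measurable fun k => M k p q)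
    (h1 : ∀ p q, ∀ᵐ k ∂τ, ‖M k p q‖ ≤ 1) (hp : ∀ᵐ k ∂τ, (M k).PosSemidef) :
    ∃ ζ : MatrixMeasure E m, ∀ (g : E → ℂ) p q,
      ∫ k, g k * ζ.density k p q ∂ζ.tr = ∫ k, g k * M k p q ∂τ := by
  classical
  -- Positivity is required at every point of a `MatrixMeasure`, so `M` is replaced by `0` on a
  -- measurable null set.
  let N : Set E := toMeasurable τ {k | (M k).PosSemidef}ᶜ
  have hN : MeasurableSet N := measurableSet_toMeasurable _ _
  have hN0 : τ N = 0 := by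
    rw [measure_toMeasurable]
    exact hp
  let M' : E → Matrix (Fin m) (Fin m) ℂ := fun k => if k ∈ N then 0 else M k
  have hM'm : ∀ p q, Measurable fun k => M' k p q := by
    intro p q
    have : (fun k => M' k p q) = fun k => if k ∈ N then 0 else M k p q := by
      funext k
      by_cases hk : k ∈ N <;> simp [M', hk]
    rw [this]
    exact Measurable.ite hN measurable_const (hm p q)
  have hM'p : ∀ k, (M' k).PosSemidef := by
    intro k
    by_cases hk : k ∈ N
    · simp only [M', hk, if_true]
      exact PosSemidef.zero
    · simp only [M', hk, if_false]
      by_contra h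
      exact hk (subset_toMeasurable _ _ h)
  have hM'e : ∀ᵐ k ∂τ, M' k = M k := by
    have : ∀ᵐ k ∂τ, k ∉ N := measure_eq_zero_iff_ae_notMem.1 hN0
    filter_upwards [this] with k hk
    simp [M', hk]
  let T : E → ℝ := fun k => (M' k).trace.re
  have hT : ∀ k, (M' k).trace = (T k : ℂ) := fun k =>
    Complex.ext rfl (by simpa using (Complex.nonneg_iff.1 (hM'p k).trace_nonneg).2.symm)
  have hT0 : ∀ k, 0 ≤ T k := fun k => (Complex.nonneg_iff.1 (hM'p k).trace_nonneg).1
  have hTm : Measurable T := by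
    refine Complex.measurable_re.comp ?_
    unfold Matrix.trace
    exact Finset.measurable_fun_sum _ fun p _ => hM'm p p
  have hTb : ∀ᵐ k ∂τ, T k ≤ m := by
    filter_upwards [hM'e, ae_all_iff.2 fun p => h1 p p] with k hk hk1
    calc T k ≤ ‖(M' k).trace‖ := Complex.re_le_norm _
      _ ≤ ∑ p : Fin m, 1 := by
          rw [hk]
          exact (norm_sum_le _ _).trans (Finset.sum_le_sum fun p _ => hk1 p)
      _ = m := by simp
  let tr : Measure E := τ.withDensity fun k => ENNReal.ofReal (T k)
  have hle : tr ≤ (m : ℝ≥0∞) • τ := by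
    rw [← withDensity_const]
    refine withDensity_mono ?_
    filter_upwards [hTb] with k hk
    exact ENNReal.ofReal_le_of_le_toReal (by simpa using hk)
  refine ⟨⟨tr, fun k => (T k)⁻¹ • M' k, ?_, ?_, ?_, ?_⟩, ?_⟩
  · obtain ⟨n, hn⟩ := ‹τ.HasTemperateGrowth›.exists_integrable
    exact ⟨n, (hn.smul_measure (by simp)).mono_measure hle⟩
  · intro p q
    exact hTm.inv.smul (hM'm p q)
  · intro k
    exact (hM'p k).smul (inv_nonneg.2 (hT0 k))
  · rw [ae_withDensity_iff hTm.ennreal_ofReal]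
    refine Eventually.of_forall fun k hk => ?_
    have : (T k : ℂ) ≠ 0 := by
      intro h
      rw [Complex.ofReal_eq_zero.1 h, ENNReal.ofReal_zero] at hk
      exact hk rfl
    rw [trace_smul, hT, Complex.real_smul, Complex.ofReal_inv, inv_mul_cancel₀ this]
  · intro g p q
    change ∫ k, g k * ((T k)⁻¹ • M' k) p q ∂(τ.withDensity fun k => ENNReal.ofReal (T k)) = _
    rw [integral_withDensity_eq_integral_toReal_smul hTm.ennreal_ofReal
      (Eventually.of_forall fun _ => ENNReal.ofReal_lt_top)]
    refine integral_congr_ae ?_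
    filter_upwards [hM'e] with k hk
    rw [ENNReal.toReal_ofReal (hT0 k), ← hk]
    -- Dividing by the trace loses nothing: a positive semidefinite matrix of trace zero is zero.
    by_cases h0 : T k = 0
    · have : M' k = 0 := (hM'p k).trace_eq_zero_iff.1 (by rw [hT, h0, Complex.ofReal_zero])
      rw [this]
      simp
    · have : (T k : ℂ) ≠ 0 := by exact_mod_cast h0
      rw [Matrix.smul_apply, Complex.real_smul, Complex.real_smul, Complex.ofReal_inv]
      field_simp

theorem sum_sum_single_add_single (b : Fin m → Fin m → ℂ) (p q : Fin m) (c : ℂ) :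
    ∑ r, ∑ s, star ((Pi.single p 1 + Pi.single q c : Fin m → ℂ) r) *
      (Pi.single p 1 + Pi.single q c : Fin m → ℂ) s * b r s =
      b p p + c * b p q + star c * b q p + star c * c * b q q := by
  simp [Pi.single_apply, add_mul, mul_add, Finset.sum_add_distrib, apply_ite star, ite_mul, mul_ite]
  ring

/-- A matrix of sesquilinear forms, all of whose diagonal contractions are represented by tempered
measures, is represented by a matrix-valued measure. -/
theorem exists_matrixMeasure (B : Fin m → Fin m → 𝓢(E, ℂ) → 𝓢(E, ℂ) → ℂ)
    (h : ∀ w : Fin m → ℂ, ∃ η : Measure E, η.HasTemperateGrowth ∧ ∀ φ₁ φ₂ : 𝓢(E, ℂ),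
      ∑ p, ∑ q, star (w p) * w q * B p q φ₁ φ₂ = ∫ k, star (𝓕 φ₁ k) * 𝓕 φ₂ k ∂η) :
    ∃ ζ : MatrixMeasure E m, ∀ p q φ₁ φ₂,
      B p q φ₁ φ₂ = ∫ k, star (𝓕 φ₁ k) * 𝓕 φ₂ k * ζ.density k p q ∂ζ.tr := by
  choose η hη hηB using h
  -- Polarization: the contractions by `e_p + i^j e_q`, for `j = 0, ..., 3`, recover the entry `(p,
  -- q)`. The sum `τ` of the corresponding measures dominates each of them, and `M` combines their
  -- densities with coefficients `conj(i^j) / 4`.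
  let w : Fin m × Fin m × Fin 4 → Fin m → ℂ := fun i =>
    Pi.single i.1 1 + Pi.single i.2.1 (Complex.I ^ (i.2.2 : ℕ))
  let τ : Measure E := ∑ i, η (w i)
  have hτ : τ.HasTemperateGrowth := hasTemperateGrowth_sum _ fun i => hη _
  have := isLocallyFiniteMeasure_of_hasTemperateGrowth τ
  have hσ : ∀ i, SigmaFinite (η (w i)) := fun i => by
    have := hη (w i)
    have := isLocallyFiniteMeasure_of_hasTemperateGrowth (η (w i))
    infer_instance
  have hle : ∀ i, η (w i) ≤ τ := fun i =>
    Finset.single_le_sum (f := fun i => η (w i)) (fun _ _ => Measure.zero_le _) (Finset.mem_univ i)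
  let D : Fin m × Fin m × Fin 4 → E → ℂ := fun i k => (((η (w i)).rnDeriv τ k).toReal : ℂ)
  have hDm : ∀ i, Measurable (D i) := fun i => measurable_rnDeriv_ofReal _ _
  have hD1 : ∀ i, ∀ᵐ k ∂τ, ‖D i k‖ ≤ 1 := fun i => norm_rnDeriv_le_one (hle i)
  let M : E → Matrix (Fin m) (Fin m) ℂ := fun k p q =>
    4⁻¹ * ∑ j : Fin 4, star (Complex.I ^ (j : ℕ)) * D (p, q, j) k
  have hMm : ∀ p q, Measurable fun k => M k p q := fun p q =>
    (Finset.measurable_fun_sum _ fun j _ => (hDm _).const_mul _).const_mul _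
  have hM1 : ∀ p q, ∀ᵐ k ∂τ, ‖M k p q‖ ≤ 1 := by
    intro p q
    filter_upwards [ae_all_iff.2 fun j => hD1 (p, q, j)] with k hk
    have : ‖∑ j : Fin 4, star (Complex.I ^ (j : ℕ)) * D (p, q, j) k‖ ≤ ∑ j : Fin 4, 1 :=
      (norm_sum_le _ _).trans (Finset.sum_le_sum fun j _ => by simpa using hk j)
    simp only [M, norm_mul]
    norm_num at this ⊢
    linarith
  have hB : ∀ p q φ₁ φ₂, B p q φ₁ φ₂ = ∫ k, star (𝓕 φ₁ k) * 𝓕 φ₂ k * M k p q ∂τ := by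
    intro p q φ₁ φ₂
    have hj : ∀ j : Fin 4, ∫ k, star (𝓕 φ₁ k) * 𝓕 φ₂ k * D (p, q, j) k ∂τ =
        B p p φ₁ φ₂ + B q q φ₁ φ₂ + Complex.I ^ (j : ℕ) * B p q φ₁ φ₂ +
          star (Complex.I ^ (j : ℕ)) * B q p φ₁ φ₂ := by
      intro j
      rw [← integral_eq_integral_mul_rnDeriv (hle (p, q, j)), ← hηB,
        sum_sum_single_add_single fun p q => B p q φ₁ φ₂]
      have : star (Complex.I ^ (j : ℕ)) * Complex.I ^ (j : ℕ) = 1 := by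
        rw [star_pow, ← mul_pow]
        simp
      rw [this]
      ring
    have hi : ∀ j : Fin 4, Integrable (fun k => 4⁻¹ * (star (Complex.I ^ (j : ℕ)) *
        (star (𝓕 φ₁ k) * 𝓕 φ₂ k * D (p, q, j) k))) τ := fun j =>
      ((integrable_star_fourier_mul_fourier_mul τ φ₁ φ₂ (hDm _).aestronglyMeasurable
        (hD1 _)).const_mul _).const_mul _
    have h1 : ∀ k, star (𝓕 φ₁ k) * 𝓕 φ₂ k * M k p q = ∑ j : Fin 4, 4⁻¹ *
        (star (Complex.I ^ (j : ℕ)) * (star (𝓕 φ₁ k) * 𝓕 φ₂ k * D (p, q, j) k)) := by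
      intro k
      simp only [M, Finset.mul_sum]
      exact Finset.sum_congr rfl fun j _ => by ring
    simp only [h1]
    rw [integral_finsetSum _ fun j _ => hi j]
    simp only [integral_const_mul, hj, Fin.sum_univ_four]
    simp [pow_succ]
    linear_combination (B p q φ₁ φ₂ / 2 - B q p φ₁ φ₂ / 2) * (Complex.I_mul_I)
  have hps : ∀ᵐ k ∂τ, (M k).PosSemidef := ae_posSemidef hMm hM1 fun w =>
    ⟨η w, hη w, fun φ₁ φ₂ => by simp only [← hηB, ← hB]⟩
  obtain ⟨ζ, hζ⟩ := exists_matrixMeasure_of_density hMm hM1 hps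
  exact ⟨ζ, fun p q φ₁ φ₂ => by rw [hB, hζ]⟩

end MatrixValued

end FlatBranched

end

noncomputable section

set_option linter.unusedSectionVars false

namespace FlatBranched

open scoped ENNReal
open Filter Topology

/-! ### The space of square-integrable functions of a matrix-valued measure -/

theorem norm_toLp_sq {α : Type*} [MeasurableSpace α] {ν : Measure α} {h : α → ℂ}
    (hh : MemLp h 2 ν) : ‖hh.toLp h‖ ^ 2 = ∫ k, ‖h k‖ ^ 2 ∂ν := by
  have h2 : ∫ k, ((‖h k‖ ^ 2 : ℝ) : ℂ) ∂ν = ((∫ k, ‖h k‖ ^ 2 ∂ν : ℝ) : ℂ) := integral_ofReal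
  have h1 : ∫ k, ⟪(hh.toLp h : α → ℂ) k, (hh.toLp h : α → ℂ) k⟫_ℂ ∂ν =
      ∫ k, ((‖h k‖ ^ 2 : ℝ) : ℂ) ∂ν := by
    refine integral_congr_ae ?_
    filter_upwards [hh.coeFn_toLp] with k hk
    rw [hk, inner_self_eq_norm_sq_to_K]
    simp
  rw [← inner_self_eq_norm_sq (𝕜 := ℂ), L2.inner_def, h1, h2, RCLike.re_to_complex,
    Complex.ofReal_re]

namespace MatrixMeasure

variable {E : Type v} [NormedAddCommGroup E] [MeasurableSpace E] {m : ℕ} (ζ : MatrixMeasure E m)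

theorem inner_mk (g h : ζ.SquareIntegrable) :
    ⟪(SeparationQuotient.mk g : ζ.L2), SeparationQuotient.mk h⟫_ℂ =
      ∫ k, ζ.form g.1 h.1 k ∂ζ.tr := rfl

theorem norm_mk_sub_mk_sq (g h : ζ.SquareIntegrable) :
    ‖(SeparationQuotient.mk g : ζ.L2) - SeparationQuotient.mk h‖ ^ 2 =
      (∫ k, ζ.form (g.1 - h.1) (g.1 - h.1) k ∂ζ.tr).re := by
  rw [← SeparationQuotient.mk_sub, ← inner_self_eq_norm_sq (𝕜 := ℂ), inner_mk]
  rfl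

theorem mk_eq_mk_of_ae_eq {g h : ζ.SquareIntegrable} (hgh : g.1 =ᵐ[ζ.tr] h.1) :
    (SeparationQuotient.mk g : ζ.L2) = SeparationQuotient.mk h := by
  have h1 := ζ.norm_mk_sub_mk_sq g h
  have h2 : ∫ k, ζ.form (g.1 - h.1) (g.1 - h.1) k ∂ζ.tr = 0 := by
    refine integral_eq_zero_of_ae ?_
    filter_upwards [hgh] with k hk
    have h0 : (g.1 - h.1) k = 0 := sub_eq_zero.2 hk
    simp [form, h0]
  rw [h2, Complex.zero_re, sq_eq_zero_iff, norm_eq_zero, sub_eq_zero] at h1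
  exact h1

theorem form_single_single (h h' : E → ℂ) (p q : Fin m) (k : E) :
    ζ.form (fun k => Pi.single p (h k)) (fun k => Pi.single q (h' k)) k =
      star (h k) * h' k * ζ.density k p q := by
  simp only [form]
  rw [← Pi.single_star, single_dotProduct, mulVec_single]
  simp only [Pi.smul_apply, MulOpposite.smul_eq_mul_unop, MulOpposite.unop_op, col_apply]
  ring

theorem inner_tensor {h h' : E → ℂ} (hh : MemLp h 2 ζ.tr) (hh' : MemLp h' 2 ζ.tr) (p q : Fin m) :
    ⟪ζ.tensor h hh p, ζ.tensor h' hh' q⟫_ℂ =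
      ∫ k, star (h k) * h' k * ζ.density k p q ∂ζ.tr := by
  refine (ζ.inner_mk _ _).trans ?_
  simp only [form_single_single]

theorem tensor_congr {h h' : E → ℂ} (hh : MemLp h 2 ζ.tr) (hh' : MemLp h' 2 ζ.tr)
    (he : h =ᵐ[ζ.tr] h') (p : Fin m) : ζ.tensor h hh p = ζ.tensor h' hh' p := by
  refine ζ.mk_eq_mk_of_ae_eq ?_
  filter_upwards [he] with k hk
  simp only [hk]

theorem tensor_add {h h' : E → ℂ} (hh : MemLp h 2 ζ.tr) (hh' : MemLp h' 2 ζ.tr) (p : Fin m) :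
    ζ.tensor (h + h') (hh.add hh') p = ζ.tensor h hh p + ζ.tensor h' hh' p := by
  let a : ζ.SquareIntegrable := ⟨_, ζ.single_mem hh p⟩
  let b : ζ.SquareIntegrable := ⟨_, ζ.single_mem hh' p⟩
  refine Eq.trans (congrArg SeparationQuotient.mk (Subtype.ext (funext fun k => ?_)))
    (SeparationQuotient.mk_add a b)
  exact Pi.single_add (f := fun _ : Fin m => ℂ) p (h k) (h' k)

theorem tensor_smul (c : ℂ) {h : E → ℂ} (hh : MemLp h 2 ζ.tr) (p : Fin m) :
    ζ.tensor (c • h) (hh.const_smul c) p = c • ζ.tensor h hh p := by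
  let a : ζ.SquareIntegrable := ⟨_, ζ.single_mem hh p⟩
  refine Eq.trans (congrArg SeparationQuotient.mk (Subtype.ext (funext fun k => ?_)))
    (SeparationQuotient.mk_smul c a)
  exact Pi.single_smul (f := fun _ : Fin m => ℂ) p c (h k)

theorem norm_density_le : ∀ᵐ k ∂ζ.tr, ∀ p, ‖ζ.density k p p‖ ≤ 1 := by
  filter_upwards [ζ.trace_density] with k hk p
  have hd : ∀ q, 0 ≤ ζ.density k q q := fun q => (ζ.posSemidef k).diag_nonneg
  have hle : ζ.density k p p ≤ 1 := by
    rw [← hk, trace]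
    exact Finset.single_le_sum (f := fun q => ζ.density k q q) (fun q _ => hd q)
      (Finset.mem_univ p)
  have h1 : ((‖ζ.density k p p‖ : ℝ) : ℂ) = ζ.density k p p := Complex.norm_of_nonneg' (hd p)
  rw [← h1] at hle
  exact_mod_cast hle

/-- The diagonal entries of the density lie between `0` and its trace, which is `1`. -/
theorem norm_tensor_le {h : E → ℂ} (hh : MemLp h 2 ζ.tr) (p : Fin m) :
    ‖ζ.tensor h hh p‖ ≤ ‖hh.toLp h‖ := by
  rw [← sq_le_sq₀ (norm_nonneg _) (norm_nonneg _), ← inner_self_eq_norm_sq (𝕜 := ℂ),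
    norm_toLp_sq, inner_tensor]
  refine (Complex.re_le_norm _).trans ?_
  refine norm_integral_le_of_norm_le (hh.integrable_norm_pow (by norm_num)) ?_
  filter_upwards [ζ.norm_density_le] with k hk
  rw [norm_mul, norm_mul, norm_star, ← pow_two]
  exact mul_le_of_le_one_right (by positivity) (hk p)

/-- The map `h ↦ h ⊗ e_p`. -/
def tensorCLM (p : Fin m) : Lp ℂ 2 ζ.tr →L[ℂ] ζ.L2 :=
  LinearMap.mkContinuous
    { toFun := fun h => ζ.tensor h (Lp.memLp h) p
      map_add' := fun h h' => by
        rw [← tensor_add]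
        exact ζ.tensor_congr _ _ (Lp.coeFn_add h h') p
      map_smul' := fun c h => by
        rw [RingHom.id_apply, ← tensor_smul]
        exact ζ.tensor_congr _ _ (Lp.coeFn_smul c h) p }
    1 fun h => by
      rw [one_mul]
      refine (ζ.norm_tensor_le (Lp.memLp h) p).trans_eq ?_
      rw [Lp.toLp_coeFn]

theorem tensorCLM_toLp {h : E → ℂ} (hh : MemLp h 2 ζ.tr) (p : Fin m) :
    ζ.tensorCLM p (hh.toLp h) = ζ.tensor h hh p :=
  ζ.tensor_congr (Lp.memLp _) hh hh.coeFn_toLp p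

variable [BorelSpace E] [InnerProductSpace ℝ E] [FiniteDimensional ℝ E]

theorem mk_mem_of_bounded {W : Submodule ℂ ζ.L2} (hW : ∀ p h, ζ.tensorCLM p h ∈ W)
    {g : ζ.SquareIntegrable} (hg : ∀ p, MemLp (fun k => g.1 k p) 2 ζ.tr) :
    SeparationQuotient.mk g ∈ W := by
  have h1 : (SeparationQuotient.mk g : ζ.L2) = ∑ p, ζ.tensor _ (hg p) p := by
    simp only [tensor]
    have hs := map_sum (SeparationQuotient.mkCLM ℂ ζ.SquareIntegrable)
      (fun p : Fin m => (⟨fun k => Pi.single p (g.1 k p), ζ.single_mem (hg p) p⟩ :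
        ζ.SquareIntegrable)) Finset.univ
    refine Eq.trans ?_ hs
    refine congrArg SeparationQuotient.mk (Subtype.ext ?_)
    have hs' := map_sum ζ.squareIntegrableSubmodule.subtype
      (fun p : Fin m => (⟨fun k => Pi.single p (g.1 k p), ζ.single_mem (hg p) p⟩ :
        ζ.squareIntegrableSubmodule)) Finset.univ
    refine Eq.trans ?_ hs'.symm
    funext k
    simp only [Submodule.subtype_apply, Finset.sum_apply]
    exact (Finset.univ_sum_single (g.1 k)).symm
  rw [h1]
  refine W.sum_mem fun p _ => ?_
  rw [← tensorCLM_toLp]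
  exact hW p _

/-- Where the density degenerates, a square-integrable `g` need not have components in `L²(tr ζ)`.
Cutting it off to the sets `A n`, where it is bounded and the measure is finite, makes it a finite
sum of tensors; dominated convergence of the form brings `g` back. -/
theorem eq_top_of_tensor_mem {W : Submodule ℂ ζ.L2} (hc : IsClosed (W : Set ζ.L2))
    (hW : ∀ p h, ζ.tensorCLM p h ∈ W) : W = ⊤ := by
  have := ζ.tempered
  have := isLocallyFiniteMeasure_of_hasTemperateGrowth ζ.tr
  refine Submodule.eq_top_iff'.2 fun x => ?_
  obtain ⟨g, rfl⟩ := SeparationQuotient.surjective_mk x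
  let G : E → Fin m → ℂ := g.2.1.mk g.1
  have hGm : StronglyMeasurable G := g.2.1.stronglyMeasurable_mk
  let A : ℕ → Set E := fun n => {k | ‖G k‖ ≤ n} ∩ Metric.closedBall 0 n
  have hA : ∀ n, MeasurableSet (A n) := fun n =>
    (hGm.norm.measurable measurableSet_Iic).inter Metric.isClosed_closedBall.measurableSet
  have hform : ∀ n k, ζ.form ((A n).indicator g.1) ((A n).indicator g.1) k =
      (A n).indicator (ζ.form g.1 g.1) k := by
    intro n k
    by_cases hk : k ∈ A n <;> simp [form, hk]
  let gn : ℕ → ζ.SquareIntegrable := fun n => ⟨(A n).indicator g.1, g.2.1.indicator (hA n), by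
    have : ζ.form ((A n).indicator g.1) ((A n).indicator g.1) = (A n).indicator (ζ.form g.1 g.1) :=
      funext (hform n)
    rw [this]
    exact g.2.2.indicator (hA n)⟩
  have hgn : ∀ n, SeparationQuotient.mk (gn n) ∈ W := by
    intro n
    refine ζ.mk_mem_of_bounded hW fun p => ?_
    have hfin : ζ.tr (A n) < ∞ := (measure_mono Set.inter_subset_right).trans_lt
      (isCompact_closedBall (0 : E) n).measure_lt_top
    have hind : (fun k => (gn n).1 k p) = (A n).indicator fun k => g.1 k p := by
      funext k
      change (A n).indicator g.1 k p = _
      by_cases hk : k ∈ A n <;> simp [hk]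
    rw [hind, memLp_indicator_iff_restrict (hA n)]
    have : IsFiniteMeasure (ζ.tr.restrict (A n)) := ⟨by simpa using hfin⟩
    refine MemLp.of_bound (C := n) ?_ ?_
    · exact ((continuous_apply p).comp_aestronglyMeasurable g.2.1).restrict
    · filter_upwards [ae_restrict_mem (hA n), ae_restrict_of_ae g.2.1.ae_eq_mk] with k hk hk'
      rw [hk']
      exact (norm_le_pi_norm _ p).trans hk.1
  have hev : ∀ k, ∀ᶠ n in atTop, k ∈ A n := by
    intro k
    filter_upwards [eventually_ge_atTop ⌈max ‖G k‖ ‖k‖⌉₊] with n hn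
    have := Nat.ceil_le.1 hn
    exact ⟨(le_max_left _ _).trans this, mem_closedBall_zero_iff.2 ((le_max_right _ _).trans this)⟩
  have hlim : Tendsto (fun n => (SeparationQuotient.mk (gn n) : ζ.L2)) atTop
      (𝓝 (SeparationQuotient.mk g)) := by
    rw [tendsto_iff_norm_sub_tendsto_zero]
    have hsq : Tendsto (fun n => ‖(SeparationQuotient.mk (gn n) : ζ.L2) - SeparationQuotient.mk g‖ ^ 2)
        atTop (𝓝 0) := by
      simp only [norm_mk_sub_mk_sq]
      have h0 : Tendsto (fun n => ∫ k, ζ.form ((gn n).1 - g.1) ((gn n).1 - g.1) k ∂ζ.tr) atTop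
          (𝓝 (∫ k, 0 ∂ζ.tr)) := by
        refine tendsto_integral_of_dominated_convergence (fun k => ‖ζ.form g.1 g.1 k‖) ?_
          g.2.2.norm ?_ ?_
        · exact fun n => ζ.aestronglyMeasurable_form ((gn n).2.1.sub g.2.1) ((gn n).2.1.sub g.2.1)
        · refine fun n => Eventually.of_forall fun k => ?_
          by_cases hk : k ∈ A n
          · have : ((gn n).1 - g.1) k = 0 := by
              change (A n).indicator g.1 k - g.1 k = 0
              simp [hk]
            simp [form, this]
          · have : ((gn n).1 - g.1) k = -g.1 k := by
              change (A n).indicator g.1 k - g.1 k = _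
              simp [hk]
            simp [form, this, mulVec_neg]
        · refine Eventually.of_forall fun k => tendsto_const_nhds.congr' ?_
          filter_upwards [hev k] with n hk
          have : ((gn n).1 - g.1) k = 0 := by
            change (A n).indicator g.1 k - g.1 k = 0
            simp [hk]
          simp [form, this]
      rw [integral_zero] at h0
      exact (Complex.continuous_re.tendsto _).comp h0
    have := hsq.sqrt
    simpa using this
  exact hc.mem_of_tendsto hlim (Eventually.of_forall hgn)

theorem inner_schwartzTensor (φ₁ φ₂ : 𝓢(E, ℂ)) (p q : Fin m) :
    ⟪ζ.schwartzTensor φ₁ p, ζ.schwartzTensor φ₂ q⟫_ℂ =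
      ∫ k, star (φ₁ k) * φ₂ k * ζ.density k p q ∂ζ.tr :=
  ζ.inner_tensor _ _ p q

/-- The map `(φ_p)_p ↦ ∑_p φ_p^ ⊗ e_p`. -/
def fourierTensor : (Fin m → 𝓢(E, ℂ)) →ₗ[ℂ] ζ.L2 :=
  haveI := ζ.tempered
  ∑ p, ((ζ.tensorCLM p).comp ((SchwartzMap.toLpCLM ℂ ℂ 2 ζ.tr).comp
    (FourierTransform.fourierCLM ℂ 𝓢(E, ℂ)))).toLinearMap ∘ₗ LinearMap.proj p

theorem fourierTensor_apply (φ : Fin m → 𝓢(E, ℂ)) :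
    ζ.fourierTensor φ = ∑ p, ζ.schwartzTensor (𝓕 (φ p)) p := by
  rw [fourierTensor, LinearMap.sum_apply]
  exact Finset.sum_congr rfl fun p _ => ζ.tensorCLM_toLp _ p

theorem fourierTensor_single (φ : 𝓢(E, ℂ)) (p : Fin m) :
    ζ.fourierTensor (Pi.single p φ) = ζ.schwartzTensor (𝓕 φ) p := by
  rw [fourierTensor, LinearMap.sum_apply, Finset.sum_eq_single p]
  · refine Eq.trans ?_ (ζ.tensorCLM_toLp _ p)
    simp
    rfl
  · intro q _ hq
    rw [LinearMap.comp_apply, LinearMap.proj_apply, Pi.single_eq_of_ne hq, map_zero]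
  · simp

theorem denseRange_fourierTensor : DenseRange ζ.fourierTensor := by
  have := ζ.tempered
  have := isLocallyFiniteMeasure_of_hasTemperateGrowth ζ.tr
  have htop := ζ.eq_top_of_tensor_mem
    (W := (LinearMap.range ζ.fourierTensor).topologicalClosure)
    (Submodule.isClosed_topologicalClosure _) fun p h => by
      -- Density of Schwartz functions in `L²(tr ζ)`; every Schwartz function is a Fourier
      -- transform, so all its tensors are in the range.
      have hd : DenseRange (SchwartzMap.toLpCLM ℝ ℂ 2 ζ.tr) :=
        SchwartzMap.denseRange_toLpCLM (by norm_num)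
      refine hd.induction_on (p := fun h => ζ.tensorCLM p h ∈ _) h ?_ fun φ => ?_
      · exact (Submodule.isClosed_topologicalClosure _).preimage (ζ.tensorCLM p).continuous
      · refine Submodule.le_topologicalClosure _ ⟨Pi.single p (𝓕⁻ φ), ?_⟩
        rw [fourierTensor_single, FourierTransform.fourier_fourierInv_eq]
        exact (ζ.tensorCLM_toLp _ p).symm
  intro x
  have : x ∈ (LinearMap.range ζ.fourierTensor).topologicalClosure := htop ▸ Submodule.mem_top
  exact this

/-- Linear maps on the Schwartz space with the inner products given by `ζ` extend to an isometric
embedding of `L²(E, ζ; ℂ^m)`. -/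
theorem exists_linearIsometry {H : Type*} [NormedAddCommGroup H] [InnerProductSpace ℂ H]
    [CompleteSpace H] (S : Fin m → 𝓢(E, ℂ) →ₗ[ℂ] H)
    (hS : ∀ p q φ₁ φ₂, ⟪S p φ₁, S q φ₂⟫_ℂ =
      ∫ k, star (𝓕 φ₁ k) * 𝓕 φ₂ k * ζ.density k p q ∂ζ.tr) :
    ∃ Θ : ζ.L2 →ₗᵢ[ℂ] H, ∀ p φ, Θ (ζ.schwartzTensor (𝓕 φ) p) = S p φ := by
  let R : (Fin m → 𝓢(E, ℂ)) →ₗ[ℂ] H := ∑ p, S p ∘ₗ LinearMap.proj p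
  have hR : ∀ φ, R φ = ∑ p, S p (φ p) := fun φ => by simp [R]
  have hnorm : ∀ φ, ‖R φ‖ = ‖ζ.fourierTensor φ‖ := by
    intro φ
    rw [← sq_eq_sq₀ (norm_nonneg _) (norm_nonneg _), ← inner_self_eq_norm_sq (𝕜 := ℂ),
      ← inner_self_eq_norm_sq (𝕜 := ℂ), hR, fourierTensor_apply]
    simp only [sum_inner, inner_sum, inner_schwartzTensor, hS]
  have hd := ζ.denseRange_fourierTensor
  have hb : ∃ C, ∀ φ, ‖R φ‖ ≤ C * ‖ζ.fourierTensor φ‖ := ⟨1, fun φ => by rw [hnorm, one_mul]⟩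
  refine ⟨⟨(R.extendOfNorm ζ.fourierTensor).toLinearMap, fun x => ?_⟩, fun p φ => ?_⟩
  · refine hd.induction_on (p := fun x => ‖R.extendOfNorm ζ.fourierTensor x‖ = ‖x‖) x ?_ fun φ => ?_
    · exact isClosed_eq (by fun_prop) (by fun_prop)
    · rw [LinearMap.extendOfNorm_eq hd hb, hnorm]
  · change R.extendOfNorm ζ.fourierTensor _ = _
    rw [← fourierTensor_single, LinearMap.extendOfNorm_eq hd hb, hR, Finset.sum_eq_single p]
    · simp
    · intro q _ hq
      simp [hq]
    · simp

end MatrixMeasure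

end FlatBranched

end

noncomputable section

set_option linter.unusedSectionVars false

namespace FlatBranched

open scoped ENNReal
open Filter Topology

/-! ### Convergence to the indicator function of a point -/

section Atoms

theorem tendsto_toLp_of_dominated {α : Type*} [MeasurableSpace α] {ν : Measure α}
    {F : ℕ → α → ℂ} {g : α → ℂ} (hF : ∀ n, MemLp (F n) 2 ν) (hg : MemLp g 2 ν) {b : α → ℝ}
    (hb : MemLp b 2 ν) (hbd : ∀ n k, ‖F n k - g k‖ ≤ b k)
    (hlim : ∀ k, Tendsto (fun n => F n k) atTop (𝓝 (g k))) :
    Tendsto (fun n => (hF n).toLp (F n)) atTop (𝓝 (hg.toLp g)) := by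
  rw [tendsto_iff_norm_sub_tendsto_zero]
  have hsq : Tendsto (fun n => ‖(hF n).toLp (F n) - hg.toLp g‖ ^ 2) atTop (𝓝 0) := by
    simp only [← MemLp.toLp_sub, norm_toLp_sq]
    have h0 : Tendsto (fun n => ∫ k, ‖(F n - g) k‖ ^ 2 ∂ν) atTop (𝓝 (∫ _, (0 : ℝ) ∂ν)) := by
      refine tendsto_integral_of_dominated_convergence (fun k => ‖b k‖ ^ 2) ?_
        (hb.integrable_norm_pow (by norm_num)) ?_ ?_
      · exact fun n => (((hF n).sub hg).1.norm.pow 2)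
      · refine fun n => Eventually.of_forall fun k => ?_
        rw [Real.norm_of_nonneg (by positivity)]
        gcongr
        exact (hbd n k).trans (le_abs_self _)
      · refine Eventually.of_forall fun k => ?_
        have := ((hlim k).sub_const (g k)).norm.pow 2
        simpa using this
    simpa using h0
  have := hsq.sqrt
  simpa using this

variable {E : Type v} [NormedAddCommGroup E] [InnerProductSpace ℝ E] [FiniteDimensional ℝ E]
  [MeasurableSpace E] [BorelSpace E]

/-- Schwartz functions whose Fourier transforms converge to the indicator function of `{k}`. -/
theorem exists_seq_fourier (k : E) : ∃ φ : ℕ → 𝓢(E, ℂ), ∀ n, 𝓕 (φ n) k = 1 ∧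
    (∀ l, 1 / ((n : ℝ) + 1) ≤ dist l k → 𝓕 (φ n) l = 0) ∧ ∀ l, ‖𝓕 (φ n) l‖ ≤ 1 := by
  have : ∀ n : ℕ, ∃ φ : 𝓢(E, ℂ), 𝓕 φ k = 1 ∧
      (∀ l, 1 / ((n : ℝ) + 1) ≤ dist l k → 𝓕 φ l = 0) ∧ ∀ l, ‖𝓕 φ l‖ ≤ 1 := by
    intro n
    have hn : 0 < 1 / ((n : ℝ) + 1) := by positivity
    obtain ⟨χ, h1, h2, h3⟩ := exists_schwartz_bump k (half_pos hn) (half_lt_self hn)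
    refine ⟨𝓕⁻ χ, ?_⟩
    rw [FourierTransform.fourier_fourierInv_eq]
    exact ⟨h1 k (Metric.mem_closedBall_self (half_pos hn).le), h2, h3⟩
  choose φ hφ using this
  exact ⟨φ, hφ⟩

/-- A sequence of Schwartz functions as in `exists_seq_fourier`. -/
def atomSeq (k : E) : ℕ → 𝓢(E, ℂ) := (exists_seq_fourier k).choose

theorem fourier_atomSeq_self (k : E) (n : ℕ) : 𝓕 (atomSeq k n) k = 1 :=
  ((exists_seq_fourier k).choose_spec n).1

theorem fourier_atomSeq_eq_zero (k : E) (n : ℕ) {l : E} (h : 1 / ((n : ℝ) + 1) ≤ dist l k) :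
    𝓕 (atomSeq k n) l = 0 :=
  ((exists_seq_fourier k).choose_spec n).2.1 l h

theorem norm_fourier_atomSeq_le (k : E) (n : ℕ) (l : E) : ‖𝓕 (atomSeq k n) l‖ ≤ 1 :=
  ((exists_seq_fourier k).choose_spec n).2.2 l

theorem fourier_atomSeq_eq_zero_of_notMem {k l : E} (n : ℕ) (h : l ∉ Metric.closedBall k 1) :
    𝓕 (atomSeq k n) l = 0 := by
  refine fourier_atomSeq_eq_zero k n (le_trans ?_ (not_le.1 h).le)
  rw [div_le_one (by positivity)]
  linarith [(Nat.cast_nonneg n : (0 : ℝ) ≤ n)]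

theorem eventually_fourier_atomSeq_eq_zero {k l : E} (h : l ≠ k) :
    ∀ᶠ n in atTop, 𝓕 (atomSeq k n) l = 0 := by
  have := (tendsto_one_div_add_atTop_nhds_zero_nat (𝕜 := ℝ)).eventually
    (eventually_le_nhds (dist_pos.2 h))
  filter_upwards [this] with n hn
  exact fourier_atomSeq_eq_zero k n hn

theorem memLp_indicator_closedBall (η : Measure E) [hη : η.HasTemperateGrowth] (k : E) (C : ℝ) :
    MemLp ((Metric.closedBall k 1).indicator fun _ => C) 2 η := by
  have := isLocallyFiniteMeasure_of_hasTemperateGrowth η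
  exact memLp_indicator_const 2 Metric.isClosed_closedBall.measurableSet C
    (Or.inr (isCompact_closedBall k 1).measure_lt_top.ne)

theorem memLp_indicator_singleton (η : Measure E) [hη : η.HasTemperateGrowth] (k : E) :
    MemLp (({k} : Set E).indicator fun _ => (1 : ℂ)) 2 η := by
  have := isLocallyFiniteMeasure_of_hasTemperateGrowth η
  exact memLp_indicator_const 2 (measurableSet_singleton k) 1
    (Or.inr isCompact_singleton.measure_lt_top.ne)

theorem tendsto_toLp_fourier_atomSeq (η : Measure E) [hη : η.HasTemperateGrowth] (k : E) :
    Tendsto (fun n => (𝓕 (atomSeq k n)).toLp 2 η) atTop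
      (𝓝 ((memLp_indicator_singleton η k).toLp _)) := by
  refine tendsto_toLp_of_dominated (fun n => (𝓕 (atomSeq k n)).memLp 2 η)
    (memLp_indicator_singleton η k) (memLp_indicator_closedBall η k 1) (fun n l => ?_) fun l => ?_
  · by_cases hl : l = k
    · subst hl
      simp [fourier_atomSeq_self]
    · by_cases hb : l ∈ Metric.closedBall k 1
      · simpa [hl, hb] using norm_fourier_atomSeq_le k n l
      · simp [hl, fourier_atomSeq_eq_zero_of_notMem n hb, hb]
  · by_cases hl : l = k
    · subst hl
      simp [fourier_atomSeq_self]
    · refine tendsto_const_nhds.congr' ?_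
      filter_upwards [eventually_fourier_atomSeq_eq_zero hl] with n hn
      simp [hn, hl]

theorem char_comm (t k : E) : char t k = char k t := by
  rw [char, char, real_inner_comm]

theorem fourier_shift (φ : 𝓢(E, ℂ)) (t l : E) : 𝓕 (shift t φ) l = char t l * 𝓕 φ l := by
  rw [SchwartzMap.fourier_coe, SchwartzMap.fourier_coe, fourier_eq_integral_char,
    fourier_eq_integral_char, ← integral_const_mul,
    ← integral_add_right_eq_self _ t]
  refine integral_congr_ae (Eventually.of_forall fun y => ?_)
  simp only [SchwartzMap.compSubConstCLM_apply, add_comm y t, char_comm l, char_add]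
  rw [add_sub_cancel_left]
  ring

/-- The transform is `char t l - char t k` times that of `atomSeq k n`: it vanishes at `l = k`, and
at any other `l` once the support has shrunk past it. -/
theorem tendsto_toLp_fourier_shift_sub (η : Measure E) [hη : η.HasTemperateGrowth] (k t : E) :
    Tendsto (fun n => (𝓕 (shift t (atomSeq k n) - char t k • atomSeq k n)).toLp 2 η) atTop
      (𝓝 0) := by
  have hF : ∀ n l, 𝓕 (shift t (atomSeq k n) - char t k • atomSeq k n) l =
      (char t l - char t k) * 𝓕 (atomSeq k n) l := by
    intro n l
    rw [sub_eq_add_neg, FourierTransform.fourier_add, ← neg_smul, FourierTransform.fourier_smul,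
      _root_.add_apply, _root_.smul_apply, fourier_shift]
    simp only [smul_eq_mul]
    ring
  have h0 : MemLp (0 : E → ℂ) 2 η := MemLp.zero
  have := tendsto_toLp_of_dominated (fun n => (𝓕 (shift t (atomSeq k n) -
    char t k • atomSeq k n)).memLp 2 η) h0 (memLp_indicator_closedBall η k 2) (fun n l => ?_)
    fun l => ?_
  · rw [MemLp.toLp_zero] at this
    exact this
  · rw [Pi.zero_apply, sub_zero, hF, norm_mul]
    by_cases hb : l ∈ Metric.closedBall k 1
    · rw [Set.indicator_of_mem hb]
      calc ‖char t l - char t k‖ * ‖𝓕 (atomSeq k n) l‖ ≤ (1 + 1) * 1 := by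
            gcongr
            · exact (norm_sub_le _ _).trans (by rw [norm_char, norm_char])
            · exact norm_fourier_atomSeq_le k n l
        _ = 2 := by norm_num
    · simp [fourier_atomSeq_eq_zero_of_notMem n hb, hb]
  · simp only [hF]
    by_cases hl : l = k
    · subst hl
      simp
    · refine tendsto_const_nhds.congr' ?_
      filter_upwards [eventually_fourier_atomSeq_eq_zero hl] with n hn
      simp [hn]

variable {H : Type*} [NormedAddCommGroup H] [InnerProductSpace ℂ H] [CompleteSpace H]
  {S : 𝓢(E, ℂ) →ₗ[ℂ] H} {η : Measure E} [hη : η.HasTemperateGrowth]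

theorem norm_eq_of_inner_eq (h : ∀ φ₁ φ₂, ⟪S φ₁, S φ₂⟫_ℂ = ∫ k, star (𝓕 φ₁ k) * 𝓕 φ₂ k ∂η)
    (φ : 𝓢(E, ℂ)) : ‖S φ‖ = ‖(𝓕 φ).toLp 2 η‖ := by
  rw [← sq_eq_sq₀ (norm_nonneg _) (norm_nonneg _), ← inner_self_eq_norm_sq (𝕜 := ℂ),
    ← inner_self_eq_norm_sq (𝕜 := ℂ), h, SchwartzMap.inner_toL2_toL2_eq _ _ η]
  congr 2
  funext k
  rw [RCLike.inner_apply, mul_comm]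
  rfl

/-- The sequence is Cauchy because `φ^ ↦ S φ` preserves the norm of `L²(η)`, where the transforms
converge. -/
theorem exists_tendsto_atomSeq (h : ∀ φ, ‖S φ‖ = ‖(𝓕 φ).toLp 2 η‖) (k : E) :
    ∃ v, Tendsto (fun n => S (atomSeq k n)) atTop (𝓝 v) := by
  refine cauchySeq_tendsto_of_complete ?_
  have hc := (tendsto_toLp_fourier_atomSeq η k).cauchySeq
  rw [Metric.cauchySeq_iff] at hc ⊢
  have hd : ∀ a b, dist (S (atomSeq k a)) (S (atomSeq k b)) =
      dist ((𝓕 (atomSeq k a)).toLp 2 η) ((𝓕 (atomSeq k b)).toLp 2 η) := by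
    intro a b
    rw [dist_eq_norm, ← map_sub, h, dist_eq_norm]
    congr 1
    exact map_sub ((SchwartzMap.toLpCLM ℂ ℂ 2 η).comp (FourierTransform.fourierCLM ℂ 𝓢(E, ℂ)))
      (atomSeq k a) (atomSeq k b)
  simpa only [hd] using hc

/-- The limit has the same norm as `1_{k}` in `L²(η)`. -/
theorem norm_sq_eq_of_tendsto_atomSeq (h : ∀ φ, ‖S φ‖ = ‖(𝓕 φ).toLp 2 η‖) {k : E} {v : H}
    (hv : Tendsto (fun n => S (atomSeq k n)) atTop (𝓝 v)) :
    η {k} = ENNReal.ofReal (‖v‖ ^ 2) := by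
  have := isLocallyFiniteMeasure_of_hasTemperateGrowth η
  have h1 := (tendsto_toLp_fourier_atomSeq η k).norm
  have h2 := hv.norm
  simp only [h] at h2
  rw [tendsto_nhds_unique h2 h1, norm_toLp_sq]
  have : ∀ l, ‖({k} : Set E).indicator (fun _ => (1 : ℂ)) l‖ ^ 2 =
      ({k} : Set E).indicator (fun _ => (1 : ℝ)) l := by
    intro l
    by_cases hl : l = k <;> simp [hl]
  simp only [this]
  rw [integral_indicator_const _ (measurableSet_singleton k), smul_eq_mul, mul_one,
    ofReal_measureReal isCompact_singleton.measure_lt_top.ne]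

theorem tendsto_shift_atomSeq (h : ∀ φ, ‖S φ‖ = ‖(𝓕 φ).toLp 2 η‖) {k : E} {v : H}
    (hv : Tendsto (fun n => S (atomSeq k n)) atTop (𝓝 v)) (t : E) :
    Tendsto (fun n => S (shift t (atomSeq k n))) atTop (𝓝 (char t k • v)) := by
  have h1 : Tendsto (fun n => S (shift t (atomSeq k n) - char t k • atomSeq k n)) atTop (𝓝 0) := by
    rw [tendsto_zero_iff_norm_tendsto_zero]
    simp only [h]
    simpa using (tendsto_toLp_fourier_shift_sub η k t).norm
  have h2 := h1.add (hv.const_smul (char t k))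
  simpa using h2

end Atoms

namespace MatrixMeasure

variable {E : Type v} [NormedAddCommGroup E] [InnerProductSpace ℝ E] [FiniteDimensional ℝ E]
  [MeasurableSpace E] [BorelSpace E] {m : ℕ} (ζ : MatrixMeasure E m)

theorem tendsto_schwartzTensor_atomSeq (k : E) (p : Fin m) :
    Tendsto (fun n => ζ.schwartzTensor (𝓕 (atomSeq k n)) p) atTop (𝓝 (ζ.indicatorTensor k p)) := by
  have := ζ.tempered
  have h1 := ((ζ.tensorCLM p).continuous.tendsto _).comp (tendsto_toLp_fourier_atomSeq ζ.tr k)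
  rw [tensorCLM_toLp] at h1
  refine h1.congr fun n => ?_
  exact ζ.tensorCLM_toLp _ p

end MatrixMeasure

/-! ### Eigenfunctions of an ergodic action -/

section Ergodic

variable {G Y : Type*} [AddGroup G] [AddAction G Y] [MeasurableSpace Y] {μ : Measure Y}

/-- Preimages of measurable sets are invariant up to null sets, hence null or conull; as `ℂ` is
countably separated, `u` is almost everywhere constant. -/
theorem exists_ae_eq_const_of_vadd_invariant [ErgodicVAdd G Y μ] {u : Y → ℂ}
    (hu : AEMeasurable u μ) (h : ∀ t : G, (fun y => u (t +ᵥ y)) =ᵐ[μ] u) :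
    ∃ c, u =ᵐ[μ] fun _ => c := by
  refine exists_eventuallyEq_const_of_forall_separating MeasurableSet fun U hU => ?_
  have h1 : EventuallyConst (u ⁻¹' U) (ae μ) := by
    refine aeconst_of_forall_preimage_vadd_ae_eq G (hu.nullMeasurable hU) fun t => ?_
    filter_upwards [h t] with y hy
    change (u (t +ᵥ y) ∈ U) = (u y ∈ U)
    rw [hy]
  rw [eventuallyConst_set] at h1
  exact h1

/-- The functions `conj(ψ) ψ` and `conj(ψ) V` are invariant since `|χ| = 1`, so they are constants
`1` and `c`. Hence `V = c ψ` with `c = ⟨ψ, V⟩`. -/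
theorem norm_inner_eq_norm_of_eigen [ErgodicVAdd G Y μ] [IsProbabilityMeasure μ]
    {χ : G → ℂ} (hχ : ∀ t, ‖χ t‖ = 1) {ψ V : Lp ℂ 2 μ} (hψ1 : ‖ψ‖ = 1)
    (hψ : ∀ t : G, (fun y => ψ (t +ᵥ y)) =ᵐ[μ] fun y => χ t * ψ y)
    (hV : ∀ t : G, (fun y => V (t +ᵥ y)) =ᵐ[μ] fun y => χ t * V y) :
    ‖⟪ψ, V⟫_ℂ‖ = ‖V‖ := by
  have hχ' : ∀ t, star (χ t) * χ t = 1 := by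
    intro t
    have := RCLike.conj_mul (χ t)
    rw [hχ] at this
    simpa using this
  have hψm := (Lp.aestronglyMeasurable ψ).aemeasurable
  have hVm := (Lp.aestronglyMeasurable V).aemeasurable
  have hprod : ∀ {a b : Lp ℂ 2 μ}, (∀ t : G, (fun y => a (t +ᵥ y)) =ᵐ[μ] fun y => χ t * a y) →
      (∀ t : G, (fun y => b (t +ᵥ y)) =ᵐ[μ] fun y => χ t * b y) →
      ∃ c, (fun y => star (a y) * b y) =ᵐ[μ] fun _ => c := by
    intro a b ha hb
    refine exists_ae_eq_const_of_vadd_invariant (G := G) ?_ fun t => ?_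
    · exact (Complex.continuous_conj.measurable.comp_aemeasurable
        (Lp.aestronglyMeasurable a).aemeasurable).mul (Lp.aestronglyMeasurable b).aemeasurable
    · filter_upwards [ha t, hb t] with y h1 h2
      rw [h1, h2, star_mul', mul_mul_mul_comm, hχ', one_mul]
  have hinner : ∀ {a b : Lp ℂ 2 μ} {c : ℂ}, (fun y => star (a y) * b y) =ᵐ[μ] (fun _ => c) →
      ⟪a, b⟫_ℂ = c := by
    intro a b c h
    rw [L2.inner_def]
    have : ∫ y, ⟪a y, b y⟫_ℂ ∂μ = ∫ _, c ∂μ := by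
      refine integral_congr_ae ?_
      filter_upwards [h] with y hy
      rw [← hy, RCLike.inner_apply, mul_comm]
      rfl
    rw [this]
    simp
  obtain ⟨c₁, hc₁⟩ := hprod hψ hψ
  obtain ⟨c, hc⟩ := hprod hψ hV
  have h1 : c₁ = 1 := by
    rw [← hinner hc₁, inner_self_eq_norm_sq_to_K, hψ1]
    simp
  have hVψ : V = c • ψ := by
    refine Lp.ext ?_
    filter_upwards [hc₁, hc, Lp.coeFn_smul c ψ] with y h2 h3 h4
    rw [h4, Pi.smul_apply, smul_eq_mul, ← h3]
    rw [h1] at h2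
    linear_combination -(V y) * h2
  rw [hinner hc, hVψ, norm_smul, hψ1, mul_one]

end Ergodic

end FlatBranched

end

noncomputable section

set_option linter.unusedSectionVars false

namespace FlatBranched

open scoped ENNReal
open Filter Topology

/-! ### The diffraction measures of a hull -/

section HullDiffraction

variable {E : Type v} [NormedAddCommGroup E] [InnerProductSpace ℝ E] [FiniteDimensional ℝ E]
  [MeasurableSpace E] [BorelSpace E] {X : Type u} [TopologicalSpace X] [T1Space X] {f₀ : C(E, X)}
  (μ : Measure (Hull f₀)) [IsProbabilityMeasure μ] (h : HasUniformlyDiscreteFibres f₀) {m : ℕ}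
  (x : Fin m → X)

/-- The map `φ ↦ ∑_p w_p Γ_{x_p}(φ)`. -/
def weightedΓ (w : Fin m → ℂ) : 𝓢(E, ℂ) →ₗ[ℂ] Lp ℂ 2 μ := ∑ p, w p • toL2Γ μ h (x p)

theorem weightedΓ_apply (w : Fin m → ℂ) (φ : 𝓢(E, ℂ)) :
    weightedΓ μ h x w φ = ∑ p, w p • toL2Γ μ h (x p) φ := by
  simp [weightedΓ]

theorem inner_weightedΓ (w : Fin m → ℂ) (φ₁ φ₂ : 𝓢(E, ℂ)) :
    ⟪weightedΓ μ h x w φ₁, weightedΓ μ h x w φ₂⟫_ℂ =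
      ∑ p, ∑ q, star (w p) * w q * innerΓ μ (x p) (x q) φ₁ φ₂ := by
  simp only [weightedΓ_apply, sum_inner, inner_sum, inner_smul_left, inner_smul_right,
    inner_toL2Γ, innerΓ, Finset.mul_sum]
  rw [Finset.sum_comm]
  refine Finset.sum_congr rfl fun p _ => Finset.sum_congr rfl fun q _ => ?_
  rw [mul_left_comm, ← mul_assoc]
  rfl

theorem inner_weightedΓ_eq {w : Fin m → ℂ} {η : Measure E} (hη : IsDiffractionMeasure μ x w η)
    (φ₁ φ₂ : 𝓢(E, ℂ)) : ⟪weightedΓ μ h x w φ₁, weightedΓ μ h x w φ₂⟫_ℂ =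
      ∫ k, star (𝓕 φ₁ k) * 𝓕 φ₂ k ∂η := by
  rw [inner_weightedΓ, hη.inner_eq]

variable [VAddInvariantMeasure E (Hull f₀) μ]

theorem isTranslationInvariant_weightedΓ (w : Fin m → ℂ) :
    IsTranslationInvariant (weightedΓ μ h x w) := by
  refine ⟨?_, fun φ₁ φ₂ t => ?_⟩
  · choose C hC0 hC using fun p => exists_norm_toL2Γ_le μ h (x p)
    refine ⟨∑ p, ‖w p‖ * C p, Finset.sum_nonneg fun p _ => mul_nonneg (norm_nonneg _) (hC0 p),
      fun φ M hM => ?_⟩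
    rw [weightedΓ_apply, Finset.sum_mul]
    refine (norm_sum_le _ _).trans (Finset.sum_le_sum fun p _ => ?_)
    rw [norm_smul, mul_assoc]
    gcongr
    exact hC p φ M hM
  · simp only [weightedΓ_apply, sum_inner, inner_sum, inner_smul_left, inner_smul_right,
      inner_toL2Γ_translate]

include h in
theorem exists_isDiffractionMeasure (w : Fin m → ℂ) :
    ∃ η : Measure E, IsDiffractionMeasure μ x w η := by
  obtain ⟨η, h1, h2⟩ := (isTranslationInvariant_weightedΓ μ h x w).exists_measure_inner_eq
  exact ⟨η, h1, fun φ₁ φ₂ => by rw [← h2, inner_weightedΓ]⟩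

include h in
theorem exists_isMatrixDiffractionMeasure :
    ∃ ζ : MatrixMeasure E m, IsMatrixDiffractionMeasure μ x ζ := by
  refine exists_matrixMeasure (fun p q φ₁ φ₂ => innerΓ μ (x p) (x q) φ₁ φ₂) fun w => ?_
  obtain ⟨η, hη⟩ := exists_isDiffractionMeasure μ h x w
  exact ⟨η, hη.tempered, hη.inner_eq⟩

include h in
theorem exists_isDiffractionEmbedding {ζ : MatrixMeasure E m}
    (hζ : IsMatrixDiffractionMeasure μ x ζ) :
    ∃ Θ : ζ.L2 →ₗᵢ[ℂ] Lp ℂ 2 μ, IsDiffractionEmbedding μ x ζ Θ := by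
  obtain ⟨Θ, hΘ⟩ := ζ.exists_linearIsometry (fun p => toL2Γ μ h (x p)) fun p q φ₁ φ₂ => by
    rw [inner_toL2Γ]
    exact hζ p q φ₁ φ₂
  refine ⟨Θ, fun p φ => ?_⟩
  rw [hΘ]
  exact coeFn_toL2Γ μ h (x p) φ

/-! ### Diffraction amplitudes -/

theorem exists_tendsto_toL2Γ_atomSeq (y : X) (k : E) :
    ∃ v, Tendsto (fun n => toL2Γ μ h y (atomSeq k n)) atTop (𝓝 v) := by
  -- A single decoration point of weight `1`: the limit then refers to `y` and `k` alone, not to any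
  -- larger decoration.
  obtain ⟨η, hη⟩ := exists_isDiffractionMeasure μ h (fun _ : Fin 1 => y) fun _ => 1
  have := hη.tempered
  have h1 := exists_tendsto_atomSeq (norm_eq_of_inner_eq (inner_weightedΓ_eq μ h _ hη)) k
  simpa [weightedΓ_apply] using h1

/-- The component of the Dirac comb of `f⁻¹(y)` at the frequency `k`. -/
def spectralAtom (k : E) (y : X) : Lp ℂ 2 μ := (exists_tendsto_toL2Γ_atomSeq μ h y k).choose

theorem tendsto_spectralAtom (k : E) (y : X) :
    Tendsto (fun n => toL2Γ μ h y (atomSeq k n)) atTop (𝓝 (spectralAtom μ h k y)) :=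
  (exists_tendsto_toL2Γ_atomSeq μ h y k).choose_spec

variable {x} in
-- Both sides are limits of `Γ_{x_p}(φ_n)` along the same fixed sequence `atomSeq k`, on the left by
-- continuity of `Θ`.
theorem map_indicatorTensor {ζ : MatrixMeasure E m} {Θ : ζ.L2 →ₗᵢ[ℂ] Lp ℂ 2 μ}
    (hΘ : IsDiffractionEmbedding μ x ζ Θ) (k : E) (p : Fin m) :
    Θ (ζ.indicatorTensor k p) = spectralAtom μ h k (x p) := by
  refine tendsto_nhds_unique ((Θ.continuous.tendsto _).comp
    (ζ.tendsto_schwartzTensor_atomSeq k p)) ((tendsto_spectralAtom μ h k (x p)).congr fun n => ?_)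
  exact Lp.ext ((coeFn_toL2Γ μ h (x p) _).trans (hΘ p _).symm)

theorem tendsto_weightedΓ_atomSeq (w : Fin m → ℂ) (k : E) :
    Tendsto (fun n => weightedΓ μ h x w (atomSeq k n)) atTop
      (𝓝 (∑ p, w p • spectralAtom μ h k (x p))) := by
  simp only [weightedΓ_apply]
  exact tendsto_finsetSum _ fun p _ => (tendsto_spectralAtom μ h k (x p)).const_smul (w p)

theorem compMeasurePreserving_weightedΓ (w : Fin m → ℂ) (φ : 𝓢(E, ℂ)) (t : E) :
    Lp.compMeasurePreserving (-t +ᵥ · : Hull f₀ → Hull f₀) (measurePreserving_vadd (-t) μ)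
      (weightedΓ μ h x w φ) = weightedΓ μ h x w (shift (-t) φ) := by
  rw [weightedΓ_apply, weightedΓ_apply, map_sum]
  refine Finset.sum_congr rfl fun p _ => ?_
  have h1 : ∀ (c : ℂ) (g : Lp ℂ 2 μ), Lp.compMeasurePreserving (-t +ᵥ · : Hull f₀ → Hull f₀)
      (measurePreserving_vadd (-t) μ) (c • g) =
      c • Lp.compMeasurePreserving (-t +ᵥ · : Hull f₀ → Hull f₀) (measurePreserving_vadd (-t) μ) g :=
    (Lp.compMeasurePreservingₗ ℂ (-t +ᵥ · : Hull f₀ → Hull f₀)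
      (measurePreserving_vadd (-t) μ)).map_smul
  rw [h1]
  congr 1
  exact Lp.ext ((Lp.coeFn_compMeasurePreserving _ _).trans (toL2Γ_vadd μ h (x p) φ t))

variable {x} in
-- Composition with a translation is an isometry of `L²`, so it passes to the limit. On the
-- approximants it shifts `φ_n`, which in the limit is multiplication by a character value at `k`.
theorem sum_spectralAtom_vadd {w : Fin m → ℂ} {η : Measure E} (hη : IsDiffractionMeasure μ x w η)
    (k t : E) : (fun f : Hull f₀ => (∑ p, w p • spectralAtom μ h k (x p) : Lp ℂ 2 μ) (-t +ᵥ f))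
      =ᵐ[μ] fun f => char (-t) k * (∑ p, w p • spectralAtom μ h k (x p) : Lp ℂ 2 μ) f := by
  have := hη.tempered
  set V : Lp ℂ 2 μ := ∑ p, w p • spectralAtom μ h k (x p)
  have hV := tendsto_weightedΓ_atomSeq μ h x w k
  have h1 := tendsto_shift_atomSeq (norm_eq_of_inner_eq (inner_weightedΓ_eq μ h x hη)) hV (-t)
  have hc : Continuous (Lp.compMeasurePreserving (E := ℂ) (p := 2)
      (-t +ᵥ · : Hull f₀ → Hull f₀) (measurePreserving_vadd (-t) μ)) :=
    (Lp.isometry_compMeasurePreserving (measurePreserving_vadd (-t) μ)).continuous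
  have h2 := (hc.tendsto V).comp hV
  have h3 : Lp.compMeasurePreserving (-t +ᵥ · : Hull f₀ → Hull f₀) (measurePreserving_vadd (-t) μ) V =
      char (-t) k • V :=
    tendsto_nhds_unique h2 (h1.congr fun n => (compMeasurePreserving_weightedΓ μ h x w _ t).symm)
  have h4 := Lp.coeFn_compMeasurePreserving V (measurePreserving_vadd (-t) μ)
  rw [h3] at h4
  exact h4.symm.trans (Lp.coeFn_smul _ _)

variable {μ x} in
theorem measure_singleton_eq (herg : ErgodicVAdd E (Hull f₀) μ) {k : E} {ψ : Lp ℂ 2 μ}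
    (hψ : IsNormalizedEigenfunction μ k ψ) {w : Fin m → ℂ} {η : Measure E}
    (hη : IsDiffractionMeasure μ x w η) :
    η {k} = ENNReal.ofReal (‖∑ p, w p * ⟪ψ, spectralAtom μ h k (x p)⟫_ℂ‖ ^ 2) := by
  have := hη.tempered
  set V : Lp ℂ 2 μ := ∑ p, w p • spectralAtom μ h k (x p) with hVdef
  -- The eigenvalue convention has the sign opposite to that of `char`; replacing `t` by `-t`
  -- reconciles them.
  have hchar : ∀ t : E, Complex.exp (2 * Real.pi * Complex.I * (⟪k, t⟫_ℝ : ℝ)) = char (-t) k := by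
    intro t
    rw [char, inner_neg_right]
    congr 1
    push_cast
    ring
  have hψ' : ∀ t : E, (fun f => ψ (t +ᵥ f)) =ᵐ[μ] fun f => char t k * ψ f := by
    intro t
    have := hψ.eigen (-t)
    rw [hchar, neg_neg] at this
    exact this
  have hV' : ∀ t : E, (fun f => V (t +ᵥ f)) =ᵐ[μ] fun f => char t k * V f := by
    intro t
    have := sum_spectralAtom_vadd μ h hη k (-t)
    rw [neg_neg] at this
    exact this
  rw [norm_sq_eq_of_tendsto_atomSeq (norm_eq_of_inner_eq (inner_weightedΓ_eq μ h x hη))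
    (tendsto_weightedΓ_atomSeq μ h x w k), ← hVdef,
    ← norm_inner_eq_norm_of_eigen (fun t => norm_char t k) hψ.norm_eq_one hψ' hV', hVdef, inner_sum]
  simp only [inner_smul_right]

end HullDiffraction

end FlatBranched

end

theorem mainTheorem3 {E : Type v} [NormedAddCommGroup E] [InnerProductSpace ℝ E]
    [FiniteDimensional ℝ E] [MeasurableSpace E] [BorelSpace E]
    (K : FlatBranched.FBSComplex.{u} E) (f₀ : C(E, K.Space))
    (hf₀ : FlatBranched.IsIsometricWinding K f₀)
    (μ : Measure (FlatBranched.Hull f₀)) [IsProbabilityMeasure μ]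
    [VAddInvariantMeasure E (FlatBranched.Hull f₀) μ] :
    -- the functions `Γ_x(φ)` are well defined elements of `L²`
    (∀ (x : K.Space) (φ : 𝓢(E, ℂ)),
      (∀ f : FlatBranched.Hull f₀,
        Summable fun y : (f.toMap ⁻¹' {x} : Set E) => φ (-(y : E))) ∧
      MemLp (FlatBranched.Γ f₀ x φ) 2 μ) ∧
    -- the diffraction measures and the embedding `Θ` exist
    (∀ (m : ℕ) (x : Fin m → K.Space),
      (∀ w : Fin m → ℂ, ∃ η : Measure E, FlatBranched.IsDiffractionMeasure μ x w η) ∧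
      (∃ ζ : FlatBranched.MatrixMeasure E m, FlatBranched.IsMatrixDiffractionMeasure μ x ζ) ∧
      ∀ ζ : FlatBranched.MatrixMeasure E m, FlatBranched.IsMatrixDiffractionMeasure μ x ζ →
        ∃ Θ : ζ.L2 →ₗᵢ[ℂ] Lp ℂ 2 μ, FlatBranched.IsDiffractionEmbedding μ x ζ Θ) ∧
    -- the partial diffraction amplitudes
    ∀ (k : E) (ψ : Lp ℂ 2 μ), FlatBranched.IsNormalizedEigenfunction μ k ψ →
      ∃ a : K.Space → ℂ, ∀ (m : ℕ) (x : Fin m → K.Space),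
        (∀ ζ : FlatBranched.MatrixMeasure E m, FlatBranched.IsMatrixDiffractionMeasure μ x ζ →
          ∀ Θ : ζ.L2 →ₗᵢ[ℂ] Lp ℂ 2 μ, FlatBranched.IsDiffractionEmbedding μ x ζ Θ →
            ∀ p : Fin m, ⟪ψ, Θ (ζ.indicatorTensor k p)⟫_ℂ = a (x p)) ∧
        (ErgodicVAdd E (FlatBranched.Hull f₀) μ →
          ∀ (w : Fin m → ℂ) (η : Measure E), FlatBranched.IsDiffractionMeasure μ x w η →
            η {k} = ENNReal.ofReal (‖∑ p, w p * a (x p)‖ ^ 2)) := by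
  have h := hf₀.hasUniformlyDiscreteFibres
  refine ⟨fun x φ => ⟨fun f => (h.summable_norm x φ f).of_norm, h.memLp_Γ μ x φ⟩,
    fun m x => ⟨FlatBranched.exists_isDiffractionMeasure μ h x,
      FlatBranched.exists_isMatrixDiffractionMeasure μ h x,
      fun ζ hζ => FlatBranched.exists_isDiffractionEmbedding μ h x hζ⟩, fun k ψ hψ =>
    -- The amplitude at `y` comes from the fibre over `y` alone, so it can be fixed before `m`, the
    -- points and the weights are given.
    ⟨fun y => ⟪ψ, FlatBranched.spectralAtom μ h k y⟫_ℂ, fun m x => ⟨fun ζ hζ Θ hΘ p => ?_,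
      fun herg w η hη => FlatBranched.measure_singleton_eq h herg hψ hη⟩⟩⟩
  rw [FlatBranched.map_indicatorTensor μ h hΘ]
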